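/- **Setting.** Let $M$ be an $m$-dimensional $C^\infty$ manifold (Hausdorff, $\sigma$-compact) with a $C^\infty$ foliation $\mathcal F$ of codimension $k$, $F=T\mathcal F\subseteq TM$ the tangent bundle of the leaves, $\nu\mathcal F=TM/F$ and $\psi:TM\to\nu\mathcal F$ the projection. All bundles are real, smooth and of finite rank. A function $f$ is *foliated* if $Yf=0$ for all $Y\in F$; a vector field $X$ is *foliated* if $[Y,X]\in\Gamma F$ for all local $Y\in\Gamma F$; the foliated sections of $\nu\mathcal F$ are those that are locally classes mod $F$ of foliated vector fields, with bracket $[[X_1],[X_2]]_{\nu\mathcal F}=[[X_1,X_2]]$. A *foliated structure* on a vector bundle $E\to M$ is a subsheaf $\Phi_{\mathcal F}(E)$ of the sheaf of smooth sections (the *foliated* sections) such that $E$ has, around each point, a local frame which is a basis of $\Phi_{\mathcal F}(E)$ over the foliated functions. A *transversal-Lie algebroid* over $(M,\mathcal F)$ is a foliated vector bundle $E$ with a bracket $[\,,\,]_E$ making $\Phi_{\mathcal F}(E)$ a sheaf of real Lie algebras, and a vector bundle morphism $\sharp_E:E\to\nu\mathcal F$ that sends foliated sections to foliated sections, such that $\sharp_E[e_1,e_2]_E=[\sharp_Ee_1,\sharp_Ee_2]_{\nu\mathcal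 F}$ and $[e_1,fe_2]_E=f[e_1,e_2]_E+(\sharp_Ee_1(f))e_2$ for all local foliated sections $e_1,e_2$ and foliated functions $f$. A *lift* of $\sharp_E$ is a smooth vector bundle morphism $\rho:E\to TM$ with $\psi\circ\rho=\sharp_E$. If $A$ is a Lie algebroid over $M$ and $B\subseteq A$ a vector subbundle whose sections are closed under $[\,,\,]_A$, a local section $a$ of $A$ is *$B$-foliated* if $[b,a]_A\in\Gamma B$ for all local $b\in\Gamma B$. The pair $(A,B)$ is a *minimally foliated Lie algebroid* if $\sharp_A$ restricts to an isomorphism $B\to F$ and $\Gamma A$ is locally spanned over $C^\infty$ by $B$-foliated sections. A *minimal extension* of $E$ is a Lie algebroid $A$ with a subbundle $B$ such that $(A,B)$ is minimally foliated, and a smooth surjective vector bundle morphism $\sigma:A\to E$ with kernel $B$, such that a local section $a$ of $A$ is $B$-foliated if and only if $\sigma a$ is foliated (so $A/B\cong E$ as foliated vector bundles), and $\psi\circ\sharp_A=\sharp_E\circ\sigma$. It is *bracket-preserving* if moreover $\sigma[a_1,a_2]_A=[\sigma a_1,\sigma a_2]_E$ for all local $B$-foliated sections $a_1,a_2$. **Proposition.**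 Let $E$ be a transversal-Lie algebroid over $(M,\mathcal F)$. (1) For every lift $\rho$ of $\sharp_E$ there is a unique Lie algebroid structure on $A_0=F\oplus E$ with anchor $\sharp_0=\mathrm{Id}+\rho$ and bracket satisfying $$[Y_1,Y_2]_0=[Y_1,Y_2],\quad [Y,e]_0=[Y,\rho e],\quad [e,Y]_0=[\rho e,Y],$$ $$[e_1,e_2]_0=\big([\rho e_1,\rho e_2]-\rho[e_1,e_2]_E\big)+[e_1,e_2]_E$$ for all local sections $Y,Y_1,Y_2$ of $F$ and all local foliated sections $e,e_1,e_2$ of $E$, where the unindexed brackets are Lie brackets of vector fields. With $B=F$ and $\sigma$ the projection $F\oplus E\to E$, it is a minimal extension of $E$, and it is bracket-preserving. (2) Conversely, for every minimal extension $(A,B,\sigma)$ of $E$ there exist a lift $\rho$ of $\sharp_E$, a foliated $2$-form $\lambda:\wedge^2E\to E$ with values in $\ker\sharp_E$ (*foliated*: $\lambda(e_1,e_2)$ is foliated for foliated $e_1,e_2$), a Lie algebroid structure on $F\oplus E$ which has the anchor $\mathrm{Id}+\rho$ and satisfies the bracket formulas of (1) with the last one replaced by $$[e_1,e_2]=\big([\rho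 e_1,\rho e_2]-\rho[e_1,e_2]_E\big)+[e_1,e_2]_E+\lambda(e_1,e_2),$$ and an isomorphism of Lie algebroids $\theta:F\oplus E\to A$ from this structure (the canonical extension twisted by $\lambda$) with $\sigma\circ\theta=\mathrm{pr}_E$. If the minimal extension is bracket-preserving, then $\lambda=0$. -/

import Mathlib

open scoped Manifold ContDiff
open Bundle TopologicalSpace

noncomputable section

namespace FolAlg

/-- The model space of an `m`-dimensional manifold. -/
abbrev Coord (m : ℕ) : Type := EuclideanSpace ℝ (Fin m)

section Basic

variable {m : ℕ} {M : Type*} [TopologicalSpace M] [ChartedSpace (Coord m) M]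

/-- `f` is a `C^∞` function on the open set `U` (its values outside `U` are irrelevant). -/
def SmoothFun (m : ℕ) {M : Type*} [TopologicalSpace M] [ChartedSpace (Coord m) M] (U : Opens M) (f : M → ℝ) : Prop :=
  ContMDiffOn (𝓡 m) 𝓘(ℝ, ℝ) ∞ f U

/-- The derivative `v f = df_x(v)` of a function in the direction of a tangent vector. -/
def dirDeriv (f : M → ℝ) (x : M) (v : TangentSpace (𝓡 m) x) : ℝ :=
  mfderiv (𝓡 m) 𝓘(ℝ, ℝ) f x v

/-- The derivative of the coordinate functions `φ` in the direction of a tangent vector. -/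
def coordDeriv (φ : M → Coord m) (x : M) (v : TangentSpace (𝓡 m) x) : Coord m :=
  mfderiv (𝓡 m) 𝓘(ℝ, Coord m) φ x v

/-- `s` is a `C^∞` section over the open set `U` of the vector bundle `W` with model fibre `R`
(the values of `s` outside `U` are irrelevant). -/
def SmoothSection (m : ℕ) {M : Type*} [TopologicalSpace M] [ChartedSpace (Coord m) M]
    (R : Type*) {W : M → Type*} [NormedAddCommGroup R] [NormedSpace ℝ R]
    [∀ x, TopologicalSpace (W x)] [TopologicalSpace (TotalSpace R W)] [FiberBundle R W]
    (U : Opens M) (s : Π x, W x) : Prop :=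
  ContMDiffOn (𝓡 m) ((𝓡 m).prod 𝓘(ℝ, R)) ∞ (fun x => (⟨x, s x⟩ : TotalSpace R W)) U

/-- A `C^∞` vector field on `U`. -/
def SmoothVF [IsManifold (𝓡 m) ∞ M] (U : Opens M) (X : Π x : M, TangentSpace (𝓡 m) x) : Prop :=
  SmoothSection m (Coord m) (W := (TangentSpace (𝓡 m) : M → Type)) U X

/-- The Lie bracket of vector fields. -/
def lieVF (X Y : Π x : M, TangentSpace (𝓡 m) x) (x : M) : TangentSpace (𝓡 m) x :=
  VectorField.mlieBracket (𝓡 m) X Y x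

end Basic

/-- A `C^∞` foliation of codimension `k` of the `m`-dimensional manifold `M`, given by the tangent
spaces `F_x` of its leaves: around each point there are coordinates of the `C^∞` structure of `M`,
`(x^1, …, x^k, y^1, …, y^{m-k})`, in which the leaves are `x^i = const`. -/
structure Foliation (m k : ℕ) (M : Type*) [TopologicalSpace M] [ChartedSpace (Coord m) M] where
  codim_le : k ≤ m
  /-- The tangent bundle `F` of the leaves. -/
  tangent : (x : M) → Submodule ℝ (TangentSpace (𝓡 m) x)
  adapted : ∀ x : M, ∃ φ ∈ IsManifold.maximalAtlas (𝓡 m) ∞ M, x ∈ φ.source ∧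
    ∀ y ∈ φ.source, ∀ v : TangentSpace (𝓡 m) y, v ∈ tangent y ↔
      ∀ i : Fin m, (i : ℕ) < k →
        coordDeriv φ y v i = 0

namespace Foliation

variable {m k : ℕ} {M : Type*} [TopologicalSpace M] [ChartedSpace (Coord m) M]

/-- A foliated function on `U`: smooth, with zero derivative along the leaves. -/
def IsFolFun (𝓕 : Foliation m k M) (U : Opens M) (f : M → ℝ) : Prop :=
  SmoothFun m U f ∧ ∀ x ∈ U, ∀ v ∈ 𝓕.tangent x, dirDeriv f x v = 0

variable [IsManifold (𝓡 m) ∞ M]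

/-- A foliated vector field on `U`: its brackets with vector fields tangent to the leaves are
tangent to the leaves. -/
def IsFolVF (𝓕 : Foliation m k M) (U : Opens M) (X : Π x : M, TangentSpace (𝓡 m) x) : Prop :=
  SmoothVF U X ∧ ∀ V : Opens M, V ≤ U → ∀ Y : Π x : M, TangentSpace (𝓡 m) x, SmoothVF V Y →
    (∀ x ∈ V, Y x ∈ 𝓕.tangent x) → ∀ x ∈ V, lieVF Y X x ∈ 𝓕.tangent x

/-- The fibre at `x` of the transversal bundle `νℱ = TM / F`. -/
abbrev Normal (𝓕 : Foliation m k M) (x : M) : Type :=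
  TangentSpace (𝓡 m) x ⧸ 𝓕.tangent x

/-- The projection `ψ : TM → νℱ`. -/
def toNormal (𝓕 : Foliation m k M) (x : M) : TangentSpace (𝓡 m) x →ₗ[ℝ] 𝓕.Normal x :=
  (𝓕.tangent x).mkQ

/-- A foliated section of `νℱ` over `U`: locally the class mod `F` of a foliated vector field. -/
def IsFolNormal (𝓕 : Foliation m k M) (U : Opens M) (n : Π x, 𝓕.Normal x) : Prop :=
  ∀ x ∈ U, ∃ V : Opens M, x ∈ V ∧ V ≤ U ∧ ∃ X, 𝓕.IsFolVF V X ∧ ∀ y ∈ V, 𝓕.toNormal y (X y) = n y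

end Foliation

section Transversal

variable {m k : ℕ} {M : Type*} [TopologicalSpace M] [ChartedSpace (Coord m) M]

/-- A foliated structure on the vector bundle `E`: a subsheaf of the sheaf of smooth sections, the
foliated sections, which locally has a frame of `E` as a basis over the foliated functions. -/
structure FoliatedStructure (𝓕 : Foliation m k M) (R : Type*) (E : M → Type*)
    [NormedAddCommGroup R] [NormedSpace ℝ R]
    [∀ x, AddCommGroup (E x)] [∀ x, Module ℝ (E x)] [∀ x, TopologicalSpace (E x)]
    [TopologicalSpace (TotalSpace R E)] [FiberBundle R E] where
  /-- `IsFol U e`: the section `e` is foliated on `U`. -/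
  IsFol : Opens M → (Π x, E x) → Prop
  congr : ∀ (U : Opens M) (e e' : Π x, E x), (∀ x ∈ U, e x = e' x) → IsFol U e → IsFol U e'
  restrict : ∀ (U V : Opens M) (e : Π x, E x), V ≤ U → IsFol U e → IsFol V e
  glue : ∀ (U : Opens M) (e : Π x, E x),
    (∀ x ∈ U, ∃ V : Opens M, x ∈ V ∧ V ≤ U ∧ IsFol V e) → IsFol U e
  frame : ∀ x₀ : M, ∃ U : Opens M, x₀ ∈ U ∧ ∃ (r : ℕ) (b : Fin r → Π x, E x),
    (∀ i, SmoothSection m R U (b i)) ∧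
    (∀ x ∈ U, LinearIndependent ℝ (fun i => b i x) ∧
      Submodule.span ℝ (Set.range fun i => b i x) = ⊤) ∧
    ∀ V : Opens M, V ≤ U → ∀ e : Π x, E x, IsFol V e ↔
      ∃ f : Fin r → M → ℝ, (∀ i, 𝓕.IsFolFun V (f i)) ∧ ∀ x ∈ V, e x = ∑ i, f i x • b i x

/-- An `ℱ`-transversal-Lie algebroid structure on the foliated vector bundle `E`: a transversal
anchor `♯ : E → νℱ` and a bracket of the sheaf of foliated sections. Since the brackets over the
various open sets commute with restrictions, they are recorded by one operation, which has a
meaning (and satisfies laws) only on sections that are foliated on an open set `U`, and there only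
at the points of `U`. -/
structure TransLieAlgebroid [IsManifold (𝓡 m) ∞ M] {𝓕 : Foliation m k M} {R : Type*}
    {E : M → Type*} [NormedAddCommGroup R] [NormedSpace ℝ R]
    [∀ x, AddCommGroup (E x)] [∀ x, Module ℝ (E x)] [∀ x, TopologicalSpace (E x)]
    [TopologicalSpace (TotalSpace R E)] [FiberBundle R E]
    (Φ : FoliatedStructure 𝓕 R E) where
  /-- The transversal anchor `♯_E`. -/
  anchor : Π x, E x →ₗ[ℝ] 𝓕.Normal x
  anchor_fol : ∀ (U : Opens M) (e : Π x, E x), Φ.IsFol U e →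
    𝓕.IsFolNormal U (fun x => anchor x (e x))
  /-- The bracket `[ , ]_E` of foliated sections. -/
  bracket : (Π x, E x) → (Π x, E x) → Π x, E x
  bracket_congr : ∀ (U : Opens M) (e₁ e₁' e₂ e₂' : Π x, E x), Φ.IsFol U e₁ → Φ.IsFol U e₂ →
    (∀ x ∈ U, e₁ x = e₁' x) → (∀ x ∈ U, e₂ x = e₂' x) →
    ∀ x ∈ U, bracket e₁ e₂ x = bracket e₁' e₂' x
  bracket_fol : ∀ (U : Opens M) (e₁ e₂ : Π x, E x), Φ.IsFol U e₁ → Φ.IsFol U e₂ →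
    Φ.IsFol U (bracket e₁ e₂)
  bracket_add : ∀ (U : Opens M) (e₁ e₂ e₃ : Π x, E x), Φ.IsFol U e₁ → Φ.IsFol U e₂ →
    Φ.IsFol U e₃ → ∀ x ∈ U, bracket e₁ (e₂ + e₃) x = bracket e₁ e₂ x + bracket e₁ e₃ x
  bracket_smul : ∀ (U : Opens M) (e₁ e₂ : Π x, E x) (c : ℝ), Φ.IsFol U e₁ → Φ.IsFol U e₂ →
    ∀ x ∈ U, bracket e₁ (c • e₂) x = c • bracket e₁ e₂ x
  bracket_skew : ∀ (U : Opens M) (e₁ e₂ : Π x, E x), Φ.IsFol U e₁ → Φ.IsFol U e₂ →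
    ∀ x ∈ U, bracket e₁ e₂ x = -bracket e₂ e₁ x
  jacobi : ∀ (U : Opens M) (e₁ e₂ e₃ : Π x, E x), Φ.IsFol U e₁ → Φ.IsFol U e₂ → Φ.IsFol U e₃ →
    ∀ x ∈ U, bracket e₁ (bracket e₂ e₃) x + bracket e₂ (bracket e₃ e₁) x
      + bracket e₃ (bracket e₁ e₂) x = 0
  /-- `♯[e₁,e₂] = [♯e₁,♯e₂]_{νℱ}`, the latter being the class of `[X₁,X₂]` for foliated vector
  fields `X₁, X₂` with classes `♯e₁, ♯e₂`. -/
  anchor_bracket : ∀ (U : Opens M) (e₁ e₂ : Π x, E x) (X₁ X₂ : Π x : M, TangentSpace (𝓡 m) x),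
    Φ.IsFol U e₁ → Φ.IsFol U e₂ → 𝓕.IsFolVF U X₁ → 𝓕.IsFolVF U X₂ →
    (∀ x ∈ U, 𝓕.toNormal x (X₁ x) = anchor x (e₁ x)) →
    (∀ x ∈ U, 𝓕.toNormal x (X₂ x) = anchor x (e₂ x)) →
    ∀ x ∈ U, anchor x (bracket e₁ e₂ x) = 𝓕.toNormal x (lieVF X₁ X₂ x)
  /-- `[e₁, f e₂] = f [e₁,e₂] + (♯e₁)(f) e₂`, where `(♯e₁)(f)(x) = v f` for any representative
  `v` of `♯e₁(x)`. -/
  leibniz : ∀ (U : Opens M) (e₁ e₂ : Π x, E x) (f : M → ℝ), Φ.IsFol U e₁ → Φ.IsFol U e₂ →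
    𝓕.IsFolFun U f → ∀ x ∈ U, ∀ v : TangentSpace (𝓡 m) x, 𝓕.toNormal x v = anchor x (e₁ x) →
    bracket e₁ (fun y => f y • e₂ y) x = f x • bracket e₁ e₂ x + dirDeriv f x v • e₂ x

end Transversal

section Algebroid

variable {m k : ℕ} {M : Type*} [TopologicalSpace M] [ChartedSpace (Coord m) M]

section Ambient

variable (m) (R : Type*) {W : M → Type*}
  [NormedAddCommGroup R] [NormedSpace ℝ R]
  [∀ x, AddCommGroup (W x)] [∀ x, Module ℝ (W x)] [∀ x, TopologicalSpace (W x)]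
  [TopologicalSpace (TotalSpace R W)] [FiberBundle R W]

/-- The subspaces `S x` are the fibres of a smooth vector subbundle of `W`: they have local smooth
frames. (`W` itself is the subbundle `fun _ => ⊤`; vector bundles that carry Lie algebroids are
presented as subbundles of some `W`.) -/
def IsVectorSubbundle (S : Π x, Submodule ℝ (W x)) : Prop :=
  ∀ x₀ : M, ∃ U : Opens M, x₀ ∈ U ∧ ∃ (r : ℕ) (b : Fin r → Π x, W x),
    (∀ i, SmoothSection m R U (b i)) ∧
    ∀ x ∈ U, LinearIndependent ℝ (fun i => b i x) ∧
      Submodule.span ℝ (Set.range fun i => b i x) = S x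

/-- `s` is a smooth section over `U` of the subbundle with fibres `S x`. -/
def SmoothSubSection {S : Π x, Submodule ℝ (W x)} (U : Opens M) (s : Π x, S x) : Prop :=
  SmoothSection m R U (fun x => (s x : W x))

variable [VectorBundle ℝ R W]

/-- The space `Γ S` of global smooth sections of the subbundle with fibres `S x`. -/
def Sec (S : Π x, Submodule ℝ (W x)) : Submodule ℝ (Π x, S x) where
  carrier := {s | SmoothSubSection m R ⊤ s}
  add_mem' {a b} ha hb := by
    exact ContMDiffOn.add_section (s := fun x => (a x : W x)) (t := fun x => (b x : W x)) ha hb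
  zero_mem' := by
    exact (contMDiff_zeroSection ℝ W).contMDiffOn
  smul_mem' c a ha := by
    exact ContMDiffOn.const_smul_section (s := fun x => (a x : W x)) ha

variable {m R}

/-- The product of a smooth function and a section. -/
def mulSec {S : Π x, Submodule ℝ (W x)} (f : M → ℝ) (hf : SmoothFun m ⊤ f) (s : Sec m R S) :
    Sec m R S :=
  ⟨fun x => f x • s.1 x, by
    exact ContMDiffOn.smul_section (s := fun x => (s.1 x : W x)) hf s.2⟩

variable (m R) [IsManifold (𝓡 m) ∞ M]

/-- A Lie algebroid structure on the vector bundle `A` with fibres `S x`. -/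
structure LieAlgebroid (S : Π x, Submodule ℝ (W x)) where
  isVectorSubbundle : IsVectorSubbundle m R S
  /-- The anchor `♯_A : A → TM`. -/
  anchor : Π x, S x →ₗ[ℝ] TangentSpace (𝓡 m) x
  anchor_smooth : ∀ (U : Opens M) (s : Π x, S x), SmoothSubSection m R U s →
    SmoothVF U (fun x => anchor x (s x))
  /-- The bracket `[ , ]_A` on `Γ A`. -/
  bracket : Sec m R S →ₗ[ℝ] Sec m R S →ₗ[ℝ] Sec m R S
  bracket_self : ∀ a, bracket a a = 0
  jacobi : ∀ a b c, bracket a (bracket b c) + bracket b (bracket c a) + bracket c (bracket a b) = 0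
  anchor_bracket : ∀ (a b : Sec m R S) (x : M), anchor x ((bracket a b).1 x) =
    lieVF (fun y => anchor y (a.1 y)) (fun y => anchor y (b.1 y)) x
  leibniz : ∀ (a b : Sec m R S) (f : M → ℝ) (hf : SmoothFun m ⊤ f) (x : M),
    (bracket a (mulSec f hf b)).1 x =
      f x • (bracket a b).1 x + dirDeriv f x (anchor x (a.1 x)) • b.1 x

variable {m R} {S : Π x, Submodule ℝ (W x)}

/-- The section `a` of `A` is `B`-foliated on `U`: there `[b, a]` is a section of `B` whenever
`b` is. -/
def LieAlgebroid.IsBFol (L : LieAlgebroid m R S) (B : Π x, Submodule ℝ (W x)) (U : Opens M)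
    (a : Sec m R S) : Prop :=
  ∀ V : Opens M, V ≤ U → ∀ b : Sec m R S, (∀ x ∈ V, (b.1 x : W x) ∈ B x) →
    ∀ x ∈ V, ((L.bracket b a).1 x : W x) ∈ B x

/-- `(A, B)` is a minimally foliated Lie algebroid over `(M, ℱ)`. -/
structure IsMinimallyFoliated (𝓕 : Foliation m k M) (L : LieAlgebroid m R S)
    (B : Π x, Submodule ℝ (W x)) : Prop where
  le : ∀ x, B x ≤ S x
  isVectorSubbundle : IsVectorSubbundle m R B
  bracket_mem : ∀ b₁ b₂ : Sec m R S, (∀ x, (b₁.1 x : W x) ∈ B x) → (∀ x, (b₂.1 x : W x) ∈ B x) →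
    ∀ x, ((L.bracket b₁ b₂).1 x : W x) ∈ B x
  /-- `♯_A(B) = F`. -/
  map_anchor : ∀ x (v : TangentSpace (𝓡 m) x),
    v ∈ 𝓕.tangent x ↔ ∃ b : S x, (b : W x) ∈ B x ∧ L.anchor x b = v
  /-- Locally, `Γ A` is spanned by `B`-foliated sections over the smooth functions. -/
  generation : ∀ (a : Sec m R S) (x₀ : M), ∃ U : Opens M, x₀ ∈ U ∧
    ∃ (r : ℕ) (c : Fin r → Sec m R S) (f : Fin r → M → ℝ),
      (∀ i, L.IsBFol B U (c i)) ∧ (∀ i, SmoothFun m U (f i)) ∧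
      ∀ x ∈ U, a.1 x = ∑ i, f i x • (c i).1 x
  /-- `♯_A : B → F` is an isomorphism. -/
  anchor_injective : ∀ x (b : S x), (b : W x) ∈ B x → L.anchor x b = 0 → b = 0

variable {𝓕 : Foliation m k M} {RE : Type*} {E : M → Type*}
  [NormedAddCommGroup RE] [NormedSpace ℝ RE]
  [∀ x, AddCommGroup (E x)] [∀ x, Module ℝ (E x)] [∀ x, TopologicalSpace (E x)]
  [TopologicalSpace (TotalSpace RE E)] [FiberBundle RE E]
  {Φ : FoliatedStructure 𝓕 RE E}

/-- The Lie algebroid `A` is a minimal extension of the transversal-Lie algebroid `E`, by means of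
the foliation `B` of `A` and of `σ : A → E`: `(A, B)` is a minimally foliated Lie algebroid, `σ`
induces an isomorphism of foliated vector bundles `A / B ≅ E` (the foliated sections of `A / B` are
the classes of the `B`-foliated sections), and `ψ ∘ ♯_A = ♯_E ∘ σ`. -/
structure IsMinimalExtension (T : TransLieAlgebroid Φ) (L : LieAlgebroid m R S)
    (B : Π x, Submodule ℝ (W x)) (σ : Π x, S x →ₗ[ℝ] E x) : Prop where
  foliated : IsMinimallyFoliated 𝓕 L B
  smooth : ∀ (U : Opens M) (s : Π x, S x), SmoothSubSection m R U s →
    SmoothSection m RE U (fun x => σ x (s x))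
  surjective : ∀ x, Function.Surjective (σ x)
  ker : ∀ x (a : S x), σ x a = 0 ↔ (a : W x) ∈ B x
  isFol_iff : ∀ (U : Opens M) (a : Sec m R S),
    Φ.IsFol U (fun x => σ x (a.1 x)) ↔ L.IsBFol B U a
  anchor_comm : ∀ x (a : S x), 𝓕.toNormal x (L.anchor x a) = T.anchor x (σ x a)

/-- `σ` is moreover compatible with the bracket that `A / B` gets from `A` and with that of `E`,
i.e. `A / B ≅ E` is an isomorphism of transversal-Lie algebroids. -/
def PreservesBrackets (T : TransLieAlgebroid Φ) (L : LieAlgebroid m R S)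
    (B : Π x, Submodule ℝ (W x)) (σ : Π x, S x →ₗ[ℝ] E x) : Prop :=
  ∀ (U : Opens M) (a₁ a₂ : Sec m R S), L.IsBFol B U a₁ → L.IsBFol B U a₂ → ∀ x ∈ U,
    σ x ((L.bracket a₁ a₂).1 x) =
      T.bracket (fun y => σ y (a₁.1 y)) (fun y => σ y (a₂.1 y)) x

/-- An isomorphism of Lie algebroids over the identity of `M`. -/
structure IsLieAlgebroidIso {R' : Type*} {W' : M → Type*}
    [NormedAddCommGroup R'] [NormedSpace ℝ R']
    [∀ x, AddCommGroup (W' x)] [∀ x, Module ℝ (W' x)] [∀ x, TopologicalSpace (W' x)]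
    [TopologicalSpace (TotalSpace R' W')] [FiberBundle R' W'] [VectorBundle ℝ R' W']
    {S' : Π x, Submodule ℝ (W' x)}
    (L : LieAlgebroid m R S) (L' : LieAlgebroid m R' S') (θ : Π x, S x ≃ₗ[ℝ] S' x) : Prop where
  smooth : ∀ (U : Opens M) (s : Π x, S x), SmoothSubSection m R U s →
    SmoothSubSection m R' U (fun x => θ x (s x))
  smooth_symm : ∀ (U : Opens M) (s : Π x, S' x), SmoothSubSection m R' U s →
    SmoothSubSection m R U (fun x => (θ x).symm (s x))
  anchor : ∀ x (a : S x), L'.anchor x (θ x a) = L.anchor x a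
  bracket : ∀ (a b : Sec m R S) (a' b' : Sec m R' S'), (∀ x, a'.1 x = θ x (a.1 x)) →
    (∀ x, b'.1 x = θ x (b.1 x)) → ∀ x, (L'.bracket a' b').1 x = θ x ((L.bracket a b).1 x)

end Ambient

section Canonical

variable [IsManifold (𝓡 m) ∞ M] {𝓕 : Foliation m k M} {R : Type*} {E : M → Type*}
  [NormedAddCommGroup R] [NormedSpace ℝ R]
  [∀ x, AddCommGroup (E x)] [∀ x, Module ℝ (E x)] [∀ x, TopologicalSpace (E x)]
  [TopologicalSpace (TotalSpace R E)] [FiberBundle R E]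
  {Φ : FoliatedStructure 𝓕 R E}

/-- `ρ : E → TM` is a lift of the transversal anchor: a smooth vector bundle morphism with
`ψ ∘ ρ = ♯_E`. -/
structure IsLift (T : TransLieAlgebroid Φ) (ρ : Π x : M, E x →ₗ[ℝ] TangentSpace (𝓡 m) x) :
    Prop where
  smooth : ∀ (U : Opens M) (e : Π x, E x), SmoothSection m R U e → SmoothVF U (fun x => ρ x (e x))
  proj : ∀ x (e : E x), 𝓕.toNormal x (ρ x e) = T.anchor x e

/-- `μ` is a (foliated, in particular smooth) `2`-form on `E` with values in `ker ♯_E ⊆ E`. -/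
structure IsTwist (T : TransLieAlgebroid Φ) (μ : Π x, E x →ₗ[ℝ] E x →ₗ[ℝ] E x) : Prop where
  alternating : ∀ x (e : E x), μ x e e = 0
  anchor_zero : ∀ x (e₁ e₂ : E x), T.anchor x (μ x e₁ e₂) = 0
  foliated : ∀ (U : Opens M) (e₁ e₂ : Π x, E x), Φ.IsFol U e₁ → Φ.IsFol U e₂ →
    Φ.IsFol U (fun x => μ x (e₁ x) (e₂ x))

variable (𝓕 E)

/-- The fibres of the subbundle `F ⊕ E` of `TM ⊕ E`. -/
def sumBundle (x : M) :
    Submodule ℝ (((TangentSpace (𝓡 m) : M → Type) ×ᵇ E) x) :=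
  Submodule.prod (𝓕.tangent x) (⊤ : Submodule ℝ (E x))

/-- The fibres of the subbundle `F = F ⊕ 0` of `F ⊕ E`. -/
def leafBundle (x : M) :
    Submodule ℝ (((TangentSpace (𝓡 m) : M → Type) ×ᵇ E) x) :=
  Submodule.prod (𝓕.tangent x) (⊥ : Submodule ℝ (E x))

variable {𝓕 E}

/-- The component `F ⊕ E → F ⊆ TM`. -/
def leafPart (x : M) : sumBundle 𝓕 E x →ₗ[ℝ] TangentSpace (𝓡 m) x :=
  (LinearMap.fst ℝ (TangentSpace (𝓡 m) x) (E x)).comp (sumBundle 𝓕 E x).subtype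

/-- The component `F ⊕ E → E`. -/
def transPart (x : M) : sumBundle 𝓕 E x →ₗ[ℝ] E x :=
  (LinearMap.snd ℝ (TangentSpace (𝓡 m) x) (E x)).comp (sumBundle 𝓕 E x).subtype

variable [VectorBundle ℝ R E]

/-- `L` is the canonical Lie algebroid structure of `F ⊕ E` associated with the lift `ρ`, twisted
by the addition of the form `μ`; it is the canonical structure itself if `μ = 0`.
The bracket formulas are between local sections: `a₁, a₂` are sections of `F`, respectively
foliated sections of `E`, on an open set `U`, and the formulas hold on `U`. -/
structure IsTwistedCanonical (T : TransLieAlgebroid Φ)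
    (ρ : Π x : M, E x →ₗ[ℝ] TangentSpace (𝓡 m) x) (μ : Π x, E x →ₗ[ℝ] E x →ₗ[ℝ] E x)
    (L : LieAlgebroid m (Coord m × R) (sumBundle 𝓕 E)) : Prop where
  /-- The anchor is `Id + ρ`. -/
  anchor_eq : ∀ x (a : sumBundle 𝓕 E x), L.anchor x a = leafPart x a + ρ x (transPart x a)
  /-- `[Y₁, Y₂]₀ = [Y₁, Y₂]`. -/
  bracket_leaf_leaf : ∀ (U : Opens M) (a₁ a₂ : Sec m (Coord m × R) (sumBundle 𝓕 E)),
    (∀ x ∈ U, transPart x (a₁.1 x) = 0) → (∀ x ∈ U, transPart x (a₂.1 x) = 0) → ∀ x ∈ U,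
    leafPart x ((L.bracket a₁ a₂).1 x) =
      lieVF (fun y => leafPart y (a₁.1 y)) (fun y => leafPart y (a₂.1 y)) x ∧
    transPart x ((L.bracket a₁ a₂).1 x) = 0
  /-- `[Y, e]₀ = [Y, ρ e]`. -/
  bracket_leaf_trans : ∀ (U : Opens M) (a₁ a₂ : Sec m (Coord m × R) (sumBundle 𝓕 E)),
    (∀ x ∈ U, transPart x (a₁.1 x) = 0) → (∀ x ∈ U, leafPart x (a₂.1 x) = 0) →
    Φ.IsFol U (fun y => transPart y (a₂.1 y)) → ∀ x ∈ U,
    leafPart x ((L.bracket a₁ a₂).1 x) =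
      lieVF (fun y => leafPart y (a₁.1 y)) (fun y => ρ y (transPart y (a₂.1 y))) x ∧
    transPart x ((L.bracket a₁ a₂).1 x) = 0
  /-- `[e, Y]₀ = [ρ e, Y]`. -/
  bracket_trans_leaf : ∀ (U : Opens M) (a₁ a₂ : Sec m (Coord m × R) (sumBundle 𝓕 E)),
    (∀ x ∈ U, leafPart x (a₁.1 x) = 0) → (∀ x ∈ U, transPart x (a₂.1 x) = 0) →
    Φ.IsFol U (fun y => transPart y (a₁.1 y)) → ∀ x ∈ U,
    leafPart x ((L.bracket a₁ a₂).1 x) =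
      lieVF (fun y => ρ y (transPart y (a₁.1 y))) (fun y => leafPart y (a₂.1 y)) x ∧
    transPart x ((L.bracket a₁ a₂).1 x) = 0
  /-- `[e₁, e₂]₀ = ([ρ e₁, ρ e₂] - ρ [e₁, e₂]_E) + [e₁, e₂]_E`, plus `μ(e₁, e₂)`. -/
  bracket_trans_trans : ∀ (U : Opens M) (a₁ a₂ : Sec m (Coord m × R) (sumBundle 𝓕 E)),
    (∀ x ∈ U, leafPart x (a₁.1 x) = 0) → (∀ x ∈ U, leafPart x (a₂.1 x) = 0) →
    Φ.IsFol U (fun y => transPart y (a₁.1 y)) → Φ.IsFol U (fun y => transPart y (a₂.1 y)) →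
    ∀ x ∈ U,
    leafPart x ((L.bracket a₁ a₂).1 x) =
      lieVF (fun y => ρ y (transPart y (a₁.1 y))) (fun y => ρ y (transPart y (a₂.1 y))) x
        - ρ x (T.bracket (fun y => transPart y (a₁.1 y)) (fun y => transPart y (a₂.1 y)) x) ∧
    transPart x ((L.bracket a₁ a₂).1 x) =
      T.bracket (fun y => transPart y (a₁.1 y)) (fun y => transPart y (a₂.1 y)) x
        + μ x (transPart x (a₁.1 x)) (transPart x (a₂.1 x))

end Canonical

end Algebroid

end FolAlg

end

open scoped Manifold ContDiff
open Bundle TopologicalSpace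

noncomputable section

/-! Everything rests on one model: the fibre product of TM and E over νℱ, whose sections are the
pairs (X, e) with ψX = ♯e. If e = ∑ f_i b_i and e' = ∑ g_j b_j in a frame of foliated sections, the
Leibniz rule forces the bracket of (X, e) and (X', e') to have the components [X, X'] and ∑ X(g_j)
b_j − ∑ X'(f_i) b_i + ∑ f_i g_j [b_i, b_j]_E. The second component is `transBracket`. It does not
depend on the frame (`bracketExpr_change_right`, `transBracket_eq`), because the transition
coefficients are foliated functions, and X differentiates such a function in a way that depends only
on ψX = ♯e. The two components are again compatible in νℱ (`IsLift.anchor_transBracket`), and the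
Jacobi identity (`IsLift.transBracket_jacobi`) reduces to that of E on the frame and to the
commutator formula for vector fields.

For (1), a lift ρ identifies F ⊕ E with the fibre product by (Y, e) ↦ (Y + ρe, e). The canonical
structure is the model bracket carried over, and the four formulas are its values on sections of F
and on foliated sections of E. Since such sections generate locally, anchor and Leibniz rule leave
no freedom (`IsTwistedCanonical.unique`). Bracketing with a section of F differentiates the frame
coefficients of e along the leaves, so B-foliated means foliated (`IsLift.isFol_iff_isBFol`).

For (2), a ↦ (♯a, σa) identifies A with the fibre product, since ♯ maps B = ker σ isomorphically
onto F. The difference between σ[a, b] and the model bracket is tensorial and vanishes if an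
argument lies in B, so it descends to a 2-form λ on E (`IsMinimalExtension.twist`). Its values lie
in ker ♯ because both brackets have the same anchor. It is foliated because brackets of B-foliated
sections are B-foliated, and it is zero if σ preserves their brackets, because they generate. The
lift is taken from a complement of F (`exists_lift_of_complement`), so that ρλ = 0 and the
F-component keeps its untwisted form. -/

namespace FolAlg

set_option linter.unusedSectionVars false
set_option linter.unusedVariables false

/-! ### Smooth functions, sections and vector fields; derivatives and cutoffs -/

section Calculus

variable {m : ℕ} {M : Type*} [TopologicalSpace M] [ChartedSpace (Coord m) M]

/-- `f` is `C^∞` at the point `x`. -/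
abbrev SmoothFunAt (m : ℕ) {M : Type*} [TopologicalSpace M] [ChartedSpace (Coord m) M]
    (f : M → ℝ) (x : M) : Prop :=
  ContMDiffAt (𝓡 m) 𝓘(ℝ, ℝ) ∞ f x

/-- `s` is `C^∞` at the point `x`. -/
abbrev SmoothSecAt (m : ℕ) {M : Type*} [TopologicalSpace M] [ChartedSpace (Coord m) M]
    (R : Type*) {W : M → Type*} [NormedAddCommGroup R] [NormedSpace ℝ R]
    [∀ x, TopologicalSpace (W x)] [TopologicalSpace (TotalSpace R W)] [FiberBundle R W]
    (s : Π x, W x) (x : M) : Prop :=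
  ContMDiffAt (𝓡 m) ((𝓡 m).prod 𝓘(ℝ, R)) ∞ (fun y => (⟨y, s y⟩ : TotalSpace R W)) x

/-- The vector field `X` is `C^∞` at the point `x`. -/
abbrev SmoothVFAt [IsManifold (𝓡 m) ∞ M] (X : Π x : M, TangentSpace (𝓡 m) x) (x : M) : Prop :=
  SmoothSecAt m (Coord m) (W := (TangentSpace (𝓡 m) : M → Type)) X x

theorem smoothFun_iff {U : Opens M} {f : M → ℝ} :
    SmoothFun m U f ↔ ∀ x ∈ U, SmoothFunAt m f x :=
  ⟨fun h x hx => h.contMDiffAt (U.isOpen.mem_nhds hx), fun h x hx => (h x hx).contMDiffWithinAt⟩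

theorem SmoothFun.at {U : Opens M} {f : M → ℝ} (h : SmoothFun m U f) {x : M} (hx : x ∈ U) :
    SmoothFunAt m f x := smoothFun_iff.1 h x hx

theorem SmoothFun.mono {U V : Opens M} {f : M → ℝ} (h : SmoothFun m U f) (hV : V ≤ U) :
    SmoothFun m V f := ContMDiffOn.mono h hV

theorem SmoothFunAt.mdiff {f : M → ℝ} {x : M} (h : SmoothFunAt m f x) :
    MDifferentiableAt (𝓡 m) 𝓘(ℝ, ℝ) f x := ContMDiffAt.mdifferentiableAt h (by simp)

section Bundle

variable {R : Type*} {W : M → Type*} [NormedAddCommGroup R] [NormedSpace ℝ R]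
    [∀ x, TopologicalSpace (W x)] [TopologicalSpace (TotalSpace R W)] [FiberBundle R W]

theorem smoothSection_iff {U : Opens M} {s : Π x, W x} :
    SmoothSection m R U s ↔ ∀ x ∈ U, SmoothSecAt m R s x :=
  ⟨fun h x hx => ContMDiffOn.contMDiffAt h (U.isOpen.mem_nhds hx),
    fun h x hx => (h x hx).contMDiffWithinAt⟩

theorem SmoothSection.at {U : Opens M} {s : Π x, W x} (h : SmoothSection m R U s) {x : M}
    (hx : x ∈ U) : SmoothSecAt m R s x := smoothSection_iff.1 h x hx

theorem SmoothSection.mono {U V : Opens M} {s : Π x, W x} (h : SmoothSection m R U s)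
    (hV : V ≤ U) : SmoothSection m R V s := ContMDiffOn.mono h hV

theorem SmoothSecAt.congr {s t : Π x, W x} {x : M} (h : SmoothSecAt m R s x)
    (hst : ∀ᶠ y in nhds x, t y = s y) : SmoothSecAt m R t x :=
  ContMDiffAt.congr_of_eventuallyEq h (hst.mono fun y hy => by simp [hy])

theorem SmoothSection.congr {U : Opens M} {s t : Π x, W x} (h : SmoothSection m R U s)
    (hst : ∀ y ∈ U, t y = s y) : SmoothSection m R U t :=
  ContMDiffOn.congr h fun y hy => by simp [hst y hy]

variable [∀ x, AddCommGroup (W x)] [∀ x, Module ℝ (W x)] [VectorBundle ℝ R W]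

theorem smoothSecAt_zero (x : M) : SmoothSecAt m R (fun x : M => (0 : W x)) x :=
  (contMDiff_zeroSection ℝ W).contMDiffAt

theorem SmoothSecAt.add {s t : Π x, W x} {x : M} (hs : SmoothSecAt m R s x)
    (ht : SmoothSecAt m R t x) : SmoothSecAt m R (fun y => s y + t y) x :=
  ContMDiffAt.add_section hs ht

theorem SmoothSecAt.sub {s t : Π x, W x} {x : M} (hs : SmoothSecAt m R s x)
    (ht : SmoothSecAt m R t x) : SmoothSecAt m R (fun y => s y - t y) x :=
  ContMDiffAt.sub_section hs ht

theorem SmoothSecAt.smul {f : M → ℝ} {s : Π x, W x} {x : M} (hf : SmoothFunAt m f x)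
    (hs : SmoothSecAt m R s x) : SmoothSecAt m R (fun y => f y • s y) x :=
  ContMDiffAt.smul_section hf hs

theorem SmoothSecAt.sum {ι : Type*} {J : Finset ι} {s : ι → Π x, W x} {x : M}
    (hs : ∀ i ∈ J, SmoothSecAt m R (s i) x) : SmoothSecAt m R (fun y => ∑ i ∈ J, s i y) x :=
  ContMDiffAt.sum_section hs

/-- The coefficients of a smooth section with respect to pointwise linearly independent smooth
sections are smooth. -/
theorem smoothFunAt_coeff [FiniteDimensional ℝ R] [ContMDiffVectorBundle ∞ R W (𝓡 m)]
    {ι : Type*} [Fintype ι] {b : ι → Π x, W x} {f : ι → M → ℝ} {s : Π x, W x} {x : M}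
    (hb : ∀ i, SmoothSecAt m R (b i) x) (hli : LinearIndependent ℝ (fun i => b i x))
    (hs : SmoothSecAt m R s x) (hf : ∀ᶠ y in nhds x, s y = ∑ i, f i y • b i y) (i : ι) :
    SmoothFunAt m (f i) x := by
  classical
  let e := trivializationAt R W x
  have hx : x ∈ e.baseSet := mem_baseSet_trivializationAt R W x
  let v : ι → M → R := fun i y => (e ⟨y, b i y⟩).2
  let w : M → R := fun y => (e ⟨y, s y⟩).2
  have hv : ∀ i, ContMDiffAt (𝓡 m) 𝓘(ℝ, R) ∞ (v i) x :=
    fun i => (Bundle.contMDiffAt_section x).1 (hb i)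
  have hw : ContMDiffAt (𝓡 m) 𝓘(ℝ, R) ∞ w x := (Bundle.contMDiffAt_section x).1 hs
  have hvi : LinearIndependent ℝ (fun i => v i x) := by
    have := hli.map' (e.linearEquivAt ℝ x hx).toLinearMap (LinearEquiv.ker _)
    exact this
  have hwv : ∀ᶠ y in nhds x, w y = ∑ i, f i y • v i y := by
    filter_upwards [hf, e.open_baseSet.mem_nhds hx] with y hy hyb
    have h1 : w y = e.linearEquivAt ℝ y hyb (s y) := rfl
    rw [h1, hy, map_sum]
    refine Finset.sum_congr rfl fun i _ => ?_
    rw [map_smul]; rfl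
  -- dual functionals
  obtain ⟨g, hg⟩ := (hvi.repr).exists_extend
  let ℓ : ι → R →L[ℝ] ℝ := fun i =>
    LinearMap.toContinuousLinearMap ((Finsupp.lapply i).comp g)
  have hℓ : ∀ i j, ℓ i (v j x) = if i = j then 1 else 0 := by
    intro i j
    have hmem : v j x ∈ Submodule.span ℝ (Set.range fun i => v i x) :=
      Submodule.subset_span ⟨j, rfl⟩
    have h1 : g (v j x) = hvi.repr ⟨v j x, hmem⟩ := by
      rw [← hg]; rfl
    have h2 : hvi.repr ⟨v j x, hmem⟩ = Finsupp.single j 1 := hvi.repr_eq_single j _ rfl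
    change (g (v j x)) i = _
    rw [h1, h2, Finsupp.single_apply]
    simp only [eq_comm]
  -- At x this matrix is the identity, so it stays invertible nearby and Cramer's rule gives the
  -- coefficients as quotients of smooth determinants. Linear independence suffices; the sections
  -- need not span.
  let A : M → Matrix ι ι ℝ := fun y i j => ℓ i (v j y)
  have hA : ∀ i j, SmoothFunAt m (fun y => A y i j) x := fun i j =>
    ((ℓ i).contDiff.contMDiff.contMDiffAt).comp x (hv j)
  have hAx : A x = 1 := by
    ext i j
    simp [A, hℓ, Matrix.one_apply]
  have hprod : ∀ (J : Finset ι) (h : ι → M → ℝ), (∀ i ∈ J, SmoothFunAt m (h i) x) →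
      SmoothFunAt m (fun y => ∏ i ∈ J, h i y) x := fun J h hh => ContMDiffAt.prod hh
  have hdetS : ∀ B : M → Matrix ι ι ℝ, (∀ i j, SmoothFunAt m (fun y => B y i j) x) →
      SmoothFunAt m (fun y => (B y).det) x := by
    intro B hB
    simp only [Matrix.det_apply]
    refine ContMDiffAt.sum fun σ _ => ?_
    have := hprod Finset.univ (fun i y => B y (σ i) i) (fun i _ => hB _ _)
    exact (contMDiffAt_const (c := ((Equiv.Perm.sign σ : ℤ) : ℝ))).mul this |>.congr_of_eventuallyEq
      (Filter.Eventually.of_forall fun y => by simp [Units.smul_def])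
  have hdet : SmoothFunAt m (fun y => (A y).det) x := hdetS A hA
  have hdet0 : ∀ᶠ y in nhds x, (A y).det ≠ 0 := by
    refine hdet.continuousAt.eventually_ne ?_
    rw [hAx]; simp
  have hcr : ∀ᶠ y in nhds x, f i y =
      ((A y).det)⁻¹ * ((A y).updateCol i (fun p => ℓ p (w y))).det := by
    filter_upwards [hdet0, hwv] with y hy hwy
    have hmul : (A y).mulVec (fun j => f j y) = fun p => ℓ p (w y) := by
      ext p
      rw [hwy]
      simp [Matrix.mulVec, dotProduct, A, mul_comm]
    rw [← hmul, ← Matrix.cramer_apply, Matrix.cramer_eq_adjugate_mulVec, Matrix.mulVec_mulVec,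
      Matrix.adjugate_mul, Matrix.smul_mulVec, Matrix.one_mulVec]
    simp [hy]
  refine ContMDiffAt.congr_of_eventuallyEq ?_ hcr
  have h1 : SmoothFunAt m (fun y => ((A y).det)⁻¹) x := by
    have : ContDiffAt ℝ ∞ (fun t : ℝ => t⁻¹) ((A x).det) :=
      contDiffAt_inv ℝ (by rw [hAx]; simp)
    exact this.contMDiffAt.comp x hdet
  refine ContMDiffAt.mul h1 (hdetS (fun y => (A y).updateCol i (fun p => ℓ p (w y))) ?_)
  intro p q
  by_cases hq : q = i
  · subst hq
    simp only [Matrix.updateCol_self]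
    exact ((ℓ p).contDiff.contMDiff.contMDiffAt).comp x hw
  · simp only [Matrix.updateCol_ne hq]
    exact hA p q

end Bundle

theorem SmoothFunAt.mul {f g : M → ℝ} {x : M} (hf : SmoothFunAt m f x) (hg : SmoothFunAt m g x) :
    SmoothFunAt m (fun y => f y * g y) x := ContMDiffAt.mul hf hg

theorem SmoothFun.mul {U : Opens M} {f g : M → ℝ} (hf : SmoothFun m U f) (hg : SmoothFun m U g) :
    SmoothFun m U (fun y => f y * g y) := ContMDiffOn.mul hf hg

theorem SmoothFun.sub {U : Opens M} {f g : M → ℝ} (hf : SmoothFun m U f) (hg : SmoothFun m U g) :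
    SmoothFun m U (fun y => f y - g y) := ContMDiffOn.sub hf hg

section DirDeriv

theorem dirDeriv_eq (f : M → ℝ) (x : M) (v : TangentSpace (𝓡 m) x) :
    dirDeriv f x v = mvfderiv (𝓡 m) f x v := rfl

variable {f g : M → ℝ} {x : M}

@[simp] theorem dirDeriv_zero_vec : dirDeriv (m := m) f x 0 = 0 := by simp [dirDeriv_eq]

theorem dirDeriv_add_vec (v w : TangentSpace (𝓡 m) x) :
    dirDeriv f x (v + w) = dirDeriv f x v + dirDeriv f x w := by simp [dirDeriv_eq]

theorem dirDeriv_sub_vec (v w : TangentSpace (𝓡 m) x) :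
    dirDeriv f x (v - w) = dirDeriv f x v - dirDeriv f x w := by simp [dirDeriv_eq]

theorem dirDeriv_smul_vec (c : ℝ) (v : TangentSpace (𝓡 m) x) :
    dirDeriv f x (c • v) = c * dirDeriv f x v := by simp [dirDeriv_eq]

theorem dirDeriv_sum_vec {ι : Type*} (J : Finset ι) (v : ι → TangentSpace (𝓡 m) x) :
    dirDeriv f x (∑ i ∈ J, v i) = ∑ i ∈ J, dirDeriv f x (v i) := by simp [dirDeriv_eq]

theorem dirDeriv_congr (h : ∀ᶠ y in nhds x, f y = g y) (v : TangentSpace (𝓡 m) x) :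
    dirDeriv f x v = dirDeriv g x v := by
  have h' : f =ᶠ[nhds x] g := h
  simp only [dirDeriv]
  rw [h'.mfderiv_eq]
  rfl

@[simp] theorem dirDeriv_const (c : ℝ) (v : TangentSpace (𝓡 m) x) :
    dirDeriv (fun _ => c) x v = 0 := by
  rw [dirDeriv_eq, mvfderiv_const]; rfl

theorem dirDeriv_add (hf : SmoothFunAt m f x) (hg : SmoothFunAt m g x)
    (v : TangentSpace (𝓡 m) x) :
    dirDeriv (fun y => f y + g y) x v = dirDeriv f x v + dirDeriv g x v := by
  rw [dirDeriv_eq, mvfderiv_fun_add (SmoothFunAt.mdiff hf) (SmoothFunAt.mdiff hg)]; rfl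

theorem dirDeriv_sub (hf : SmoothFunAt m f x) (hg : SmoothFunAt m g x)
    (v : TangentSpace (𝓡 m) x) :
    dirDeriv (fun y => f y - g y) x v = dirDeriv f x v - dirDeriv g x v := by
  rw [dirDeriv_eq, mvfderiv_fun_sub (SmoothFunAt.mdiff hf) (SmoothFunAt.mdiff hg)]; rfl

theorem dirDeriv_mul (hf : SmoothFunAt m f x) (hg : SmoothFunAt m g x)
    (v : TangentSpace (𝓡 m) x) :
    dirDeriv (fun y => f y * g y) x v = f x * dirDeriv g x v + dirDeriv f x v * g x := by
  rw [dirDeriv_eq, mvfderiv_fun_mul (SmoothFunAt.mdiff hf) (SmoothFunAt.mdiff hg)]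
  simp [dirDeriv_eq, mul_comm]

theorem dirDeriv_sum {ι : Type*} (J : Finset ι) {f : ι → M → ℝ}
    (hf : ∀ i ∈ J, SmoothFunAt m (f i) x) (v : TangentSpace (𝓡 m) x) :
    dirDeriv (fun y => ∑ i ∈ J, f i y) x v = ∑ i ∈ J, dirDeriv (f i) x v := by
  classical
  induction J using Finset.induction_on with
  | empty => simp
  | insert a J ha ih =>
    simp only [Finset.sum_insert ha]
    rw [dirDeriv_add (hf a (by simp)) (ContMDiffAt.sum fun i hi => hf i (by simp [hi])),
      ih fun i hi => hf i (by simp [hi])]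

variable [IsManifold (𝓡 m) ∞ M]

theorem SmoothFun.dirDeriv {U : Opens M} {f : M → ℝ} {X : Π x : M, TangentSpace (𝓡 m) x}
    (hf : SmoothFun m U f) (hX : SmoothVF U X) :
    SmoothFun m U (fun y => dirDeriv f y (X y)) := by
  have h1 : ContMDiffOn (𝓡 m).tangent 𝓘(ℝ, ℝ).tangent ∞
      (tangentMapWithin (𝓡 m) 𝓘(ℝ, ℝ) f U) (π (Coord m) (TangentSpace (𝓡 m)) ⁻¹' U) :=
    ContMDiffOn.contMDiffOn_tangentMapWithin hf (by simp) U.isOpen.uniqueMDiffOn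
  have h2 := h1.comp hX (fun y hy => hy)
  have h3 := (contMDiff_snd_tangentBundle_modelSpace ℝ 𝓘(ℝ, ℝ) (n := ∞)).contMDiffOn
    (s := Set.univ) |>.comp h2 (fun _ _ => trivial)
  refine ContMDiffOn.congr h3 fun y hy => ?_
  simp only [Function.comp, tangentMapWithin, FolAlg.dirDeriv]
  rw [mfderivWithin_of_isOpen U.isOpen hy]

theorem SmoothVFAt.mdiff {X : Π x : M, TangentSpace (𝓡 m) x} {x : M} (h : SmoothVFAt X x) :
    MDifferentiableAt (𝓡 m) ((𝓡 m).prod 𝓘(ℝ, Coord m))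
      (fun y => (⟨y, X y⟩ : TotalSpace (Coord m) (TangentSpace (𝓡 m) : M → Type))) x :=
  ContMDiffAt.mdifferentiableAt h (by simp)

theorem isManifold_of_le_infty {n : ℕ∞ω} (hn : n ≤ ∞) : IsManifold (𝓡 m) n M :=
  IsManifold.of_le hn

theorem two_le_infty : (2 : ℕ∞ω) ≤ ∞ := ENat.LEInfty.out

theorem three_le_infty : (3 : ℕ∞ω) ≤ ∞ := ENat.LEInfty.out

theorem SmoothVFAt.lieVF {X Y : Π x : M, TangentSpace (𝓡 m) x} {x : M}
    (hX : SmoothVFAt X x) (hY : SmoothVFAt Y x) : SmoothVFAt (lieVF X Y) x := by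
  have : IsManifold (𝓡 m) (((⊤ : ℕ∞) : ℕ∞ω) + 1) M := by
    simpa using (inferInstance : IsManifold (𝓡 m) ∞ M)
  have : IsManifold (𝓡 m) (minSmoothness ℝ 2) M :=
    isManifold_of_le_infty (by simpa using two_le_infty)
  have := ContMDiffAt.mlieBracket_vectorField (m := ⊤) (n := ⊤) (I := 𝓡 m) hX hY (by simp)
  exact this

theorem SmoothVF.lieVF {U : Opens M} {X Y : Π x : M, TangentSpace (𝓡 m) x}
    (hX : SmoothVF U X) (hY : SmoothVF U Y) : SmoothVF U (lieVF X Y) :=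
  smoothSection_iff.2 fun _ hx => SmoothVFAt.lieVF (SmoothSection.at hX hx) (SmoothSection.at hY hx)

variable {X Y Z : Π x : M, TangentSpace (𝓡 m) x}

theorem lieVF_congr {X' Y' : Π x : M, TangentSpace (𝓡 m) x}
    (hX : ∀ᶠ y in nhds x, X y = X' y) (hY : ∀ᶠ y in nhds x, Y y = Y' y) :
    lieVF X Y x = lieVF X' Y' x :=
  Filter.EventuallyEq.mlieBracket_vectorField_eq hX hY

theorem lieVF_swap : lieVF X Y x = -lieVF Y X x := VectorField.mlieBracket_swap_apply

theorem lieVF_self : lieVF X X x = 0 := by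
  have := VectorField.mlieBracket_self (I := 𝓡 m) (V := X)
  exact congrFun this x

theorem lieVF_add_right (hY : SmoothVFAt Y x) (hZ : SmoothVFAt Z x) :
    lieVF X (fun y => Y y + Z y) x = lieVF X Y x + lieVF X Z x := by
  have := isManifold_of_le_infty (m := m) (M := M) (n := 2) two_le_infty
  exact VectorField.mlieBracket_add_right (SmoothVFAt.mdiff hY) (SmoothVFAt.mdiff hZ)

theorem lieVF_smul_right (hf : SmoothFunAt m f x) (hY : SmoothVFAt Y x) :
    lieVF X (fun y => f y • Y y) x = dirDeriv f x (X x) • Y x + f x • lieVF X Y x := by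
  have := isManifold_of_le_infty (m := m) (M := M) (n := 2) two_le_infty
  exact VectorField.mlieBracket_smul_right (SmoothFunAt.mdiff hf) (SmoothVFAt.mdiff hY)

theorem lieVF_jacobi (hX : SmoothVFAt X x) (hY : SmoothVFAt Y x) (hZ : SmoothVFAt Z x) :
    lieVF X (lieVF Y Z) x = lieVF (lieVF X Y) Z x + lieVF Y (lieVF X Z) x := by
  have : IsManifold (𝓡 m) (minSmoothness ℝ 3) M :=
    isManifold_of_le_infty (by simpa using three_le_infty)
  have h2 : minSmoothness ℝ 2 ≤ ∞ := by simpa using two_le_infty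
  exact VectorField.leibniz_identity_mlieBracket_apply (hX.of_le h2) (hY.of_le h2) (hZ.of_le h2)

/-- Every tangent vector is the value of a vector field that is smooth near the point. -/
theorem exists_smoothVF_eq (v : TangentSpace (𝓡 m) x) :
    ∃ (U : Opens M) (Z : Π x : M, TangentSpace (𝓡 m) x), x ∈ U ∧ SmoothVF U Z ∧ Z x = v := by
  let e := trivializationAt (Coord m) (TangentSpace (𝓡 m) : M → Type) x
  have hx : x ∈ e.baseSet := mem_baseSet_trivializationAt _ _ x
  refine ⟨⟨e.baseSet, e.open_baseSet⟩, fun y => e.symm y (e ⟨x, v⟩).2, hx, ?_, ?_⟩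
  · refine (e.contMDiffOn_section_baseSet_iff).2 ?_
    refine ContMDiffOn.congr (contMDiffOn_const (c := (e ⟨x, v⟩).2)) fun y hy => ?_
    rw [e.apply_mk_symm hy]
  · exact e.symm_apply_apply_mk hx v

/-- The Lie bracket of vector fields is the commutator of derivations. -/
theorem dirDeriv_lieVF {U : Opens M} (hx : x ∈ U) (hf : SmoothFun m U f) (hX : SmoothVF U X)
    (hY : SmoothVF U Y) :
    dirDeriv f x (lieVF X Y x) =
      dirDeriv (fun y => dirDeriv f y (Y y)) x (X x) -
        dirDeriv (fun y => dirDeriv f y (X y)) x (Y x) := by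
  -- The proof compares coefficients of a field Z with Z x ≠ 0, which exists unless the tangent
  -- space is zero.
  rcases subsingleton_or_nontrivial (TangentSpace (𝓡 m) x) with hs | hs
  · rw [Subsingleton.elim (lieVF X Y x) 0, Subsingleton.elim (X x) 0, Subsingleton.elim (Y x) 0]
    simp
  obtain ⟨z, hz⟩ := exists_ne (0 : TangentSpace (𝓡 m) x)
  obtain ⟨V', Z, hxV, hZV, rfl⟩ := exists_smoothVF_eq z
  let V := U ⊓ V'
  have hxV : x ∈ V := ⟨hx, hxV⟩
  replace hf := hf.mono (V := V) inf_le_left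
  replace hX : SmoothVF V X := SmoothSection.mono hX inf_le_left
  replace hY : SmoothVF V Y := SmoothSection.mono hY inf_le_left
  have hZ : SmoothVF V Z := SmoothSection.mono hZV inf_le_right
  have hV : ∀ᶠ y in nhds x, y ∈ V := V.isOpen.mem_nhds hxV
  have hfx := hf.at hxV
  have hXx := SmoothSection.at hX hxV
  have hYx := SmoothSection.at hY hxV
  have hZx := SmoothSection.at hZ hxV
  -- The Jacobi identity for X, Y, fZ minus f times the one for X, Y, Z leaves exactly the
  -- commutator identity as a coefficient of Z x.
  have key : ∀ {P Q : Π x : M, TangentSpace (𝓡 m) x}, SmoothVF V P → SmoothVF V Q →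
      lieVF P (lieVF Q (fun y => f y • Z y)) x =
        dirDeriv (fun y => dirDeriv f y (Q y)) x (P x) • Z x + dirDeriv f x (Q x) • lieVF P Z x
        + (dirDeriv f x (P x) • lieVF Q Z x + f x • lieVF P (lieVF Q Z) x) := by
    intro P Q hP hQ
    rw [lieVF_congr (Filter.Eventually.of_forall fun _ => rfl)
      (Y' := fun y => dirDeriv f y (Q y) • Z y + f y • lieVF Q Z y)
      (hV.mono fun y hy => lieVF_smul_right (hf.at hy) (SmoothSection.at hZ hy))]
    have hfQ := (hf.dirDeriv hQ).at hxV
    have hQZ := SmoothSection.at (SmoothVF.lieVF hQ hZ) hxV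
    rw [lieVF_add_right (SmoothSecAt.smul hfQ hZx) (SmoothSecAt.smul hfx hQZ),
      lieVF_smul_right hfQ hZx, lieVF_smul_right hfx hQZ]
  have h1 := lieVF_jacobi hXx hYx (SmoothSecAt.smul hfx hZx)
  have h2 := lieVF_jacobi hXx hYx hZx
  rw [key hX hY, key hY hX, lieVF_smul_right hfx hZx, h2] at h1
  have h3 : (dirDeriv f x (lieVF X Y x) - (dirDeriv (fun y => dirDeriv f y (Y y)) x (X x) -
        dirDeriv (fun y => dirDeriv f y (X y)) x (Y x))) • Z x = 0 := by
    rw [← sub_eq_zero.2 h1.symm]; module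
  exact sub_eq_zero.1 ((smul_eq_zero.1 h3).resolve_right hz)

end DirDeriv

section Bump

variable [T2Space M] [IsManifold (𝓡 m) ∞ M]

theorem exists_bump (x : M) (U : Opens M) (hx : x ∈ U) :
    ∃ χ : M → ℝ, SmoothFun m ⊤ χ ∧ (∀ᶠ y in nhds x, χ y = 1) ∧ tsupport χ ⊆ U := by
  obtain ⟨χ, -, hχ⟩ := (SmoothBumpFunction.nhds_basis_tsupport (I := 𝓡 m) x).mem_iff.1
    (U.isOpen.mem_nhds hx)
  exact ⟨χ, χ.contMDiff.contMDiffOn, χ.eventuallyEq_one, hχ⟩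

variable {R : Type*} {W : M → Type*} [NormedAddCommGroup R] [NormedSpace ℝ R]
    [∀ x, TopologicalSpace (W x)] [TopologicalSpace (TotalSpace R W)] [FiberBundle R W]
    [∀ x, AddCommGroup (W x)] [∀ x, Module ℝ (W x)] [VectorBundle ℝ R W]

theorem SmoothSection.smul_bump {U : Opens M} {χ : M → ℝ} {s : Π x, W x}
    (hχ : SmoothFun m ⊤ χ) (hsupp : tsupport χ ⊆ U) (hs : SmoothSection m R U s) :
    SmoothSection m R ⊤ (fun y => χ y • s y) := by
  have := ContMDiffOn.smul_section_of_tsupport (hχ.mono (V := U) le_top) U.isOpen hsupp hs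
  exact this.contMDiffOn

theorem SmoothFun.mul_bump {U : Opens M} {χ f : M → ℝ}
    (hχ : SmoothFun m ⊤ χ) (hsupp : tsupport χ ⊆ U) (hf : SmoothFun m U f) :
    SmoothFun m ⊤ (fun y => χ y * f y) := by
  refine smoothFun_iff.2 fun x _ => ?_
  by_cases hx : x ∈ tsupport χ
  · exact ContMDiffAt.mul (hχ.at trivial) (hf.at (hsupp hx))
  · refine (contMDiffAt_const (c := (0 : ℝ))).congr_of_eventuallyEq ?_
    filter_upwards [(isClosed_tsupport χ).isOpen_compl.mem_nhds hx] with y hy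
    simp [image_eq_zero_of_notMem_tsupport hy]

end Bump

end Calculus

/-! ### Foliated functions and vector fields in adapted coordinates; a projection of TM onto F -/

section AdaptedCoordinates

variable {m k : ℕ} {M : Type*} [TopologicalSpace M] [ChartedSpace (Coord m) M]
  [IsManifold (𝓡 m) ∞ M] (𝓕 : Foliation m k M)

/-- Adapted coordinates `h` on `U`, with the coordinate vector fields `D`. -/
structure IsAdapted (U : Opens M) (h : Fin m → M → ℝ)
    (D : Fin m → Π x : M, TangentSpace (𝓡 m) x) : Prop where
  smooth_fun : ∀ i, SmoothFun m U (h i)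
  smooth_vf : ∀ i, SmoothVF U (D i)
  dual : ∀ y ∈ U, ∀ i j, dirDeriv (h i) y (D j y) = if i = j then 1 else 0
  expand : ∀ y ∈ U, ∀ v : TangentSpace (𝓡 m) y, v = ∑ i, dirDeriv (h i) y v • D i y
  mem_iff : ∀ y ∈ U, ∀ v : TangentSpace (𝓡 m) y,
    v ∈ 𝓕.tangent y ↔ ∀ i : Fin m, (i : ℕ) < k → dirDeriv (h i) y v = 0

/-- The fields are the standard basis pushed forward by the inverse of a foliation chart. Duality
with the coordinate differentials holds since chart and inverse have inverse differentials. -/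
theorem exists_adapted (x₀ : M) : ∃ (U : Opens M) (h : Fin m → M → ℝ)
    (D : Fin m → Π x : M, TangentSpace (𝓡 m) x), x₀ ∈ U ∧ IsAdapted 𝓕 U h D := by
  obtain ⟨φ, hφ, hx₀, hmem⟩ := 𝓕.adapted x₀
  have hφs : ContMDiffOn (𝓡 m) 𝓘(ℝ, Coord m) ∞ φ φ.source :=
    contMDiffOn_of_mem_maximalAtlas hφ
  have hφt : ContMDiffOn 𝓘(ℝ, Coord m) (𝓡 m) ∞ φ.symm φ.target :=
    contMDiffOn_symm_of_mem_maximalAtlas hφ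
  have hmd : φ.MDifferentiable (𝓡 m) 𝓘(ℝ, Coord m) :=
    ⟨hφs.mdifferentiableOn (by simp), hφt.mdifferentiableOn (by simp)⟩
  let U : Opens M := ⟨φ.source, φ.open_source⟩
  have hdiff : ∀ y ∈ φ.source, MDifferentiableAt (𝓡 m) 𝓘(ℝ, Coord m) φ y :=
    fun y hy => hmd.mdifferentiableAt hy
  let p : Fin m → Coord m →L[ℝ] ℝ := fun i => EuclideanSpace.proj i
  let h : Fin m → M → ℝ := fun i y => φ y i
  have hh : ∀ y ∈ φ.source, ∀ i (v : TangentSpace (𝓡 m) y),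
      dirDeriv (h i) y v = coordDeriv φ y v i := by
    intro y hy i v
    have h1 : HasMFDerivAt (𝓡 m) 𝓘(ℝ, ℝ) (p i ∘ φ) y
        ((p i).comp (mfderiv (𝓡 m) 𝓘(ℝ, Coord m) φ y)) :=
      HasMFDerivAt.comp y (p i).hasMFDerivAt (hdiff y hy).hasMFDerivAt
    change mfderiv (𝓡 m) 𝓘(ℝ, ℝ) (p i ∘ φ) y v = _
    rw [h1.mfderiv]
    rfl
  let D : Fin m → Π y : M, TangentSpace (𝓡 m) y := fun i y =>
    (mfderiv 𝓘(ℝ, Coord m) (𝓡 m) φ.symm (φ y) (EuclideanSpace.single i (1 : ℝ) : Coord m) : Coord m)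
  have hD1 : ∀ y ∈ φ.source, ∀ i, coordDeriv φ y (D i y) = EuclideanSpace.single i (1 : ℝ) := by
    intro y hy i
    have h1 := hmd.comp_symm_deriv (φ.map_source hy)
    rw [φ.left_inv hy] at h1
    exact DFunLike.congr_fun h1 (EuclideanSpace.single i (1 : ℝ) : Coord m)
  -- Lets the expansion of a vector in the coordinate fields be verified after applying the
  -- differential of the chart.
  have hinj : ∀ y ∈ φ.source, ∀ v w : TangentSpace (𝓡 m) y,
      coordDeriv φ y v = coordDeriv φ y w → v = w := by
    intro y hy v w hvw
    have h1 := hmd.symm_comp_deriv hy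
    have h2 := DFunLike.congr_fun h1 v
    have h3 := DFunLike.congr_fun h1 w
    have h4 : mfderiv (𝓡 m) 𝓘(ℝ, Coord m) φ y v = mfderiv (𝓡 m) 𝓘(ℝ, Coord m) φ y w := hvw
    simp only [ContinuousLinearMap.comp_apply] at h2 h3
    rw [h4] at h2
    exact h2.symm.trans h3
  refine ⟨U, h, D, hx₀, ⟨?_, ?_, ?_, ?_, ?_⟩⟩
  · intro i
    exact ((p i).contDiff.contMDiff.contMDiffOn (s := Set.univ)).comp hφs (fun _ _ => trivial)
  · intro i
    have h1 : ContMDiffOn 𝓘(ℝ, Coord m).tangent (𝓡 m).tangent ∞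
        (tangentMapWithin 𝓘(ℝ, Coord m) (𝓡 m) φ.symm φ.target)
        (π (Coord m) (TangentSpace 𝓘(ℝ, Coord m)) ⁻¹' φ.target) :=
      ContMDiffOn.contMDiffOn_tangentMapWithin hφt (by simp) φ.open_target.uniqueMDiffOn
    have h0 : ContMDiff 𝓘(ℝ, Coord m) 𝓘(ℝ, Coord m).tangent ∞
        (fun z : Coord m => (⟨z, (EuclideanSpace.single i (1 : ℝ) : Coord m)⟩ :
          TangentBundle 𝓘(ℝ, Coord m) (Coord m))) := fun z =>
      contMDiffAt_vectorSpace_iff_contDiffAt.2 contDiffAt_const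
    have h2 := h1.comp (h0.contMDiffOn.comp hφs (t := Set.univ) (fun _ _ => trivial))
      (fun y hy => φ.map_source hy)
    refine ContMDiffOn.congr h2 fun y hy => ?_
    have aux : ∀ (z : M) (u : Coord m), z = y →
        (⟨z, u⟩ : TotalSpace (Coord m) (TangentSpace (𝓡 m) : M → Type)) = ⟨y, u⟩ := by
      rintro z u rfl; rfl
    simp only [Function.comp, tangentMapWithin]
    rw [mfderivWithin_of_isOpen φ.open_target (φ.map_source hy)]
    exact (aux _ _ (φ.left_inv hy)).symm
  · intro y hy i j
    rw [hh y hy, hD1 y hy]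
    simp
  · intro y hy v
    refine hinj y hy _ _ ?_
    have hlin : coordDeriv φ y (∑ i, dirDeriv (h i) y v • D i y) =
        ∑ i, dirDeriv (h i) y v • coordDeriv φ y (D i y) := by
      simp only [coordDeriv]
      rw [map_sum]
      refine Finset.sum_congr rfl fun i _ => ?_
      rw [map_smul]; rfl
    rw [hlin]
    ext j
    simp only [hD1 y hy, hh y hy]
    simp [Pi.single_apply]
  · intro y hy v
    rw [hmem y hy v]
    simp only [hh y hy]

variable {𝓕}

theorem IsAdapted.isFolFun {U : Opens M} {h D} (hA : IsAdapted 𝓕 U h D) {i : Fin m}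
    (hi : (i : ℕ) < k) : 𝓕.IsFolFun U (h i) :=
  ⟨hA.smooth_fun i, fun x hx v hv => (hA.mem_iff x hx v).1 hv i hi⟩

theorem IsAdapted.mem_tangent {U : Opens M} {h D} (hA : IsAdapted 𝓕 U h D) {i : Fin m}
    (hi : ¬ (i : ℕ) < k) {y : M} (hy : y ∈ U) : D i y ∈ 𝓕.tangent y := by
  rw [hA.mem_iff y hy]
  intro j hj
  rw [hA.dual y hy, if_neg]
  rintro rfl; exact hi hj

variable (𝓕)

/-- A vector is tangent to the leaves iff it annihilates the foliated functions. -/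
theorem mem_tangent_iff {x : M} {v : TangentSpace (𝓡 m) x} :
    v ∈ 𝓕.tangent x ↔ ∀ (U : Opens M) (f : M → ℝ), x ∈ U → 𝓕.IsFolFun U f → dirDeriv f x v = 0 := by
  refine ⟨fun hv U f hx hf => hf.2 x hx v hv, fun H => ?_⟩
  obtain ⟨U, h, D, hx, hA⟩ := exists_adapted 𝓕 x
  exact (hA.mem_iff x hx v).2 fun i hi => H U (h i) hx (hA.isFolFun hi)

theorem IsFolFun_restrict {U V : Opens M} {f : M → ℝ} (hf : 𝓕.IsFolFun U f) (hV : V ≤ U) :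
    𝓕.IsFolFun V f := ⟨hf.1.mono hV, fun x hx => hf.2 x (hV hx)⟩

theorem toNormal_eq_iff {x : M} {v w : TangentSpace (𝓡 m) x} :
    𝓕.toNormal x v = 𝓕.toNormal x w ↔ v - w ∈ 𝓕.tangent x :=
  Submodule.Quotient.eq _

theorem toNormal_eq_zero_iff {x : M} {v : TangentSpace (𝓡 m) x} :
    𝓕.toNormal x v = 0 ↔ v ∈ 𝓕.tangent x := Submodule.Quotient.mk_eq_zero _

theorem dirDeriv_eq_of_toNormal_eq {U : Opens M} {f : M → ℝ} (hf : 𝓕.IsFolFun U f) {x : M}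
    (hx : x ∈ U) {v w : TangentSpace (𝓡 m) x} (h : 𝓕.toNormal x v = 𝓕.toNormal x w) :
    dirDeriv f x v = dirDeriv f x w := by
  have := hf.2 x hx _ ((toNormal_eq_iff 𝓕).1 h)
  rwa [dirDeriv_sub_vec, sub_eq_zero] at this

/-- The transverse coordinates are foliated, so foliated functions separate normal vectors.
Identities in νℱ thereby become identities between numbers. -/
theorem toNormal_eq_of_dirDeriv {x : M} {v w : TangentSpace (𝓡 m) x}
    (H : ∀ (U : Opens M) (f : M → ℝ), x ∈ U → 𝓕.IsFolFun U f → dirDeriv f x v = dirDeriv f x w) :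
    𝓕.toNormal x v = 𝓕.toNormal x w := by
  rw [toNormal_eq_iff, mem_tangent_iff]
  intro U f hx hf
  rw [dirDeriv_sub_vec, H U f hx hf, sub_self]

/-- The derivative of a foliated function along a foliated vector field is foliated. -/
theorem isFolFun_dirDeriv {U V : Opens M} {f : M → ℝ} {X : Π x : M, TangentSpace (𝓡 m) x}
    (hf : 𝓕.IsFolFun V f) (hX : 𝓕.IsFolVF U X) (hV : V ≤ U) :
    𝓕.IsFolFun V (fun y => dirDeriv f y (X y)) := by
  have hXV : SmoothVF V X := SmoothSection.mono hX.1 hV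
  refine ⟨hf.1.dirDeriv hXV, fun x hx v hv => ?_⟩
  obtain ⟨V', h, D, hx', hA⟩ := exists_adapted 𝓕 x
  let W := V ⊓ V'
  have hxW : x ∈ W := ⟨hx, hx'⟩
  -- the vector field with constant coordinates through `v`
  let Y : Π y : M, TangentSpace (𝓡 m) y := fun y => ∑ i, dirDeriv (h i) x v • D i y
  have hY : SmoothVF W Y := smoothSection_iff.2 fun y hy => SmoothSecAt.sum fun i _ =>
    SmoothSecAt.smul contMDiffAt_const (SmoothSection.at (hA.smooth_vf i) hy.2)
  have hYF : ∀ y ∈ W, Y y ∈ 𝓕.tangent y := by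
    intro y hy
    refine Submodule.sum_mem _ fun i _ => ?_
    by_cases hi : (i : ℕ) < k
    · rw [(hA.mem_iff x hx' v).1 hv i hi, zero_smul]; exact Submodule.zero_mem _
    · exact Submodule.smul_mem _ _ (hA.mem_tangent hi hy.2)
  have hYx : Y x = v := (hA.expand x hx' v).symm
  -- The bracket [Y, X] is tangent to the leaves and so kills f. In Y(Xf) − X(Yf) the second term
  -- vanishes because Yf = 0 near x, which leaves v(Xf) = 0.
  have h1 := hX.2 W (inf_le_left.trans hV) Y hY hYF x hxW
  have h2 := hf.2 x hx _ h1
  rw [dirDeriv_lieVF hxW (hf.1.mono inf_le_left) hY (SmoothSection.mono hXV inf_le_left)] at h2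
  have h3 : dirDeriv (fun y => dirDeriv f y (Y y)) x (X x) = 0 := by
    rw [dirDeriv_congr (g := fun _ => 0), dirDeriv_const]
    filter_upwards [W.isOpen.mem_nhds hxW] with y hy
    exact hf.2 y hy.1 _ (hYF y hy)
  rw [h3, hYx, sub_zero] at h2
  exact h2

/-- A smooth vector field that differentiates foliated functions to foliated functions is
foliated. -/
theorem isFolVF_of_dirDeriv {U : Opens M} {X : Π x : M, TangentSpace (𝓡 m) x} (hX : SmoothVF U X)
    (H : ∀ (V : Opens M) (f : M → ℝ), V ≤ U → 𝓕.IsFolFun V f →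
      ∀ x ∈ V, ∀ v ∈ 𝓕.tangent x, dirDeriv (fun y => dirDeriv f y (X y)) x v = 0) :
    𝓕.IsFolVF U X := by
  refine ⟨hX, fun V hV Y hY hYF x hx => ?_⟩
  rw [mem_tangent_iff]
  intro V' f hx' hf
  let W := V ⊓ V'
  have hxW : x ∈ W := ⟨hx, hx'⟩
  rw [dirDeriv_lieVF hxW (hf.1.mono inf_le_right) (SmoothSection.mono hY inf_le_left)
    (SmoothSection.mono hX (inf_le_left.trans hV))]
  have h3 : dirDeriv (fun y => dirDeriv f y (Y y)) x (X x) = 0 := by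
    rw [dirDeriv_congr (g := fun _ => 0), dirDeriv_const]
    filter_upwards [W.isOpen.mem_nhds hxW] with y hy
    exact hf.2 y hy.2 _ (hYF y hy.1)
  rw [h3, H W f (inf_le_left.trans hV) (IsFolFun_restrict 𝓕 hf inf_le_right) x hxW _ (hYF x hx),
    sub_zero]

theorem isFolVF_restrict {U V : Opens M} {X : Π x : M, TangentSpace (𝓡 m) x} (hX : 𝓕.IsFolVF U X)
    (hV : V ≤ U) : 𝓕.IsFolVF V X :=
  ⟨SmoothSection.mono hX.1 hV, fun V' hV' => hX.2 V' (hV'.trans hV)⟩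

/-- A smooth vector field whose class in `νℱ` is foliated is foliated. -/
theorem isFolVF_of_isFolNormal {U : Opens M} {X : Π x : M, TangentSpace (𝓡 m) x}
    (hX : SmoothVF U X) (hn : 𝓕.IsFolNormal U (fun x => 𝓕.toNormal x (X x))) : 𝓕.IsFolVF U X := by
  refine isFolVF_of_dirDeriv 𝓕 hX fun V f hV hf x hx v hv => ?_
  -- Near x the field differs from a foliated one by a field tangent to the leaves, a difference
  -- that foliated functions do not see.
  obtain ⟨V', hx', hV', X', hX', heq⟩ := hn x (hV hx)
  have h1 := isFolFun_dirDeriv 𝓕 (IsFolFun_restrict 𝓕 hf (inf_le_left (b := V')))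
    (isFolVF_restrict 𝓕 hX' (inf_le_right (a := V))) le_rfl
  rw [dirDeriv_congr (g := fun y => dirDeriv f y (X' y))]
  · exact h1.2 x ⟨hx, hx'⟩ v hv
  · filter_upwards [(V ⊓ V').isOpen.mem_nhds ⟨hx, hx'⟩] with y hy
    exact dirDeriv_eq_of_toNormal_eq 𝓕 hf hy.1 (heq y hy.2).symm

/-- In adapted coordinates, dropping the transverse components projects onto F. Projections onto a
fixed subspace are closed under affine combinations, so a partition of unity glues the local ones;
this is what σ-compactness is for. -/
theorem exists_leaf_projection [T2Space M] [SigmaCompactSpace M] :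
    ∃ p : Π x : M, TangentSpace (𝓡 m) x →ₗ[ℝ] TangentSpace (𝓡 m) x,
      (∀ x v, p x v ∈ 𝓕.tangent x) ∧ (∀ x, ∀ v ∈ 𝓕.tangent x, p x v = v) ∧
      ∀ (U : Opens M) (X : Π x : M, TangentSpace (𝓡 m) x), SmoothVF U X →
        SmoothVF U (fun x => p x (X x)) := by
  choose U h D hxU hA using exists_adapted 𝓕
  obtain ⟨χ, hχ⟩ := SmoothPartitionOfUnity.exists_isSubordinate (𝓡 m) isClosed_univ
    (fun x : M => (U x : Set M)) (fun x => (U x).isOpen)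
    (fun x _ => Set.mem_iUnion.2 ⟨x, hxU x⟩)
  let J : Finset (Fin m) := Finset.univ.filter fun i => ¬ (i : ℕ) < k
  let q : M → Π y : M, TangentSpace (𝓡 m) y → TangentSpace (𝓡 m) y := fun a y v =>
    ∑ i ∈ J, dirDeriv (h a i) y v • D a i y
  have hq_add : ∀ a y v w, q a y (v + w) = q a y v + q a y w := fun a y v w => by
    simp only [q, dirDeriv_add_vec, add_smul, Finset.sum_add_distrib]
  have hq_smul : ∀ a y (c : ℝ) v, q a y (c • v) = c • q a y v := fun a y c v => by
    simp only [q, dirDeriv_smul_vec, Finset.smul_sum, mul_smul]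
  have hqF : ∀ a, ∀ y ∈ U a, ∀ v, q a y v ∈ 𝓕.tangent y := fun a y hy v =>
    Submodule.sum_mem _ fun i hi => Submodule.smul_mem _ _
      ((hA a).mem_tangent (Finset.mem_filter.1 hi).2 hy)
  have hqid : ∀ a, ∀ y ∈ U a, ∀ v ∈ 𝓕.tangent y, q a y v = v := by
    intro a y hy v hv
    conv_rhs => rw [(hA a).expand y hy v]
    refine Finset.sum_subset (Finset.subset_univ _) fun i _ hi => ?_
    have : (i : ℕ) < k := by simpa [J] using hi
    rw [((hA a).mem_iff y hy v).1 hv i this, zero_smul]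
  have hfin : ∀ y : M, (Function.support fun a => χ a y).Finite := fun y =>
    (χ.locallyFinite.point_finite y).subset fun a ha => ha
  have hfin' : ∀ (y : M) v, (Function.support fun a => χ a y • q a y v).Finite := fun y v =>
    (hfin y).subset fun a ha => by
      rw [Function.mem_support] at ha ⊢
      exact left_ne_zero_of_smul ha
  have hUa : ∀ a y, χ a y ≠ 0 → y ∈ U a := fun a y hy => hχ a (subset_closure hy)
  refine ⟨fun y => { toFun := fun v => ∑ᶠ a, χ a y • q a y v, map_add' := ?_, map_smul' := ?_ },
    ?_, ?_, ?_⟩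
  · intro v w
    simp only [hq_add, smul_add]
    exact finsum_add_distrib (hfin' y v) (hfin' y w)
  · intro c v
    simp only [hq_smul, RingHom.id_apply, smul_comm _ c]
    exact (smul_finsum' c (hfin' y v)).symm
  · intro y v
    refine finsum_induction (fun w => w ∈ 𝓕.tangent y) (Submodule.zero_mem _)
      (fun _ _ => Submodule.add_mem _) fun a => ?_
    by_cases ha : χ a y = 0
    · simp [ha]
    · exact Submodule.smul_mem _ _ (hqF a y (hUa a y ha) v)
  · intro y v hv
    change ∑ᶠ a, χ a y • q a y v = v
    have h1 : ∀ a, χ a y • q a y v = χ a y • v := fun a => by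
      by_cases ha : χ a y = 0
      · simp [ha]
      · rw [hqid a y (hUa a y ha) v hv]
    simp only [h1]
    rw [← finsum_smul' (hfin y), χ.sum_eq_one (Set.mem_univ y), one_smul]
  · intro V X hX
    refine ContMDiffOn.finsum_section_of_locallyFinite
      (t := fun a y => χ a y • q a y (X y)) ?_ ?_
    · exact χ.locallyFinite.subset fun a y hy => left_ne_zero_of_smul hy
    · intro a
      refine (smoothSection_iff (m := m) (R := Coord m)
        (W := (TangentSpace (𝓡 m) : M → Type))).2 fun y hy => ?_
      by_cases hya : y ∈ tsupport (χ a)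
      · refine SmoothSecAt.smul (χ a).contMDiff.contMDiffAt (SmoothSecAt.sum fun i _ =>
          SmoothSecAt.smul ?_ (SmoothSection.at ((hA a).smooth_vf i) (hχ a hya)))
        exact (((hA a).smooth_fun i).mono (V := U a ⊓ V) inf_le_left |>.dirDeriv
          (SmoothSection.mono hX inf_le_right)).at ⟨hχ a hya, hy⟩
      · refine SmoothSecAt.congr (smoothSecAt_zero y) ?_
        filter_upwards [(isClosed_tsupport (χ a)).isOpen_compl.mem_nhds hya] with z hz
        simp [image_eq_zero_of_notMem_tsupport hz]

end AdaptedCoordinates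

/-! ### Foliated frames and their coefficients -/

section FoliatedFrames

variable {m k : ℕ} {M : Type*} [TopologicalSpace M] [ChartedSpace (Coord m) M]
  {𝓕 : Foliation m k M} {R : Type*} {E : M → Type*}
  [NormedAddCommGroup R] [NormedSpace ℝ R]
  [∀ x, AddCommGroup (E x)] [∀ x, Module ℝ (E x)] [∀ x, TopologicalSpace (E x)]
  [TopologicalSpace (TotalSpace R E)] [FiberBundle R E]

/-- `b` is a frame of `E` on `U` which is a basis of the foliated sections over the foliated
functions. -/
structure IsFolFrame (Φ : FoliatedStructure 𝓕 R E) (U : Opens M) {r : ℕ}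
    (b : Fin r → Π x, E x) : Prop where
  smooth : ∀ i, SmoothSection m R U (b i)
  linearIndependent : ∀ x ∈ U, LinearIndependent ℝ (fun i => b i x)
  span : ∀ x ∈ U, ⊤ ≤ Submodule.span ℝ (Set.range fun i => b i x)
  fol_iff : ∀ V : Opens M, V ≤ U → ∀ e : Π x, E x, Φ.IsFol V e ↔
      ∃ f : Fin r → M → ℝ, (∀ i, 𝓕.IsFolFun V (f i)) ∧ ∀ x ∈ V, e x = ∑ i, f i x • b i x

theorem exists_folFrame (Φ : FoliatedStructure 𝓕 R E) (x : M) :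
    ∃ (U : Opens M) (r : ℕ) (b : Fin r → Π x, E x), x ∈ U ∧ IsFolFrame Φ U b := by
  obtain ⟨U, hx, r, b, h1, h2, h3⟩ := Φ.frame x
  exact ⟨U, r, b, hx, h1, fun x hx => (h2 x hx).1, fun x hx => (h2 x hx).2.ge, h3⟩

open Classical in
/-- The coordinates of a vector in the basis `b i x` (zero if this is not a basis). -/
def frameCoeff {r : ℕ} (b : Fin r → Π x, E x) (i : Fin r) (x : M) : E x →ₗ[ℝ] ℝ :=
  if h : LinearIndependent ℝ (fun i => b i x) ∧ ⊤ ≤ Submodule.span ℝ (Set.range fun i => b i x)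
  then (Module.Basis.mk h.1 h.2).coord i else 0

theorem frameCoeff_sum {r : ℕ} (b : Fin r → Π x, E x) {x : M} {ι : Type*} [Fintype ι]
    {f : ι → M → ℝ} {c : ι → Π x, E x} {e : Π x, E x}
    (he : ∀ᶠ y in nhds x, e y = ∑ i, f i y • c i y) (q : Fin r) : ∀ᶠ y in nhds x,
      frameCoeff b q y (e y) = ∑ i, f i y * frameCoeff b q y (c i y) := by
  filter_upwards [he] with y hy
  rw [hy, map_sum]
  simp

section Coeff

variable {Φ : FoliatedStructure 𝓕 R E} {U : Opens M} {r : ℕ} {b : Fin r → Π x, E x}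

theorem IsFolFrame.sum_coeff (hb : IsFolFrame Φ U b) {x : M} (hx : x ∈ U) (e : E x) :
    e = ∑ i, frameCoeff b i x e • b i x := by
  have h := And.intro (hb.linearIndependent x hx) (hb.span x hx)
  have := (Module.Basis.mk h.1 h.2).sum_repr e
  simp only [Module.Basis.mk_apply] at this
  conv_lhs => rw [← this]
  refine Finset.sum_congr rfl fun i _ => ?_
  rw [frameCoeff, dif_pos h]; rfl

theorem IsFolFrame.coeff_eq (hb : IsFolFrame Φ U b) {x : M} (hx : x ∈ U) {e : E x}
    {f : Fin r → ℝ} (h : e = ∑ i, f i • b i x) (i : Fin r) : frameCoeff b i x e = f i := by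
  have h1 := (hb.sum_coeff hx e).symm.trans h
  have h2 := Fintype.linearIndependent_iff.1 (hb.linearIndependent x hx)
    (fun i => frameCoeff b i x e - f i)
    (by simp only [sub_smul, Finset.sum_sub_distrib]; rw [h1, sub_self]) i
  exact sub_eq_zero.1 h2

theorem IsFolFrame.mono (hb : IsFolFrame Φ U b) {V : Opens M} (hV : V ≤ U) : IsFolFrame Φ V b :=
  ⟨fun i => (hb.smooth i).mono hV, fun x hx => hb.linearIndependent x (hV hx),
    fun x hx => hb.span x (hV hx), fun V' hV' => hb.fol_iff V' (hV'.trans hV)⟩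

theorem isFolFun_const (U : Opens M) (c : ℝ) : 𝓕.IsFolFun U (fun _ => c) :=
  ⟨contMDiffOn_const, fun _ _ _ _ => dirDeriv_const c _⟩

theorem isFolFun_sum_mul {U : Opens M} {ι : Type*} [Fintype ι] {f g : ι → M → ℝ}
    (hf : ∀ i, 𝓕.IsFolFun U (f i)) (hg : ∀ i, 𝓕.IsFolFun U (g i)) :
    𝓕.IsFolFun U (fun x => ∑ i, f i x * g i x) := by
  have h1 : ∀ i, ∀ x ∈ U, SmoothFunAt m (fun x => f i x * g i x) x := fun i x hx =>
    ContMDiffAt.mul ((hf i).1.at hx) ((hg i).1.at hx)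
  refine ⟨smoothFun_iff.2 fun x hx => ContMDiffAt.sum fun i _ => h1 i x hx, fun x hx v hv => ?_⟩
  rw [dirDeriv_sum _ (fun i _ => h1 i x hx)]
  refine Finset.sum_eq_zero fun i _ => ?_
  rw [dirDeriv_mul ((hf i).1.at hx) ((hg i).1.at hx), (hf i).2 x hx v hv, (hg i).2 x hx v hv]
  simp

theorem IsFolFun.congr {U : Opens M} {f g : M → ℝ} (hf : 𝓕.IsFolFun U f)
    (h : ∀ x ∈ U, g x = f x) : 𝓕.IsFolFun U g := by
  refine ⟨ContMDiffOn.congr hf.1 h, fun x hx v hv => ?_⟩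
  rw [dirDeriv_congr (g := f) (Filter.mem_of_superset (U.isOpen.mem_nhds hx) h)]
  exact hf.2 x hx v hv

theorem IsFolFrame.isFol (hb : IsFolFrame Φ U b) (i : Fin r) : Φ.IsFol U (b i) :=
  (hb.fol_iff U le_rfl _).2 ⟨fun j _ => if j = i then 1 else 0, fun j => isFolFun_const U _,
    fun x _ => by simp⟩

theorem IsFolFrame.isFolFun_coeff (hb : IsFolFrame Φ U b) {V : Opens M} (hV : V ≤ U)
    {e : Π x, E x} (he : Φ.IsFol V e) (i : Fin r) :
    𝓕.IsFolFun V (fun x => frameCoeff b i x (e x)) := by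
  obtain ⟨f, hf, hef⟩ := (hb.fol_iff V hV e).1 he
  exact IsFolFun.congr (hf i) fun x hx => hb.coeff_eq (hV hx) (hef x hx) i

/-- Combinations of foliated sections with foliated coefficients are foliated. -/
theorem isFol_sum_smul {V : Opens M} {ι : Type*} [Fintype ι] {c : ι → Π x, E x} {f : ι → M → ℝ}
    (hc : ∀ i, Φ.IsFol V (c i)) (hf : ∀ i, 𝓕.IsFolFun V (f i)) :
    Φ.IsFol V (fun x => ∑ i, f i x • c i x) := by
  -- By the sheaf property it suffices to look inside a foliated frame, where the coefficients of
  -- the combination are sums of products of foliated functions.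
  refine Φ.glue V _ fun x hx => ?_
  obtain ⟨U, r, b, hxU, hb⟩ := exists_folFrame Φ x
  refine ⟨V ⊓ U, ⟨hx, hxU⟩, inf_le_left, (hb.fol_iff _ inf_le_right _).2
    ⟨fun p x => ∑ i, f i x * frameCoeff b p x (c i x), fun p => ?_, fun y hy => ?_⟩⟩
  · exact isFolFun_sum_mul (fun i => ⟨(hf i).1.mono inf_le_left, fun x hx => (hf i).2 x hx.1⟩)
      fun i => hb.isFolFun_coeff inf_le_right (Φ.restrict _ _ _ inf_le_left (hc i)) p
  · simp only [Finset.sum_smul, mul_smul]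
    rw [Finset.sum_comm]
    refine Finset.sum_congr rfl fun i _ => ?_
    rw [← Finset.smul_sum, ← hb.sum_coeff hy.2]

theorem isFol_sum {V : Opens M} {ι : Type*} {J : Finset ι} {c : ι → Π x, E x} {f : ι → M → ℝ}
    (hc : ∀ i ∈ J, Φ.IsFol V (c i)) (hf : ∀ i ∈ J, 𝓕.IsFolFun V (f i)) :
    Φ.IsFol V (fun x => ∑ i ∈ J, f i x • c i x) := by
  refine Φ.congr _ _ _ (fun x _ => ?_) (isFol_sum_smul (ι := J) (c := fun i => c i)
    (f := fun i => f i) (fun i => hc i i.2) fun i => hf i i.2)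
  exact Finset.sum_coe_sort J fun i => f i x • c i x

theorem isFol_smul {V : Opens M} {c : Π x, E x} {f : M → ℝ}
    (hc : Φ.IsFol V c) (hf : 𝓕.IsFolFun V f) : Φ.IsFol V (fun x => f x • c x) :=
  Φ.congr _ _ _ (fun x _ => by simp) (isFol_sum_smul (ι := Unit) (fun _ => hc) fun _ => hf)

variable [VectorBundle ℝ R E]

/-- Smoothness is not among the requirements on `IsFol`; it comes from the smooth local frames and
their foliated, hence smooth, coefficients. -/
theorem isFol_smooth {V : Opens M} {e : Π x, E x} (he : Φ.IsFol V e) : SmoothSection m R V e := by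
  refine smoothSection_iff.2 fun x hx => ?_
  obtain ⟨U, r, b, hxU, hb⟩ := exists_folFrame Φ x
  have hV := Φ.restrict _ _ _ (inf_le_left (b := U)) he
  refine SmoothSecAt.congr (s := fun y => ∑ i, frameCoeff b i y (e y) • b i y)
    (SmoothSecAt.sum fun i _ => SmoothSecAt.smul
    ((hb.isFolFun_coeff inf_le_right hV i).1.at ⟨hx, hxU⟩) ((hb.smooth i).at hxU)) ?_
  filter_upwards [U.isOpen.mem_nhds hxU] with y hy
  exact hb.sum_coeff hy _

variable [FiniteDimensional ℝ R] [ContMDiffVectorBundle ∞ R E (𝓡 m)]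

theorem IsFolFrame.smoothFunAt_coeff (hb : IsFolFrame Φ U b) {x : M} (hx : x ∈ U) {e : Π x, E x}
    (he : SmoothSecAt m R e x) (i : Fin r) : SmoothFunAt m (fun y => frameCoeff b i y (e y)) x :=
  FolAlg.smoothFunAt_coeff (fun i => (hb.smooth i).at hx) (hb.linearIndependent x hx) he
    (Filter.mem_of_superset (U.isOpen.mem_nhds hx) fun y hy => hb.sum_coeff hy _) i

theorem IsFolFrame.smoothFun_coeff (hb : IsFolFrame Φ U b) {V : Opens M} (hV : V ≤ U)
    {e : Π x, E x} (he : SmoothSection m R V e) (i : Fin r) :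
    SmoothFun m V (fun y => frameCoeff b i y (e y)) :=
  smoothFun_iff.2 fun _ hx => hb.smoothFunAt_coeff (hV hx) (he.at hx) i

end Coeff

/-! ### The bracket on the fibre product of TM and E over νℱ, and its independence of the frame -/

variable [IsManifold (𝓡 m) ∞ M] {Φ : FoliatedStructure 𝓕 R E} (T : TransLieAlgebroid Φ)

theorem toNormal_surjective (x : M) : Function.Surjective (𝓕.toNormal x) :=
  Submodule.mkQ_surjective _

theorem isFol_zero (V : Opens M) : Φ.IsFol V (fun _ => 0) :=
  Φ.congr _ _ _ (fun x _ => by simp)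
    (isFol_sum_smul (Φ := Φ) (ι := Empty) (c := fun i => i.elim) (f := fun i => i.elim)
      (fun i => i.elim) fun i => i.elim)

theorem bracket_sum_right {V : Opens M} {x : M} (hx : x ∈ V) {e : Π x, E x} (he : Φ.IsFol V e)
    {ι : Type*} (J : Finset ι) {g : ι → M → ℝ} {d : ι → Π x, E x}
    (hg : ∀ i ∈ J, 𝓕.IsFolFun V (g i)) (hd : ∀ i ∈ J, Φ.IsFol V (d i))
    {v : TangentSpace (𝓡 m) x} (hv : 𝓕.toNormal x v = T.anchor x (e x)) :
    T.bracket e (fun y => ∑ i ∈ J, g i y • d i y) x =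
      ∑ i ∈ J, (g i x • T.bracket e (d i) x + dirDeriv (g i) x v • d i x) := by
  classical
  induction J using Finset.induction_on with
  | empty =>
    -- The bracket with the zero section vanishes, by homogeneity with the scalar 0.
    have := T.bracket_smul V e (fun _ => 0) 0 he (isFol_zero V) x hx
    simp only [Finset.sum_empty]
    simp only [zero_smul] at this
    exact this
  | insert a J ha ih =>
    have h1 : Φ.IsFol V (fun y => g a y • d a y) := isFol_smul (hd a (by simp)) (hg a (by simp))
    have h2 : Φ.IsFol V (fun y => ∑ i ∈ J, g i y • d i y) :=
      isFol_sum (fun i hi => hd i (by simp [hi])) fun i hi => hg i (by simp [hi])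
    have h3 : (fun y => ∑ i ∈ insert a J, g i y • d i y) =
        (fun y => g a y • d a y) + fun y => ∑ i ∈ J, g i y • d i y := by
      funext y; simp [Finset.sum_insert ha]
    rw [h3, T.bracket_add V _ _ _ he h1 h2 x hx, Finset.sum_insert ha,
      ih (fun i hi => hg i (by simp [hi])) fun i hi => hd i (by simp [hi]),
      T.leibniz V e (d a) (g a) he (hd a (by simp)) (hg a (by simp)) x hx v hv]

/-- The value at `x` of the bracket of `∑ f i • c i` and `∑ g j • d j`, whose anchors take the
values `v` and `v'`, according to the Leibniz rule. -/
def bracketExpr (x : M) (v v' : TangentSpace (𝓡 m) x) {ι κ : Type*} [Fintype ι] [Fintype κ]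
    (f : ι → M → ℝ) (c : ι → Π x, E x) (g : κ → M → ℝ) (d : κ → Π x, E x) : E x :=
  ∑ j, dirDeriv (g j) x v • d j x - ∑ i, dirDeriv (f i) x v' • c i x
    + ∑ i, ∑ j, (f i x * g j x) • T.bracket (c i) (d j) x

section Expr

variable {x : M} {v v' : TangentSpace (𝓡 m) x} {ι κ : Type*} [Fintype ι] [Fintype κ]
  {f : ι → M → ℝ} {c : ι → Π x, E x} {g : κ → M → ℝ} {d : κ → Π x, E x}

theorem bracketExpr_swap {V : Opens M} (hx : x ∈ V) (hc : ∀ i, Φ.IsFol V (c i))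
    (hd : ∀ i, Φ.IsFol V (d i)) :
    bracketExpr T x v v' f c g d = -bracketExpr T x v' v g d f c := by
  unfold bracketExpr
  have : ∑ i, ∑ j, (f i x * g j x) • T.bracket (c i) (d j) x =
      -∑ j, ∑ i, (g j x * f i x) • T.bracket (d j) (c i) x := by
    rw [Finset.sum_comm, ← Finset.sum_neg_distrib]
    refine Finset.sum_congr rfl fun j _ => ?_
    rw [← Finset.sum_neg_distrib]
    refine Finset.sum_congr rfl fun i _ => ?_
    rw [T.bracket_skew V _ _ (hc i) (hd j) x hx, smul_neg, mul_comm]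
  rw [this]
  abel

/-- Substituting d_j = ∑ l_jq b_q, the Leibniz rule of E produces derivatives of l_jq along the
anchors of the c_i, whereas the new coefficients ∑ g_j l_jq produce derivatives of l_jq along v.
They agree because l_jq is foliated and v represents the anchor of ∑ f_i c_i. Only this argument
needs treatment: skew-symmetry handles the other. -/
theorem bracketExpr_change_right {μ : Type*} [Fintype μ] {V : Opens M} (hx : x ∈ V)
    (hc : ∀ i, Φ.IsFol V (c i)) {b : μ → Π x, E x} (hb : ∀ q, Φ.IsFol V (b q))
    {l : κ → μ → M → ℝ} (hl : ∀ j q, 𝓕.IsFolFun V (l j q))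
    (hd : ∀ j, ∀ y ∈ V, d j y = ∑ q, l j q y • b q y) (hg : ∀ j, SmoothFunAt m (g j) x)
    {G : μ → M → ℝ} (hG : ∀ q, ∀ᶠ y in nhds x, G q y = ∑ j, g j y * l j q y)
    (hv : 𝓕.toNormal x v = T.anchor x (∑ i, f i x • c i x)) :
    bracketExpr T x v v' f c g d = bracketExpr T x v v' f c G b := by
  -- Tangent vectors representing the anchors of the c_i; v and ∑ f_i w_i have the same class in νℱ.
  choose w hw using fun i => toNormal_surjective (𝓕 := 𝓕) x (T.anchor x (c i x))
  have hvw : ∀ j q, dirDeriv (l j q) x v = ∑ i, f i x * dirDeriv (l j q) x (w i) := by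
    intro j q
    rw [dirDeriv_eq_of_toNormal_eq 𝓕 (hl j q) hx (w := ∑ i, f i x • w i), dirDeriv_sum_vec]
    · simp only [dirDeriv_smul_vec]
    · rw [hv, map_sum, map_sum]
      simp only [map_smul, hw]
  have hbr : ∀ i j, T.bracket (c i) (d j) x =
      ∑ q, (l j q x • T.bracket (c i) (b q) x + dirDeriv (l j q) x (w i) • b q x) := by
    intro i j
    rw [← bracket_sum_right T hx (hc i) Finset.univ (fun q _ => hl j q) (fun q _ => hb q) (hw i)]
    refine T.bracket_congr V _ _ _ _ (hc i) ?_ (fun _ _ => rfl) (hd j) x hx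
    exact Φ.congr _ _ _ (fun y hy => (hd j y hy).symm) (isFol_sum_smul hb (hl j))
  have hGx : ∀ q, G q x = ∑ j, g j x * l j q x := fun q => (hG q).self_of_nhds
  have hGd : ∀ q, dirDeriv (G q) x v =
      ∑ j, (g j x * dirDeriv (l j q) x v + dirDeriv (g j) x v * l j q x) := by
    intro q
    rw [dirDeriv_congr (hG q), dirDeriv_sum _ fun j _ => SmoothFunAt.mul (hg j) ((hl j q).1.at hx)]
    exact Finset.sum_congr rfl fun j _ => dirDeriv_mul (hg j) ((hl j q).1.at hx) v
  unfold bracketExpr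
  -- The double sum of g_j v(l_jq) b_q occurs once in `e2`, from the product rule, and once in `e3`,
  -- from the Leibniz rule; all other terms match directly.
  have e1 : ∑ j, dirDeriv (g j) x v • d j x =
      ∑ q, ∑ j, (dirDeriv (g j) x v * l j q x) • b q x := by
    rw [Finset.sum_comm]
    refine Finset.sum_congr rfl fun j _ => ?_
    rw [hd j x hx, Finset.smul_sum]
    simp only [mul_smul]
  have e2 : ∑ q, dirDeriv (G q) x v • b q x =
      ∑ q, ∑ j, (g j x * dirDeriv (l j q) x v) • b q x +
        ∑ q, ∑ j, (dirDeriv (g j) x v * l j q x) • b q x := by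
    rw [← Finset.sum_add_distrib]
    refine Finset.sum_congr rfl fun q _ => ?_
    rw [hGd, Finset.sum_smul, ← Finset.sum_add_distrib]
    simp only [add_smul]
  have e3 : ∑ i, ∑ j, (f i x * g j x) • T.bracket (c i) (d j) x =
      ∑ i, ∑ q, (f i x * G q x) • T.bracket (c i) (b q) x +
        ∑ q, ∑ j, (g j x * dirDeriv (l j q) x v) • b q x := by
    have e4 : ∑ i, ∑ j, (f i x * g j x) • T.bracket (c i) (d j) x =
        ∑ i, ∑ j, ∑ q, (f i x * g j x * l j q x) • T.bracket (c i) (b q) x +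
        ∑ i, ∑ j, ∑ q, (f i x * g j x * dirDeriv (l j q) x (w i)) • b q x := by
      simp only [← Finset.sum_add_distrib]
      refine Finset.sum_congr rfl fun i _ => Finset.sum_congr rfl fun j _ => ?_
      rw [hbr, Finset.smul_sum]
      simp only [smul_add, mul_smul]
    rw [e4]
    congr 1
    · refine Finset.sum_congr rfl fun i _ => ?_
      rw [Finset.sum_comm]
      refine Finset.sum_congr rfl fun q _ => ?_
      rw [hGx, Finset.mul_sum, Finset.sum_smul]
      simp only [mul_assoc]
    · rw [Finset.sum_comm]
      simp only [fun j => Finset.sum_comm (s := (Finset.univ : Finset ι)) (t := (Finset.univ : Finset μ))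
        (f := fun i q => (f i x * g j x * dirDeriv (l j q) x (w i)) • b q x)]
      rw [Finset.sum_comm]
      refine Finset.sum_congr rfl fun q _ => Finset.sum_congr rfl fun j _ => ?_
      rw [hvw, Finset.mul_sum, Finset.sum_smul]
      refine Finset.sum_congr rfl fun i _ => ?_
      congr 1; ring
  rw [e1, e2, e3]
  abel

end Expr

/-- The size of the chosen foliated frame around `x`. -/
def frameRank (Φ : FoliatedStructure 𝓕 R E) (x : M) : ℕ := (exists_folFrame Φ x).choose_spec.choose

/-- The domain of the chosen foliated frame around `x`. -/
def frameDomain (Φ : FoliatedStructure 𝓕 R E) (x : M) : Opens M := (exists_folFrame Φ x).choose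

/-- The chosen foliated frame around `x`. -/
def frameAt (Φ : FoliatedStructure 𝓕 R E) (x : M) : Fin (frameRank Φ x) → Π x, E x :=
  (exists_folFrame Φ x).choose_spec.choose_spec.choose

theorem mem_frameDomain (Φ : FoliatedStructure 𝓕 R E) (x : M) : x ∈ frameDomain Φ x :=
  (exists_folFrame Φ x).choose_spec.choose_spec.choose_spec.1

theorem isFolFrame_frameAt (Φ : FoliatedStructure 𝓕 R E) (x : M) :
    IsFolFrame Φ (frameDomain Φ x) (frameAt Φ x) :=
  (exists_folFrame Φ x).choose_spec.choose_spec.choose_spec.2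

/-- The `E`-component at `x` of the bracket of the sections `(X, e)` and `(X', e')` of
`TM ×_{νℱ} E`, where `X x = v` and `X' x = v'`. -/
def transBracket (x : M) (v v' : TangentSpace (𝓡 m) x) (e e' : Π x, E x) : E x :=
  bracketExpr T x v v' (fun i y => frameCoeff (frameAt Φ x) i y (e y)) (frameAt Φ x)
    (fun i y => frameCoeff (frameAt Φ x) i y (e' y)) (frameAt Φ x)

section TransBracket

variable {x : M} {v v' : TangentSpace (𝓡 m) x} {ι κ : Type*} [Fintype ι] [Fintype κ]
  {f : ι → M → ℝ} {c : ι → Π x, E x} {g : κ → M → ℝ} {d : κ → Π x, E x} {e e' : Π x, E x}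

/-- `transBracket` can be computed by arbitrary expansions into foliated sections. -/
theorem transBracket_eq {V : Opens M} (hx : x ∈ V) (hc : ∀ i, Φ.IsFol V (c i))
    (hd : ∀ j, Φ.IsFol V (d j)) (hf : ∀ i, SmoothFunAt m (f i) x)
    (hg : ∀ j, SmoothFunAt m (g j) x)
    (he : ∀ᶠ y in nhds x, e y = ∑ i, f i y • c i y)
    (he' : ∀ᶠ y in nhds x, e' y = ∑ j, g j y • d j y)
    (hv : 𝓕.toNormal x v = T.anchor x (e x)) (hv' : 𝓕.toNormal x v' = T.anchor x (e' x)) :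
    transBracket T x v v' e e' = bracketExpr T x v v' f c g d := by
  have hb := isFolFrame_frameAt Φ x
  set b := frameAt Φ x
  let W := V ⊓ frameDomain Φ x
  have hxW : x ∈ W := ⟨hx, mem_frameDomain Φ x⟩
  have hbW := hb.mono (V := W) inf_le_right
  replace hc : ∀ i, Φ.IsFol W (c i) := fun i => Φ.restrict _ _ _ inf_le_left (hc i)
  replace hd : ∀ i, Φ.IsFol W (d i) := fun i => Φ.restrict _ _ _ inf_le_left (hd i)
  -- Both expansions are moved to the chosen frame at x: first the second argument, then the first
  -- one between two applications of skew-symmetry.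
  rw [bracketExpr_change_right T hxW hc hbW.isFol
    (l := fun j q y => frameCoeff b q y (d j y)) (fun j q => hbW.isFolFun_coeff le_rfl (hd j) q)
    (fun j y hy => hbW.sum_coeff hy _) hg (frameCoeff_sum _ he') (by rw [hv, he.self_of_nhds])]
  rw [bracketExpr_swap T hxW hc hbW.isFol]
  rw [bracketExpr_change_right T hxW hbW.isFol hbW.isFol
    (l := fun j q y => frameCoeff b q y (c j y)) (fun j q => hbW.isFolFun_coeff le_rfl (hc j) q)
    (fun j y hy => hbW.sum_coeff hy _) hf (frameCoeff_sum _ he) (by rw [hv', ← hbW.sum_coeff hxW])]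
  rw [bracketExpr_swap T hxW hbW.isFol hbW.isFol, neg_neg]
  rfl

end TransBracket

end FoliatedFrames

/-! ### Algebroid laws of the fibre product bracket -/

section TransBracketProperties

variable {m k : ℕ} {M : Type*} [TopologicalSpace M] [ChartedSpace (Coord m) M]
  [IsManifold (𝓡 m) ∞ M] {𝓕 : Foliation m k M} {R : Type*} {E : M → Type*}
  [NormedAddCommGroup R] [NormedSpace ℝ R] [FiniteDimensional ℝ R]
  [∀ x, AddCommGroup (E x)] [∀ x, Module ℝ (E x)] [∀ x, TopologicalSpace (E x)]
  [TopologicalSpace (TotalSpace R E)] [FiberBundle R E] [VectorBundle ℝ R E]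
  [ContMDiffVectorBundle ∞ R E (𝓡 m)]
  {Φ : FoliatedStructure 𝓕 R E} (T : TransLieAlgebroid Φ)

section Pointwise

variable {x : M} {v v' w' : TangentSpace (𝓡 m) x} {e e' e'' : Π x, E x}

theorem smoothFunAt_frameCoeff (he : SmoothSecAt m R e x) (i : Fin (frameRank Φ x)) :
    SmoothFunAt m (fun y => frameCoeff (frameAt Φ x) i y (e y)) x :=
  (isFolFrame_frameAt Φ x).smoothFunAt_coeff (mem_frameDomain Φ x) he i

theorem transBracket_swap : transBracket T x v v' e e' = -transBracket T x v' v e' e :=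
  bracketExpr_swap T (mem_frameDomain Φ x) (isFolFrame_frameAt Φ x).isFol
    (isFolFrame_frameAt Φ x).isFol

theorem transBracket_self : transBracket T x v v e e = 0 := by
  have h := transBracket_swap T (x := x) (v := v) (v' := v) (e := e) (e' := e)
  have h2 : (2 : ℝ) • transBracket T x v v e e = 0 := by
    rw [two_smul]; nth_rewrite 1 [h]; exact neg_add_cancel _
  exact (smul_eq_zero.1 h2).resolve_left two_ne_zero

theorem transBracket_add_right (he' : SmoothSecAt m R e' x) (he'' : SmoothSecAt m R e'' x) :
    transBracket T x v (v' + w') e (fun y => e' y + e'' y) =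
      transBracket T x v v' e e' + transBracket T x v w' e e'' := by
  unfold transBracket bracketExpr
  have h : ∀ j, dirDeriv (fun y => frameCoeff (frameAt Φ x) j y (e' y + e'' y)) x v =
      dirDeriv (fun y => frameCoeff (frameAt Φ x) j y (e' y)) x v +
      dirDeriv (fun y => frameCoeff (frameAt Φ x) j y (e'' y)) x v := fun j => by
    simp only [map_add]
    exact dirDeriv_add (smoothFunAt_frameCoeff he' j) (smoothFunAt_frameCoeff he'' j) v
  simp only [h]
  simp only [dirDeriv_add_vec, map_add, add_smul, mul_add, Finset.sum_add_distrib]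
  abel

theorem transBracket_smul_right {f : M → ℝ} (hf : SmoothFunAt m f x)
    (he' : SmoothSecAt m R e' x) :
    transBracket T x v (f x • v') e (fun y => f y • e' y) =
      f x • transBracket T x v v' e e' + dirDeriv f x v • e' x := by
  have hb := isFolFrame_frameAt Φ x
  unfold transBracket bracketExpr
  have h : ∀ j, dirDeriv (fun y => frameCoeff (frameAt Φ x) j y (f y • e' y)) x v =
      f x * dirDeriv (fun y => frameCoeff (frameAt Φ x) j y (e' y)) x v +
      dirDeriv f x v * frameCoeff (frameAt Φ x) j x (e' x) := fun j => by
    simp only [map_smul, smul_eq_mul]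
    exact dirDeriv_mul hf (smoothFunAt_frameCoeff he' j) v
  have h2 : dirDeriv f x v • e' x =
      ∑ j, (dirDeriv f x v * frameCoeff (frameAt Φ x) j x (e' x)) • frameAt Φ x j x := by
    conv_lhs => rw [hb.sum_coeff (mem_frameDomain Φ x) (e' x), Finset.smul_sum]
    simp only [mul_smul]
  rw [h2]
  simp only [h]
  simp only [dirDeriv_smul_vec, map_smul, smul_eq_mul, add_smul, Finset.sum_add_distrib]
  simp only [smul_add, smul_sub, Finset.smul_sum, mul_smul, smul_comm (f x)]
  abel

/-- Each section is its own expansion, with one generator and the constant coefficient 1, so the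
derivative terms drop out. -/
theorem transBracket_of_isFol {V : Opens M} (hx : x ∈ V) (he : Φ.IsFol V e) (he' : Φ.IsFol V e')
    (hv : 𝓕.toNormal x v = T.anchor x (e x)) (hv' : 𝓕.toNormal x v' = T.anchor x (e' x)) :
    transBracket T x v v' e e' = T.bracket e e' x := by
  rw [transBracket_eq T (ι := Unit) (κ := Unit) (f := fun _ _ => 1) (g := fun _ _ => 1) hx
    (fun _ => he) (fun _ => he') (fun _ => contMDiffAt_const) (fun _ => contMDiffAt_const)
    (by simp) (by simp) hv hv']
  simp [bracketExpr]

/-- With the empty expansion for the zero section and coefficient 1 for the foliated one, every term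
is an empty sum or the derivative of a constant. This is why sections of F and foliated sections of
E have brackets in F. -/
theorem transBracket_leaf_left {V : Opens M} (hx : x ∈ V) (he : ∀ y ∈ V, e y = 0)
    (he' : Φ.IsFol V e') (hv : v ∈ 𝓕.tangent x) (hv' : 𝓕.toNormal x v' = T.anchor x (e' x)) :
    transBracket T x v v' e e' = 0 := by
  have he0 : ∀ᶠ y in nhds x, e y = 0 := Filter.mem_of_superset (V.isOpen.mem_nhds hx) he
  rw [transBracket_eq T (ι := Empty) (κ := Unit) (f := fun i => i.elim) (c := fun i => i.elim)
    (g := fun _ _ => 1) hx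
    (fun i => i.elim) (fun _ => he') (fun i => i.elim) (fun _ => contMDiffAt_const)
    (by simpa using he0) (by simp) (by rw [he x hx, map_zero, toNormal_eq_zero_iff]; exact hv) hv']
  simp [bracketExpr]

end Pointwise

variable {U : Opens M} {X X' X'' : Π x : M, TangentSpace (𝓡 m) x} {e e' e'' : Π x, E x}

/-- `transBracket` picks a separate frame at every point. A single frame valid on all of V is needed
as soon as the bracket is to vary smoothly or to be bracketed again. -/
theorem transBracket_eq_bracketExpr {V : Opens M} {r : ℕ} {b : Fin r → Π x, E x}
    (hb : IsFolFrame Φ V b) (he : SmoothSection m R V e) (he' : SmoothSection m R V e')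
    (h : ∀ y ∈ V, 𝓕.toNormal y (X y) = T.anchor y (e y))
    (h' : ∀ y ∈ V, 𝓕.toNormal y (X' y) = T.anchor y (e' y)) {y : M} (hy : y ∈ V) :
    transBracket T y (X y) (X' y) e e' = bracketExpr T y (X y) (X' y)
      (fun i y => frameCoeff b i y (e y)) b (fun i y => frameCoeff b i y (e' y)) b := by
  have hV : ∀ e : Π x, E x, ∀ᶠ z in nhds y, e z = ∑ i, frameCoeff b i z (e z) • b i z := fun e =>
    Filter.mem_of_superset (V.isOpen.mem_nhds hy) fun z hz => hb.sum_coeff hz _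
  exact transBracket_eq T hy hb.isFol hb.isFol (fun i => hb.smoothFunAt_coeff hy (he.at hy) i)
    (fun i => hb.smoothFunAt_coeff hy (he'.at hy) i) (hV e) (hV e') (h y hy) (h' y hy)

theorem smoothSection_transBracket (hX : SmoothVF U X) (hX' : SmoothVF U X')
    (he : SmoothSection m R U e) (he' : SmoothSection m R U e')
    (h : ∀ y ∈ U, 𝓕.toNormal y (X y) = T.anchor y (e y))
    (h' : ∀ y ∈ U, 𝓕.toNormal y (X' y) = T.anchor y (e' y)) :
    SmoothSection m R U (fun y => transBracket T y (X y) (X' y) e e') := by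
  refine smoothSection_iff.2 fun x hx => ?_
  obtain ⟨U', r, b, hx', hb⟩ := exists_folFrame Φ x
  let V := U ⊓ U'
  have hxV : x ∈ V := ⟨hx, hx'⟩
  replace hb := hb.mono (V := V) inf_le_right
  replace he := he.mono (V := V) inf_le_left
  replace he' := he'.mono (V := V) inf_le_left
  replace hX : SmoothVF V X := SmoothSection.mono hX inf_le_left
  replace hX' : SmoothVF V X' := SmoothSection.mono hX' inf_le_left
  have hf := hb.smoothFun_coeff le_rfl he
  have hg := hb.smoothFun_coeff le_rfl he'
  refine SmoothSecAt.congr (s := fun y => bracketExpr T y (X y) (X' y)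
      (fun i y => frameCoeff b i y (e y)) b (fun i y => frameCoeff b i y (e' y)) b) ?_ ?_
  · refine SmoothSecAt.add (SmoothSecAt.sub (SmoothSecAt.sum fun j _ => SmoothSecAt.smul
      (((hg j).dirDeriv hX).at hxV) ((hb.smooth j).at hxV)) (SmoothSecAt.sum fun j _ =>
      SmoothSecAt.smul (((hf j).dirDeriv hX').at hxV) ((hb.smooth j).at hxV)))
      (SmoothSecAt.sum fun i _ => SmoothSecAt.sum fun j _ => SmoothSecAt.smul
      (((hf i).mul (hg j)).at hxV) ?_)
    exact (isFol_smooth (T.bracket_fol V _ _ (hb.isFol i) (hb.isFol j))).at hxV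
  · filter_upwards [V.isOpen.mem_nhds hxV] with y hy
    exact transBracket_eq_bracketExpr T hb he he' (fun y hy => h y hy.1) (fun y hy => h' y hy.1) hy

variable {T} {ρ : Π x : M, E x →ₗ[ℝ] TangentSpace (𝓡 m) x} (hρ : IsLift T ρ)
include hρ

theorem IsLift.isFolVF {V : Opens M} (he : Φ.IsFol V e) : 𝓕.IsFolVF V (fun x => ρ x (e x)) := by
  refine isFolVF_of_isFolNormal 𝓕 (hρ.smooth V e (isFol_smooth he)) ?_
  simp only [hρ.proj]
  exact T.anchor_fol V e he

theorem IsLift.bracket_proj {V : Opens M} (he : Φ.IsFol V e) (he' : Φ.IsFol V e') {x : M}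
    (hx : x ∈ V) : T.anchor x (T.bracket e e' x) =
      𝓕.toNormal x (lieVF (fun y => ρ y (e y)) (fun y => ρ y (e' y)) x) :=
  T.anchor_bracket V e e' _ _ he he' (hρ.isFolVF he) (hρ.isFolVF he') (fun x _ => hρ.proj x _)
    (fun x _ => hρ.proj x _) x hx

/-- `♯ : TM ×_{νℱ} E → νℱ` is compatible with brackets. -/
theorem IsLift.anchor_transBracket (hX : SmoothVF U X) (hX' : SmoothVF U X')
    (he : SmoothSection m R U e) (he' : SmoothSection m R U e')
    (h : ∀ y ∈ U, 𝓕.toNormal y (X y) = T.anchor y (e y))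
    (h' : ∀ y ∈ U, 𝓕.toNormal y (X' y) = T.anchor y (e' y)) {x : M} (hx : x ∈ U) :
    T.anchor x (transBracket T x (X x) (X' x) e e') = 𝓕.toNormal x (lieVF X X' x) := by
  obtain ⟨U', r, b, hx', hb⟩ := exists_folFrame Φ x
  let V := U ⊓ U'
  have hxV : x ∈ V := ⟨hx, hx'⟩
  replace hb := hb.mono (V := V) inf_le_right
  replace he := he.mono (V := V) inf_le_left
  replace he' := he'.mono (V := V) inf_le_left
  replace hX : SmoothVF V X := SmoothSection.mono hX inf_le_left
  replace hX' : SmoothVF V X' := SmoothSection.mono hX' inf_le_left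
  replace h : ∀ y ∈ V, 𝓕.toNormal y (X y) = T.anchor y (e y) := fun y hy => h y hy.1
  replace h' : ∀ y ∈ V, 𝓕.toNormal y (X' y) = T.anchor y (e' y) := fun y hy => h' y hy.1
  let f : Fin r → M → ℝ := fun i y => frameCoeff b i y (e y)
  let g : Fin r → M → ℝ := fun i y => frameCoeff b i y (e' y)
  let P : Fin r → Π x : M, TangentSpace (𝓡 m) x := fun i y => ρ y (b i y)
  have hP : ∀ i, 𝓕.IsFolVF V (P i) := fun i => hρ.isFolVF (hb.isFol i)
  have hf : ∀ i, SmoothFun m V (f i) := hb.smoothFun_coeff le_rfl he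
  have hg : ∀ i, SmoothFun m V (g i) := hb.smoothFun_coeff le_rfl he'
  rw [transBracket_eq_bracketExpr T hb he he' h h' hxV]
  -- A tangent vector representing the anchor of the Leibniz expression: each b_i is replaced by its
  -- lift and each bracket of the frame by the bracket of the lifts.
  let z : TangentSpace (𝓡 m) x := ∑ j, dirDeriv (g j) x (X x) • P j x -
    ∑ i, dirDeriv (f i) x (X' x) • P i x + ∑ i, ∑ j, (f i x * g j x) • lieVF (P i) (P j) x
  have hz : T.anchor x (bracketExpr T x (X x) (X' x) f b g b) = 𝓕.toNormal x z := by
    simp only [bracketExpr, z, map_add, map_sub, map_sum, map_smul]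
    simp only [P, hρ.proj, hρ.bracket_proj (hb.isFol _) (hb.isFol _) hxV]
  rw [hz]
  refine toNormal_eq_of_dirDeriv 𝓕 fun V' φ hxφ hφ => ?_
  let W := V ⊓ V'
  have hxW : x ∈ W := ⟨hxV, hxφ⟩
  have hφW := IsFolFun_restrict 𝓕 hφ (inf_le_right : W ≤ V')
  have hWV : W ≤ V := inf_le_left
  have hPφ : ∀ i, 𝓕.IsFolFun W (fun y => dirDeriv φ y (P i y)) := fun i =>
    isFolFun_dirDeriv 𝓕 hφW (hP i) hWV
  -- On foliated functions Y acts like the combination of the lifted frame with the coefficients of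
  -- a, as both have the same class in νℱ.
  have expand : ∀ {Y : Π x : M, TangentSpace (𝓡 m) x} {a : Π x, E x} {ψ : M → ℝ} {V' : Opens M},
      (∀ y ∈ V, 𝓕.toNormal y (Y y) = T.anchor y (a y)) → 𝓕.IsFolFun V' ψ → ∀ y ∈ V, y ∈ V' →
      dirDeriv ψ y (Y y) = ∑ i, frameCoeff b i y (a y) * dirDeriv ψ y (P i y) := by
    intro Y a ψ V' hY hψ y hy hy'
    rw [dirDeriv_eq_of_toNormal_eq 𝓕 hψ hy' (w := ∑ i, frameCoeff b i y (a y) • P i y),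
      dirDeriv_sum_vec]
    · simp only [dirDeriv_smul_vec]
    · rw [hY y hy, map_sum]
      conv_lhs => rw [hb.sum_coeff hy (a y)]
      simp only [map_sum, map_smul, P, hρ.proj]
  have hW : ∀ᶠ y in nhds x, y ∈ W := W.isOpen.mem_nhds hxW
  -- The derivative of φ along a lifted frame field is again foliated, so `expand` applies a second
  -- time. Antisymmetrizing in Y and Z then gives the derivative of φ along `z`.
  have second : ∀ {Y Z : Π x : M, TangentSpace (𝓡 m) x} {a c : Π x, E x},
      (∀ y ∈ V, 𝓕.toNormal y (Y y) = T.anchor y (a y)) →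
      (∀ y ∈ V, 𝓕.toNormal y (Z y) = T.anchor y (c y)) →
      (∀ i, SmoothFun m V (fun y => frameCoeff b i y (c y))) →
      dirDeriv (fun y => dirDeriv φ y (Z y)) x (Y x) =
        ∑ j, dirDeriv (fun y => frameCoeff b j y (c y)) x (Y x) * dirDeriv φ x (P j x) +
        ∑ j, ∑ i, frameCoeff b i x (a x) * frameCoeff b j x (c x) *
          dirDeriv (fun y => dirDeriv φ y (P j y)) x (P i x) := by
    intro Y Z a c hY hZ hc
    rw [dirDeriv_congr (hW.mono fun y hy => expand hZ hφ y hy.1 hy.2),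
      dirDeriv_sum _ fun j _ => SmoothFunAt.mul ((hc j).at hxV) ((hPφ j).1.at hxW),
      ← Finset.sum_add_distrib]
    refine Finset.sum_congr rfl fun j _ => ?_
    rw [dirDeriv_mul ((hc j).at hxV) ((hPφ j).1.at hxW), expand hY (hPφ j) x hxV hxW,
      Finset.mul_sum, add_comm]
    congr 1
    exact Finset.sum_congr rfl fun i _ => by ring
  rw [dirDeriv_lieVF hxW hφW.1 (SmoothSection.mono hX hWV) (SmoothSection.mono hX' hWV),
    second h h' hg, second h' h hf]
  simp only [z, dirDeriv_add_vec, dirDeriv_sub_vec, dirDeriv_sum_vec, dirDeriv_smul_vec,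
    dirDeriv_lieVF hxW hφW.1 (SmoothSection.mono (hP _).1 hWV) (SmoothSection.mono (hP _).1 hWV)]
  rw [Finset.sum_comm (f := fun j i => frameCoeff b i x (e x) * frameCoeff b j x (e' x) *
          dirDeriv (fun y => dirDeriv φ y (P j y)) x (P i x))]
  simp only [mul_sub, Finset.sum_sub_distrib]
  have : ∀ i j, frameCoeff b i x (e' x) * frameCoeff b j x (e x) *
      dirDeriv (fun y => dirDeriv φ y (P j y)) x (P i x) =
      f j x * g i x * dirDeriv (fun y => dirDeriv φ y (P j y)) x (P i x) := fun i j => by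
    simp only [f, g]; ring
  simp only [this]
  simp only [f, g]
  ring

/-- The Jacobi identity for the bracket of `TM ×_{νℱ} E`. -/
theorem IsLift.transBracket_jacobi (hX : SmoothVF U X) (hX' : SmoothVF U X')
    (hX'' : SmoothVF U X'') (he : SmoothSection m R U e) (he' : SmoothSection m R U e')
    (he'' : SmoothSection m R U e'')
    (h : ∀ y ∈ U, 𝓕.toNormal y (X y) = T.anchor y (e y))
    (h' : ∀ y ∈ U, 𝓕.toNormal y (X' y) = T.anchor y (e' y))
    (h'' : ∀ y ∈ U, 𝓕.toNormal y (X'' y) = T.anchor y (e'' y)) {x : M} (hx : x ∈ U) :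
    transBracket T x (X x) (lieVF X' X'' x) e
        (fun y => transBracket T y (X' y) (X'' y) e' e'') +
      transBracket T x (X' x) (lieVF X'' X x) e'
        (fun y => transBracket T y (X'' y) (X y) e'' e) +
      transBracket T x (X'' x) (lieVF X X' x) e''
        (fun y => transBracket T y (X y) (X' y) e e') = 0 := by
  obtain ⟨U', r, b, hx', hb⟩ := exists_folFrame Φ x
  let V := U ⊓ U'
  have hxV : x ∈ V := ⟨hx, hx'⟩
  replace hb := hb.mono (V := V) inf_le_right
  replace he := he.mono (V := V) inf_le_left
  replace he' := he'.mono (V := V) inf_le_left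
  replace he'' := he''.mono (V := V) inf_le_left
  replace hX : SmoothVF V X := SmoothSection.mono hX inf_le_left
  replace hX' : SmoothVF V X' := SmoothSection.mono hX' inf_le_left
  replace hX'' : SmoothVF V X'' := SmoothSection.mono hX'' inf_le_left
  replace h : ∀ y ∈ V, 𝓕.toNormal y (X y) = T.anchor y (e y) := fun y hy => h y hy.1
  replace h' : ∀ y ∈ V, 𝓕.toNormal y (X' y) = T.anchor y (e' y) := fun y hy => h' y hy.1
  replace h'' : ∀ y ∈ V, 𝓕.toNormal y (X'' y) = T.anchor y (e'' y) := fun y hy => h'' y hy.1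
  -- bilinear and trilinear expressions in the brackets of the frame
  let β : (Fin r → ℝ) → (Fin r → ℝ) → E x := fun a c =>
    ∑ i, ∑ j, (a i * c j) • T.bracket (b i) (b j) x
  let γ : (Fin r → ℝ) → (Fin r → ℝ) → (Fin r → ℝ) → E x := fun a c d =>
    ∑ i, ∑ j, ∑ l, (a i * c j * d l) • T.bracket (b i) (T.bracket (b j) (b l)) x
  let δ : (Fin r → ℝ) → E x := fun a => ∑ i, a i • b i x
  have hβ : ∀ a c, β a c = -β c a := by
    intro a c
    simp only [β]
    rw [Finset.sum_comm, ← Finset.sum_neg_distrib]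
    refine Finset.sum_congr rfl fun j _ => ?_
    rw [← Finset.sum_neg_distrib]
    refine Finset.sum_congr rfl fun i _ => ?_
    rw [T.bracket_skew V _ _ (hb.isFol i) (hb.isFol j) x hxV, smul_neg, mul_comm]
  have hβsub : ∀ a c d, β a (c - d) = β a c - β a d := by
    intro a c d
    simp only [β, Pi.sub_apply, mul_sub, sub_smul, Finset.sum_sub_distrib]
  have hδsub : ∀ a c, δ (a - c) = δ a - δ c := by
    intro a c
    simp only [δ, Pi.sub_apply, sub_smul, Finset.sum_sub_distrib]
  have hγ : ∀ a c d, γ a c d + γ c d a + γ d a c = 0 := by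
    intro a c d
    have e1 : γ c d a = ∑ i, ∑ j, ∑ l,
        (a i * c j * d l) • T.bracket (b j) (T.bracket (b l) (b i)) x := by
      simp only [γ]
      rw [Finset.sum_comm]
      simp only [fun j => Finset.sum_comm (s := (Finset.univ : Finset (Fin r)))
        (t := (Finset.univ : Finset (Fin r)))
        (f := fun i l => (c i * d j * a l) • T.bracket (b i) (T.bracket (b j) (b l)) x)]
      rw [Finset.sum_comm]
      refine Finset.sum_congr rfl fun i _ => ?_
      rw [Finset.sum_comm]
      refine Finset.sum_congr rfl fun j _ => Finset.sum_congr rfl fun l _ => ?_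
      congr 1; ring
    have e2 : γ d a c = ∑ i, ∑ j, ∑ l,
        (a i * c j * d l) • T.bracket (b l) (T.bracket (b i) (b j)) x := by
      simp only [γ]
      rw [Finset.sum_comm]
      refine Finset.sum_congr rfl fun i _ => ?_
      rw [Finset.sum_comm]
      refine Finset.sum_congr rfl fun j _ => Finset.sum_congr rfl fun l _ => ?_
      congr 1; ring
    rw [e1, e2]
    simp only [γ, ← Finset.sum_add_distrib, ← smul_add]
    refine Finset.sum_eq_zero fun i _ => Finset.sum_eq_zero fun j _ =>
      Finset.sum_eq_zero fun l _ => ?_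
    rw [T.jacobi V _ _ _ (hb.isFol i) (hb.isFol j) (hb.isFol l) x hxV, smul_zero]
  -- One cyclic term, sorted by type: δ collects second derivatives of coefficients, β first
  -- derivatives times brackets of the frame, γ double brackets of the frame.
  have key : ∀ {X X' X'' : Π x : M, TangentSpace (𝓡 m) x} {e e' e'' : Π x, E x},
      SmoothVF V X → SmoothVF V X' → SmoothVF V X'' → SmoothSection m R V e →
      SmoothSection m R V e' → SmoothSection m R V e'' →
      (∀ y ∈ V, 𝓕.toNormal y (X y) = T.anchor y (e y)) →
      (∀ y ∈ V, 𝓕.toNormal y (X' y) = T.anchor y (e' y)) →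
      (∀ y ∈ V, 𝓕.toNormal y (X'' y) = T.anchor y (e'' y)) →
      transBracket T x (X x) (lieVF X' X'' x) e
        (fun y => transBracket T y (X' y) (X'' y) e' e'') =
      δ (fun j => dirDeriv (fun y => dirDeriv (fun z => frameCoeff b j z (e'' z)) y (X' y)) x (X x))
      - δ (fun j => dirDeriv (fun y => dirDeriv (fun z => frameCoeff b j z (e' z)) y (X'' y)) x (X x))
      - (δ (fun j => dirDeriv (fun y => dirDeriv (fun z => frameCoeff b j z (e z)) y (X'' y)) x (X' x))
      - δ (fun j => dirDeriv (fun y => dirDeriv (fun z => frameCoeff b j z (e z)) y (X' y)) x (X'' x)))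
      + β (fun j => dirDeriv (fun z => frameCoeff b j z (e' z)) x (X x))
          (fun j => frameCoeff b j x (e'' x))
      + β (fun j => frameCoeff b j x (e' x))
          (fun j => dirDeriv (fun z => frameCoeff b j z (e'' z)) x (X x))
      + (β (fun j => frameCoeff b j x (e x))
          (fun j => dirDeriv (fun z => frameCoeff b j z (e'' z)) x (X' x))
        - β (fun j => frameCoeff b j x (e x))
          (fun j => dirDeriv (fun z => frameCoeff b j z (e' z)) x (X'' x)))
      + γ (fun j => frameCoeff b j x (e x)) (fun j => frameCoeff b j x (e' x))
          (fun j => frameCoeff b j x (e'' x)) := by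
    intro X X' X'' e e' e'' hX hX' hX'' he he' he'' h h' h''
    have hf := hb.smoothFun_coeff le_rfl he
    have hg := hb.smoothFun_coeff le_rfl he'
    have hh := hb.smoothFun_coeff le_rfl he''
    let A : Fin r → M → ℝ := fun j y => dirDeriv (fun z => frameCoeff b j z (e'' z)) y (X' y) -
      dirDeriv (fun z => frameCoeff b j z (e' z)) y (X'' y)
    have hA1 := fun j => (hh j).dirDeriv hX'
    have hA2 := fun j => (hg j).dirDeriv hX''
    -- The inner bracket is expanded in the frame together with all brackets of frame elements.
    -- These are foliated too, so no structure functions have to be introduced or differentiated.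
    let G : Fin r ⊕ Fin r × Fin r → M → ℝ := Sum.elim A
      (fun p y => frameCoeff b p.1 y (e' y) * frameCoeff b p.2 y (e'' y))
    let d : Fin r ⊕ Fin r × Fin r → Π x, E x := Sum.elim b (fun p => T.bracket (b p.1) (b p.2))
    have hd : ∀ p, Φ.IsFol V (d p) := by
      rintro (j | p)
      · exact hb.isFol j
      · exact T.bracket_fol V _ _ (hb.isFol _) (hb.isFol _)
    have hG : ∀ p, SmoothFunAt m (G p) x := by
      rintro (j | p)
      · exact ((hA1 j).sub (hA2 j)).at hxV
      · exact ((hg p.1).mul (hh p.2)).at hxV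
    have hV : ∀ᶠ y in nhds x, y ∈ V := V.isOpen.mem_nhds hxV
    rw [transBracket_eq T (ι := Fin r) (f := fun i y => frameCoeff b i y (e y)) (c := b) (g := G)
      (d := d) hxV hb.isFol hd (fun i => (hf i).at hxV) hG
      (hV.mono fun y hy => hb.sum_coeff hy _) (hV.mono fun y hy => ?_) (h x hxV)
      (hρ.anchor_transBracket hX' hX'' he' he'' h' h'' hxV).symm]
    · have e1 : ∑ p, dirDeriv (G p) x (X x) • d p x =
          δ (fun j => dirDeriv (fun y => dirDeriv (fun z => frameCoeff b j z (e'' z)) y (X' y)) x (X x))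
          - δ (fun j => dirDeriv (fun y => dirDeriv (fun z => frameCoeff b j z (e' z)) y (X'' y)) x
            (X x))
          + (β (fun j => frameCoeff b j x (e' x))
            (fun j => dirDeriv (fun z => frameCoeff b j z (e'' z)) x (X x))
          + β (fun j => dirDeriv (fun z => frameCoeff b j z (e' z)) x (X x))
          (fun j => frameCoeff b j x (e'' x))) := by
        rw [Fintype.sum_sum_type, Fintype.sum_prod_type]
        simp only [G, d, Sum.elim_inl, Sum.elim_inr]
        congr 1
        · rw [← hδsub]
          refine Finset.sum_congr rfl fun j _ => ?_
          rw [Pi.sub_apply, dirDeriv_sub ((hA1 j).at hxV) ((hA2 j).at hxV)]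
        · simp only [β, ← Finset.sum_add_distrib, ← add_smul]
          refine Finset.sum_congr rfl fun i _ => Finset.sum_congr rfl fun j _ => ?_
          rw [dirDeriv_mul ((hg i).at hxV) ((hh j).at hxV)]
      have e2 : ∑ i, dirDeriv (fun y => frameCoeff b i y (e y)) x (lieVF X' X'' x) • b i x =
          δ (fun j => dirDeriv (fun y => dirDeriv (fun z => frameCoeff b j z (e z)) y (X'' y)) x (X' x))
          - δ (fun j => dirDeriv (fun y => dirDeriv (fun z => frameCoeff b j z (e z)) y (X' y)) x
            (X'' x)) := by
        rw [← hδsub]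
        refine Finset.sum_congr rfl fun i _ => ?_
        rw [dirDeriv_lieVF hxV (hf i) hX' hX'']; rfl
      have e3 : ∑ i, ∑ p, (frameCoeff b i x (e x) * G p x) • T.bracket (b i) (d p) x =
          (β (fun j => frameCoeff b j x (e x))
            (fun j => dirDeriv (fun z => frameCoeff b j z (e'' z)) x (X' x))
          - β (fun j => frameCoeff b j x (e x))
            (fun j => dirDeriv (fun z => frameCoeff b j z (e' z)) x (X'' x)))
          + γ (fun j => frameCoeff b j x (e x)) (fun j => frameCoeff b j x (e' x))
            (fun j => frameCoeff b j x (e'' x)) := by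
        rw [← hβsub]
        simp only [β, γ, ← Finset.sum_add_distrib]
        refine Finset.sum_congr rfl fun i _ => ?_
        rw [Fintype.sum_sum_type, Fintype.sum_prod_type, Finset.sum_add_distrib]
        simp only [G, d, A, Sum.elim_inl, Sum.elim_inr, Pi.sub_apply, mul_assoc]
      unfold bracketExpr
      rw [e1, e2, e3]
      abel
    · rw [transBracket_eq_bracketExpr T hb he' he'' h' h'' hy]
      unfold bracketExpr
      rw [Fintype.sum_sum_type, Fintype.sum_prod_type]
      simp only [G, d, A, Sum.elim_inl, Sum.elim_inr, sub_smul, Finset.sum_sub_distrib]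
  rw [key hX hX' hX'' he he' he'' h h' h'', key hX' hX'' hX he' he'' he h' h'' h,
    key hX'' hX hX' he'' he he' h'' h h']
  have hγ' := hγ (fun j => frameCoeff b j x (e x)) (fun j => frameCoeff b j x (e' x))
          (fun j => frameCoeff b j x (e'' x))
  -- In the cyclic sum the δ-terms cancel pairwise. The β-terms cancel once the three with a
  -- derivative in the first slot are swapped, and the γ-terms add up to zero by the Jacobi identity
  -- of E.
  rw [hβ (fun j => dirDeriv (fun z => frameCoeff b j z (e' z)) x (X x))
          (fun j => frameCoeff b j x (e'' x)),
    hβ (fun j => dirDeriv (fun z => frameCoeff b j z (e'' z)) x (X' x))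
          (fun j => frameCoeff b j x (e x)),
    hβ (fun j => dirDeriv (fun z => frameCoeff b j z (e z)) x (X'' x))
          (fun j => frameCoeff b j x (e' x))]
  rw [← hγ']
  abel

end TransBracketProperties

/-! ### Locality of Lie algebroid brackets and extension of local sections -/

section LieAlgebroidLocality

variable {m : ℕ} {M : Type*} [TopologicalSpace M] [ChartedSpace (Coord m) M]
  [IsManifold (𝓡 m) ∞ M] {R : Type*} {W : M → Type*}
  [NormedAddCommGroup R] [NormedSpace ℝ R]
  [∀ x, AddCommGroup (W x)] [∀ x, Module ℝ (W x)] [∀ x, TopologicalSpace (W x)]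
  [TopologicalSpace (TotalSpace R W)] [FiberBundle R W] [VectorBundle ℝ R W]
  {S : Π x, Submodule ℝ (W x)} (L : LieAlgebroid m R S)

theorem sec_sum_apply {ι : Type*} (J : Finset ι) (a : ι → Sec m R S) (x : M) :
    (∑ i ∈ J, a i).1 x = ∑ i ∈ J, (a i).1 x := by
  classical
  induction J using Finset.induction_on with
  | empty => simp
  | insert i J hi ih =>
    rw [Finset.sum_insert hi, Finset.sum_insert hi, ← ih]
    rfl

theorem mulSec_apply (f : M → ℝ) (hf : SmoothFun m ⊤ f) (s : Sec m R S) (x : M) :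
    (mulSec f hf s).1 x = f x • s.1 x := rfl

theorem sec_add_apply (s t : Sec m R S) (x : M) : (s + t).1 x = s.1 x + t.1 x := rfl

theorem LieAlgebroid.bracket_swap (a b : Sec m R S) : L.bracket a b = -L.bracket b a := by
  have h := L.bracket_self (a + b)
  simp only [map_add, LinearMap.add_apply, L.bracket_self, zero_add, add_zero] at h
  rw [add_comm] at h
  exact eq_neg_of_add_eq_zero_left h

theorem LieAlgebroid.bracket_swap_apply (a b : Sec m R S) (x : M) :
    (L.bracket a b).1 x = -(L.bracket b a).1 x := by
  rw [L.bracket_swap]; rfl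

variable [T2Space M]

/-- A bump function χ supported where a vanishes gives a = (1 − χ)a, and both Leibniz terms are zero
at x. The bracket is given on global sections only, so locality has to be derived in this way. -/
theorem LieAlgebroid.bracket_eq_zero_of_eventually (c a : Sec m R S) {x : M}
    (h : ∀ᶠ y in nhds x, a.1 y = 0) : (L.bracket c a).1 x = 0 := by
  obtain ⟨V, hV, hVo, hxV⟩ := eventually_nhds_iff.1 h
  obtain ⟨χ, hχ, hχ1, hsupp⟩ := exists_bump (m := m) x ⟨V, hVo⟩ hxV
  have hψ : SmoothFun m ⊤ (fun y => 1 - χ y) := SmoothFun.sub contMDiffOn_const hχ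
  have ha : a = mulSec _ hψ a := by
    refine Subtype.ext (funext fun y => ?_)
    change a.1 y = (1 - χ y) • a.1 y
    by_cases hy : y ∈ tsupport χ
    · rw [hV y (hsupp hy), smul_zero]
    · rw [image_eq_zero_of_notMem_tsupport hy, sub_zero, one_smul]
  rw [ha, L.leibniz, h.self_of_nhds, smul_zero, add_zero, hχ1.self_of_nhds, sub_self, zero_smul]

theorem LieAlgebroid.bracket_congr_right (c : Sec m R S) {a a' : Sec m R S} {x : M}
    (h : ∀ᶠ y in nhds x, a.1 y = a'.1 y) : (L.bracket c a).1 x = (L.bracket c a').1 x := by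
  have := L.bracket_eq_zero_of_eventually c (a - a') (x := x)
    (h.mono fun y hy => sub_eq_zero.2 hy)
  rw [map_sub] at this
  exact sub_eq_zero.1 this

/-- The coefficients are cut off to global functions, which by locality alters neither the bracket
nor their derivatives at x; then the global Leibniz rule applies. -/
theorem LieAlgebroid.bracket_expand (c a : Sec m R S) {U : Opens M} {x : M} (hx : x ∈ U)
    {ι : Type*} [Fintype ι] {f : ι → M → ℝ} {t : ι → Sec m R S} (hf : ∀ i, SmoothFun m U (f i))
    (h : ∀ y ∈ U, a.1 y = ∑ i, f i y • (t i).1 y) :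
    (L.bracket c a).1 x = ∑ i, (f i x • (L.bracket c (t i)).1 x +
      dirDeriv (f i) x (L.anchor x (c.1 x)) • (t i).1 x) := by
  obtain ⟨χ, hχ, hχ1, hsupp⟩ := exists_bump (m := m) x U hx
  have hF : ∀ i, SmoothFun m ⊤ (fun y => χ y * f i y) := fun i => hχ.mul_bump hsupp (hf i)
  rw [L.bracket_congr_right c (a' := ∑ i, mulSec _ (hF i) (t i)), map_sum, sec_sum_apply]
  · refine Finset.sum_congr rfl fun i _ => ?_
    rw [L.leibniz, hχ1.self_of_nhds, one_mul]
    congr 2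
    exact dirDeriv_congr (hχ1.mono fun y hy => by rw [hy, one_mul]) _
  · filter_upwards [hχ1, U.isOpen.mem_nhds hx] with y hy hyU
    rw [h y hyU, sec_sum_apply]
    refine Finset.sum_congr rfl fun i _ => ?_
    change _ = (χ y * f i y) • (t i).1 y
    rw [hy, one_mul]

/-- The structures of two Lie algebroids agree on two sections if they agree on local generators. -/
theorem LieAlgebroid.bracket_eq_of_generators {L L' : LieAlgebroid m R S}
    (hanchor : ∀ x a, L.anchor x a = L'.anchor x a) {c a : Sec m R S} {U : Opens M} {x : M}
    (hx : x ∈ U) {ι κ : Type*} [Fintype ι] [Fintype κ] {f : ι → M → ℝ} {t : ι → Sec m R S}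
    {g : κ → M → ℝ} {u : κ → Sec m R S} (hf : ∀ i, SmoothFun m U (f i))
    (hg : ∀ i, SmoothFun m U (g i)) (hc : ∀ y ∈ U, c.1 y = ∑ i, f i y • (t i).1 y)
    (ha : ∀ y ∈ U, a.1 y = ∑ i, g i y • (u i).1 y)
    (h : ∀ i j, (L.bracket (t i) (u j)).1 x = (L'.bracket (t i) (u j)).1 x) :
    (L.bracket c a).1 x = (L'.bracket c a).1 x := by
  have h1 : ∀ i, (L.bracket (t i) a).1 x = (L'.bracket (t i) a).1 x := fun i => by
    rw [L.bracket_expand _ a hx hg ha, L'.bracket_expand _ a hx hg ha]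
    simp only [h, hanchor]
  rw [L.bracket_swap_apply, L'.bracket_swap_apply, L.bracket_expand _ c hx hf hc,
    L'.bracket_expand _ c hx hf hc]
  simp only [L.bracket_swap_apply a, L'.bracket_swap_apply a, h1, hanchor]

theorem lieAlgebroid_ext {L L' : LieAlgebroid m R S}
    (h : ∀ x a, L.anchor x a = L'.anchor x a)
    (h' : ∀ a b x, (L.bracket a b).1 x = (L'.bracket a b).1 x) : L = L' := by
  have h1 : L.anchor = L'.anchor := funext fun x => LinearMap.ext (h x)
  have h2 : L.bracket = L'.bracket :=
    LinearMap.ext fun a => LinearMap.ext fun b => Subtype.ext (funext (h' a b))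
  cases L; cases L'
  simp only at h1 h2
  subst h1 h2
  rfl

/-- A Lie algebroid from a bracket that is given as a function, with pointwise laws. -/
@[reducible] def LieAlgebroid.ofBracket (hS : IsVectorSubbundle m R S)
    (anchor : Π x, S x →ₗ[ℝ] TangentSpace (𝓡 m) x)
    (hsmooth : ∀ (U : Opens M) (s : Π x, S x), SmoothSubSection m R U s →
      SmoothVF U (fun x => anchor x (s x)))
    (br : Sec m R S → Sec m R S → Sec m R S) (hself : ∀ a x, (br a a).1 x = 0)
    (hskew : ∀ a b x, (br a b).1 x = -(br b a).1 x)
    (hadd : ∀ a b c x, (br a (b + c)).1 x = (br a b).1 x + (br a c).1 x)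
    (hjacobi : ∀ a b c x, (br a (br b c)).1 x + (br b (br c a)).1 x + (br c (br a b)).1 x = 0)
    (hanchor : ∀ (a b : Sec m R S) (x : M), anchor x ((br a b).1 x) =
      lieVF (fun y => anchor y (a.1 y)) (fun y => anchor y (b.1 y)) x)
    (hleibniz : ∀ (a b : Sec m R S) (f : M → ℝ) (hf : SmoothFun m ⊤ f) (x : M),
      (br a (mulSec f hf b)).1 x =
        f x • (br a b).1 x + dirDeriv f x (anchor x (a.1 x)) • b.1 x) : LieAlgebroid m R S :=
  -- Homogeneity over ℝ is the Leibniz rule for constant functions.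
  have hsmul : ∀ (c : ℝ) (a b : Sec m R S) (x : M), (br a (c • b)).1 x = c • (br a b).1 x :=
    fun c a b x => by
      have hx := hleibniz a b (fun _ => c) contMDiffOn_const x
      rw [dirDeriv_const, zero_smul, add_zero] at hx
      exact hx
  { isVectorSubbundle := hS
    anchor := anchor
    anchor_smooth := hsmooth
    bracket := LinearMap.mk₂ ℝ br
      (fun a b c => Subtype.ext (funext fun x => by
        change (br (a + b) c).1 x = (br a c).1 x + (br b c).1 x
        rw [hskew, hadd, hskew a, hskew b, neg_add]))
      (fun r a b => Subtype.ext (funext fun x => by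
        change (br (r • a) b).1 x = r • (br a b).1 x
        rw [hskew, hsmul, hskew a, smul_neg]))
      (fun a b c => Subtype.ext (funext (hadd a b c)))
      (fun r a b => Subtype.ext (funext (hsmul r a b)))
    bracket_self := fun a => Subtype.ext (funext (hself a))
    jacobi := fun a b c => Subtype.ext (funext (hjacobi a b c))
    anchor_bracket := hanchor
    leibniz := hleibniz }

/-- A family of local sections extends to global sections, keeping the germs at a point. -/
theorem exists_sec_family_eq {U : Opens M} {x : M} (hx : x ∈ U) {ι : Type*}
    {s : ι → Π x, S x} (hs : ∀ i, SmoothSubSection m R U (s i)) :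
    ∃ (a : ι → Sec m R S) (V : Opens M), x ∈ V ∧ V ≤ U ∧ ∀ i, ∀ y ∈ V, (a i).1 y = s i y := by
  -- One cutoff serves the whole family, so V is common and the index type need not be finite.
  obtain ⟨χ, hχ, hχ1, hsupp⟩ := exists_bump (m := m) x U hx
  obtain ⟨V, hV, hVo, hxV⟩ := eventually_nhds_iff.1 hχ1
  refine ⟨fun i => ⟨fun y => χ y • s i y, SmoothSection.smul_bump hχ hsupp (hs i)⟩,
    ⟨V, hVo⟩ ⊓ U, ⟨hxV, hx⟩, inf_le_right, fun i y hy => ?_⟩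
  change χ y • s i y = s i y
  rw [hV y hy.1, one_smul]

end LieAlgebroidLocality

/-! ### Frames of subbundles and inverses of bundle isomorphisms -/

section Subbundles

variable {m : ℕ} {M : Type*} [TopologicalSpace M] [ChartedSpace (Coord m) M]
  {R : Type*} {W : M → Type*}
  [NormedAddCommGroup R] [NormedSpace ℝ R]
  [∀ x, AddCommGroup (W x)] [∀ x, Module ℝ (W x)] [∀ x, TopologicalSpace (W x)]
  [TopologicalSpace (TotalSpace R W)] [FiberBundle R W]
  {S : Π x, Submodule ℝ (W x)}

theorem isVectorSubbundle_of_fintype (h : ∀ x₀ : M, ∃ U : Opens M, x₀ ∈ U ∧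
    ∃ (ι : Type) (_ : Fintype ι) (b : ι → Π x, W x), (∀ i, SmoothSection m R U (b i)) ∧
    ∀ x ∈ U, LinearIndependent ℝ (fun i => b i x) ∧
      Submodule.span ℝ (Set.range fun i => b i x) = S x) : IsVectorSubbundle m R S := by
  intro x₀
  obtain ⟨U, hx, ι, _, b, hb, hS⟩ := h x₀
  let φ := (Fintype.equivFin ι).symm
  refine ⟨U, hx, Fintype.card ι, fun i => b (φ i), fun i => hb _, fun x hx => ⟨?_, ?_⟩⟩
  · exact (hS x hx).1.comp φ φ.injective
  · rw [← (hS x hx).2]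
    congr 1
    exact φ.surjective.range_comp fun i => b i x

/-- Local frames of a subbundle, as sections of the subbundle. -/
theorem IsVectorSubbundle.exists_frame (hS : IsVectorSubbundle m R S) (x₀ : M) :
    ∃ (U : Opens M) (r : ℕ) (b : Fin r → Π x, S x), x₀ ∈ U ∧
      (∀ i, SmoothSubSection m R U (b i)) ∧
      (∀ x ∈ U, LinearIndependent ℝ (fun i => (b i x : W x))) ∧
      ∀ x ∈ U, ∀ s : S x, ∃ f : Fin r → ℝ, s = ∑ i, f i • b i x := by
  classical
  obtain ⟨U, hx, r, b, hb, hbS⟩ := hS x₀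
  have hmem : ∀ x ∈ U, ∀ i, b i x ∈ S x := fun x hx i => by
    rw [← (hbS x hx).2]; exact Submodule.subset_span ⟨i, rfl⟩
  -- The value 0 can occur only outside U, where the frame is irrelevant.
  let b' : Fin r → Π x, S x := fun i x => if h : b i x ∈ S x then ⟨b i x, h⟩ else 0
  have hb' : ∀ x ∈ U, ∀ i, (b' i x : W x) = b i x := fun x hx i => by
    simp only [b', dif_pos (hmem x hx i)]
  refine ⟨U, r, b', hx, fun i => (hb i).congr fun y hy => hb' y hy i, fun x hx => ?_,
    fun x hx s => ?_⟩
  · simp only [hb' x hx]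
    exact (hbS x hx).1
  · have hs : (s : W x) ∈ Submodule.span ℝ (Set.range fun i => b i x) := by
      rw [(hbS x hx).2]; exact s.2
    obtain ⟨f, hf⟩ := (Submodule.mem_span_range_iff_exists_fun ℝ).1 hs
    refine ⟨f, Subtype.ext ?_⟩
    rw [← hf]
    simp [hb' x hx]

variable [VectorBundle ℝ R W]

/-- The inverse of a smooth isomorphism of vector bundles is smooth. -/
theorem smooth_symm_of_smooth (hS : IsVectorSubbundle m R S)
    {R' : Type*} {W' : M → Type*} [NormedAddCommGroup R'] [NormedSpace ℝ R']
    [FiniteDimensional ℝ R']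
    [∀ x, AddCommGroup (W' x)] [∀ x, Module ℝ (W' x)] [∀ x, TopologicalSpace (W' x)]
    [TopologicalSpace (TotalSpace R' W')] [FiberBundle R' W'] [VectorBundle ℝ R' W']
    [ContMDiffVectorBundle ∞ R' W' (𝓡 m)]
    {S' : Π x, Submodule ℝ (W' x)} (η : Π x, S x ≃ₗ[ℝ] S' x)
    (hη : ∀ (U : Opens M) (s : Π x, S x), SmoothSubSection m R U s →
      SmoothSubSection m R' U (fun x => η x (s x)))
    (U : Opens M) (s : Π x, S' x) (hs : SmoothSubSection m R' U s) :
    SmoothSubSection m R U (fun x => (η x).symm (s x)) := by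
  refine smoothSection_iff.2 fun x hx => ?_
  obtain ⟨V, r, b, hxV, hb, hli, hspan⟩ := hS.exists_frame x
  have hV : ∀ᶠ y in nhds x, y ∈ V := V.isOpen.mem_nhds hxV
  -- The coefficients of the preimage in the frame b are those of s in the image of that frame,
  -- which is smooth and pointwise independent; hence they are smooth.
  choose! f hf using fun y (hy : y ∈ V) => hspan y hy ((η y).symm (s y))
  have hfs : ∀ i, SmoothFunAt m (fun y => f y i) x := by
    refine smoothFunAt_coeff (b := fun i y => (η y (b i y) : W' y)) (s := fun y => (s y : W' y))
      (fun i => SmoothSection.at (hη V (b i) (hb i)) hxV) ?_ (SmoothSection.at hs hx)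
      (hV.mono fun y hy => ?_)
    · have h1 : LinearIndependent ℝ (fun i => b i x) :=
        LinearIndependent.of_comp (S x).subtype (hli x hxV)
      exact (h1.map' (η x).toLinearMap (LinearEquiv.ker _)).map' (S' x).subtype
        (Submodule.ker_subtype _)
    · have := congrArg (fun t => ((η y) t : W' y)) (hf y hy)
      simpa using this
  refine SmoothSecAt.congr (s := fun y => ∑ i, f y i • (b i y : W y))
    (SmoothSecAt.sum fun i _ => SmoothSecAt.smul (hfs i) (SmoothSection.at (hb i) hxV))
    (hV.mono fun y hy => ?_)
  have := congrArg (fun t : S y => (t : W y)) (hf y hy)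
  simpa using this

end Subbundles

/-! ### Sections and components of F ⊕ E -/

section SumBundle

variable {m k : ℕ} {M : Type*} [TopologicalSpace M] [ChartedSpace (Coord m) M]
  [IsManifold (𝓡 m) ∞ M] {𝓕 : Foliation m k M} {R : Type*} {E : M → Type*}
  [NormedAddCommGroup R] [NormedSpace ℝ R]
  [∀ x, AddCommGroup (E x)] [∀ x, Module ℝ (E x)] [∀ x, TopologicalSpace (E x)]
  [TopologicalSpace (TotalSpace R E)] [FiberBundle R E]

theorem smoothSecAt_prod_iff {Y : Π x : M, TangentSpace (𝓡 m) x} {e : Π x, E x} {x : M} :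
    SmoothSecAt m (Coord m × R) (W := (TangentSpace (𝓡 m) : M → Type) ×ᵇ E)
      (fun y => (Y y, e y)) x ↔ SmoothVFAt Y x ∧ SmoothSecAt m R e x := by
  have h1 := Bundle.contMDiffAt_section (IB := 𝓡 m) (n := ∞) (F := Coord m × R)
    (E := (TangentSpace (𝓡 m) : M → Type) ×ᵇ E) (s := fun y => (Y y, e y)) x
  have h2 := Bundle.contMDiffAt_section (IB := 𝓡 m) (n := ∞) (F := Coord m)
    (E := (TangentSpace (𝓡 m) : M → Type)) (s := Y) x
  have h3 := Bundle.contMDiffAt_section (IB := 𝓡 m) (n := ∞) (F := R) (s := e) x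
  refine h1.trans (Iff.trans ?_ (h2.and h3).symm)
  exact contMDiffAt_prod_module_iff _

theorem smoothSection_prod_iff {Y : Π x : M, TangentSpace (𝓡 m) x} {e : Π x, E x} {U : Opens M} :
    SmoothSection m (Coord m × R) (W := (TangentSpace (𝓡 m) : M → Type) ×ᵇ E) U
      (fun y => (Y y, e y)) ↔ SmoothVF U Y ∧ SmoothSection m R U e := by
  simp only [SmoothVF, smoothSection_iff, smoothSecAt_prod_iff]
  exact ⟨fun h => ⟨fun x hx => (h x hx).1, fun x hx => (h x hx).2⟩,
    fun h x hx => ⟨h.1 x hx, h.2 x hx⟩⟩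

theorem smoothSubSection_iff {s : Π x, sumBundle 𝓕 E x} {U : Opens M} :
    SmoothSubSection m (Coord m × R) U s ↔ SmoothVF U (fun x => leafPart x (s x)) ∧
      SmoothSection m R U (fun x => transPart x (s x)) :=
  smoothSection_prod_iff (Y := fun x => leafPart x (s x)) (e := fun x => transPart x (s x))

/-- The vector of `F ⊕ E` with given components. -/
def sumMk {x : M} (v : TangentSpace (𝓡 m) x) (hv : v ∈ 𝓕.tangent x) (e : E x) :
    sumBundle 𝓕 E x := ⟨(v, e), ⟨hv, trivial⟩⟩

@[simp] theorem leafPart_sumMk {x : M} (v : TangentSpace (𝓡 m) x) (hv : v ∈ 𝓕.tangent x)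
    (e : E x) : leafPart x (sumMk v hv e) = v := rfl

@[simp] theorem transPart_sumMk {x : M} (v : TangentSpace (𝓡 m) x) (hv : v ∈ 𝓕.tangent x)
    (e : E x) : transPart x (sumMk v hv e) = e := rfl

theorem leafPart_mem {x : M} (a : sumBundle 𝓕 E x) : leafPart x a ∈ 𝓕.tangent x := a.2.1

theorem sumBundle_ext {x : M} {a b : sumBundle 𝓕 E x} (h : leafPart x a = leafPart x b)
    (h' : transPart x a = transPart x b) : a = b := Subtype.ext (Prod.ext h h')

theorem mem_leafBundle_iff {x : M} (a : sumBundle 𝓕 E x) :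
    (a : ((TangentSpace (𝓡 m) : M → Type) ×ᵇ E) x) ∈ leafBundle 𝓕 E x ↔ transPart x a = 0 :=
  ⟨fun h => h.2, fun h => ⟨a.2.1, h⟩⟩

theorem leafBundle_le (x : M) : leafBundle 𝓕 E x ≤ sumBundle 𝓕 E x := fun _ h => ⟨h.1, trivial⟩

/-- Local frames of `F`. -/
theorem exists_leaf_frame (𝓕 : Foliation m k M) (x₀ : M) :
    ∃ (U : Opens M) (ι : Type) (_ : Fintype ι) (D : ι → Π x : M, TangentSpace (𝓡 m) x),
      x₀ ∈ U ∧ (∀ i, SmoothVF U (D i)) ∧ (∀ i, ∀ y ∈ U, D i y ∈ 𝓕.tangent y) ∧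
      (∀ y ∈ U, LinearIndependent ℝ (fun i => D i y)) ∧
      ∀ y ∈ U, ∀ v ∈ 𝓕.tangent y, ∃ f : ι → ℝ, v = ∑ i, f i • D i y := by
  obtain ⟨U, h, D, hx, hA⟩ := exists_adapted 𝓕 x₀
  refine ⟨U, {i : Fin m // ¬ (i : ℕ) < k}, inferInstance, fun i => D i, hx,
    fun i => hA.smooth_vf i, fun i y hy => hA.mem_tangent i.2 hy, fun y hy => ?_, fun y hy v hv => ?_⟩
  · refine Fintype.linearIndependent_iff.2 fun g hg i => ?_
    have h1 := congrArg (fun v => dirDeriv (h i) y v) hg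
    simp only [dirDeriv_sum_vec, dirDeriv_smul_vec, hA.dual y hy, dirDeriv_zero_vec] at h1
    rw [Finset.sum_eq_single i] at h1
    · simpa using h1
    · intro j _ hj
      rw [if_neg (fun hij => hj (Subtype.ext hij.symm)), mul_zero]
    · simp
  · refine ⟨fun i => dirDeriv (h i) y v, ?_⟩
    conv_lhs => rw [hA.expand y hy v]
    have e1 := Finset.sum_subtype (F := inferInstance) (Finset.univ.filter fun i : Fin m => ¬ (i : ℕ) < k)
      (p := fun i : Fin m => ¬ (i : ℕ) < k) (by simp) (fun i : Fin m => dirDeriv (h i) y v • D i y)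
    refine Eq.trans (Eq.symm (Finset.sum_subset (Finset.subset_univ _) fun i _ hi => ?_)) e1
    have hik : (i : ℕ) < k := by simpa using hi
    rw [(hA.mem_iff y hy v).1 hv i hik, zero_smul]

end SumBundle

/-! ### Local generators of F ⊕ E and uniqueness of the bracket -/

section CanonicalExtension

variable {m k : ℕ} {M : Type*} [TopologicalSpace M] [ChartedSpace (Coord m) M]
  [IsManifold (𝓡 m) ∞ M] {𝓕 : Foliation m k M} {R : Type*} {E : M → Type*}
  [NormedAddCommGroup R] [NormedSpace ℝ R]
  [∀ x, AddCommGroup (E x)] [∀ x, Module ℝ (E x)] [∀ x, TopologicalSpace (E x)]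
  [TopologicalSpace (TotalSpace R E)] [FiberBundle R E] [VectorBundle ℝ R E]
  {Φ : FoliatedStructure 𝓕 R E}

theorem isVectorSubbundle_leafBundle :
    IsVectorSubbundle m (Coord m × R) (leafBundle 𝓕 E) := by
  refine isVectorSubbundle_of_fintype fun x₀ => ?_
  obtain ⟨U, ι, _, D, hx, hD, hDF, hli, hspan⟩ := exists_leaf_frame 𝓕 x₀
  refine ⟨U, hx, ι, inferInstance, fun i y => (D i y, 0), fun i => ?_, fun y hy => ⟨?_, ?_⟩⟩
  · exact smoothSection_prod_iff.2 ⟨hD i, smoothSection_iff.2 fun y _ => smoothSecAt_zero y⟩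
  · exact (hli y hy).map' (LinearMap.inl ℝ (TangentSpace (𝓡 m) y) (E y))
      (LinearMap.ker_eq_bot.2 LinearMap.inl_injective)
  · refine le_antisymm (Submodule.span_le.2 ?_) ?_
    · rintro _ ⟨i, rfl⟩
      exact ⟨hDF i y hy, rfl⟩
    · rintro ⟨v, e⟩ ⟨hv, he⟩
      obtain ⟨f, hf⟩ := hspan y hy v hv
      have he : e = 0 := he
      refine (Submodule.mem_span_range_iff_exists_fun ℝ).2 ⟨f, ?_⟩
      refine Prod.ext ?_ ?_
      · rw [Prod.fst_sum]; exact hf.symm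
      · rw [Prod.snd_sum]; simp [he]

theorem isVectorSubbundle_sumBundle (Φ : FoliatedStructure 𝓕 R E) :
    IsVectorSubbundle m (Coord m × R) (sumBundle 𝓕 E) := by
  refine isVectorSubbundle_of_fintype fun x₀ => ?_
  obtain ⟨U, ι, _, D, hx, hD, hDF, hli, hspan⟩ := exists_leaf_frame 𝓕 x₀
  obtain ⟨U', r, b, hx', hb⟩ := exists_folFrame Φ x₀
  let s : ι ⊕ Fin r → Π y, ((TangentSpace (𝓡 m) : M → Type) ×ᵇ E) y :=
    Sum.elim (fun i y => (D i y, 0)) (fun j y => (0, b j y))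
  refine ⟨U ⊓ U', ⟨hx, hx'⟩, ι ⊕ Fin r, inferInstance, s, ?_, fun y hy => ⟨?_, ?_⟩⟩
  · rintro (i | j)
    · exact smoothSection_prod_iff.2 ⟨SmoothSection.mono (hD i) inf_le_left,
        smoothSection_iff.2 fun y _ => smoothSecAt_zero y⟩
    · exact smoothSection_prod_iff.2 ⟨smoothSection_iff.2 fun y _ => smoothSecAt_zero y,
        (hb.smooth j).mono inf_le_right⟩
  · have := linearIndependent_inl_union_inr' (hli y hy.1) (hb.linearIndependent y hy.2)
    rw [show (Sum.elim _ _ : ι ⊕ Fin r → _) = fun p => s p y from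
      funext fun p => by rcases p with i | j <;> rfl] at this
    exact this
  · refine le_antisymm (Submodule.span_le.2 ?_) ?_
    · rintro _ ⟨i | j, rfl⟩
      · exact ⟨hDF i y hy.1, trivial⟩
      · exact ⟨Submodule.zero_mem _, trivial⟩
    · rintro ⟨v, e⟩ ⟨hv, -⟩
      obtain ⟨f, hf⟩ := hspan y hy.1 v hv
      refine (Submodule.mem_span_range_iff_exists_fun ℝ).2
        ⟨Sum.elim f fun j => frameCoeff b j y e, ?_⟩
      rw [Fintype.sum_sum_type]
      refine Prod.ext ?_ ?_
      · rw [Prod.fst_add, Prod.fst_sum, Prod.fst_sum]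
        simpa [s] using hf.symm
      · rw [Prod.snd_add, Prod.snd_sum, Prod.snd_sum]
        simpa [s] using (hb.sum_coeff hy.2 e).symm

/-- The `E`-component of a section of `F ⊕ E`. -/
abbrev transSec (a : Sec m (Coord m × R) (sumBundle 𝓕 E)) : Π x, E x :=
  fun x => transPart x (a.1 x)

theorem smooth_transSec (a : Sec m (Coord m × R) (sumBundle 𝓕 E)) :
    SmoothSection m R ⊤ (transSec a) := (smoothSubSection_iff.1 a.2).2

/-- The `F`-component of a section of `F ⊕ E`, as a section of `F ⊕ E`. -/
def leafSec (a : Sec m (Coord m × R) (sumBundle 𝓕 E)) : Sec m (Coord m × R) (sumBundle 𝓕 E) :=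
  ⟨fun x => sumMk (leafPart x (a.1 x)) (leafPart_mem _) 0, smoothSubSection_iff.2
    ⟨(smoothSubSection_iff.1 a.2).1, smoothSection_iff.2 fun y _ => smoothSecAt_zero y⟩⟩

variable (𝓕 E) in
/-- A section of `E` as a section of `F ⊕ E`. -/
def transMk (e : Π x, E x) : Π x, sumBundle 𝓕 E x := fun x => sumMk 0 (Submodule.zero_mem _) (e x)

theorem smooth_transMk {e : Π x, E x} {U : Opens M} (he : SmoothSection m R U e) :
    SmoothSubSection m (Coord m × R) U (transMk 𝓕 E e) :=
  smoothSubSection_iff.2 ⟨smoothSection_iff.2 fun y _ => smoothSecAt_zero y, he⟩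

section Decomposition

variable [T2Space M]

/-- Through every vector tangent to a leaf there is a global section of `F ⊆ F ⊕ E`. -/
theorem exists_leaf_sec {x : M} {v : TangentSpace (𝓡 m) x} (hv : v ∈ 𝓕.tangent x) :
    ∃ a : Sec m (Coord m × R) (sumBundle 𝓕 E), (∀ y, transPart y (a.1 y) = 0) ∧
      leafPart x (a.1 x) = v := by
  classical
  obtain ⟨U, ι, _, D, hx, hD, hDF, hli, hspan⟩ := exists_leaf_frame 𝓕 x
  obtain ⟨f, hf⟩ := hspan x hx v hv
  obtain ⟨χ, hχ, hχ1, hsupp⟩ := exists_bump (m := m) x U hx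
  have hmem : ∀ y, χ y • ∑ i, f i • D i y ∈ 𝓕.tangent y := fun y => by
    by_cases hy : y ∈ tsupport χ
    · exact Submodule.smul_mem _ _ (Submodule.sum_mem _ fun i _ =>
        Submodule.smul_mem _ _ (hDF i y (hsupp hy)))
    · rw [image_eq_zero_of_notMem_tsupport hy, zero_smul]; exact Submodule.zero_mem _
  refine ⟨⟨fun y => sumMk (χ y • ∑ i, f i • D i y) (hmem y) 0, smoothSubSection_iff.2 ⟨?_, ?_⟩⟩,
    fun y => rfl, ?_⟩
  · refine SmoothSection.smul_bump hχ hsupp (smoothSection_iff.2 fun y hy => ?_)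
    exact SmoothSecAt.sum fun i _ => SmoothSecAt.smul contMDiffAt_const (SmoothSection.at (hD i) hy)
  · exact smoothSection_iff.2 fun y _ => smoothSecAt_zero y
  · change χ x • ∑ i, f i • D i x = v
    rw [hχ1.self_of_nhds, one_smul, hf]

variable [FiniteDimensional ℝ R] [ContMDiffVectorBundle ∞ R E (𝓡 m)]

/-- Local decomposition of the sections of `F ⊕ E`: a section of `F` plus a combination of
foliated sections of `E`. -/
theorem exists_decomposition (Φ : FoliatedStructure 𝓕 R E) (x : M) :
    ∃ (U : Opens M) (r : ℕ) (t : Fin r → Sec m (Coord m × R) (sumBundle 𝓕 E)), x ∈ U ∧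
      (∀ j, ∀ y ∈ U, leafPart y ((t j).1 y) = 0) ∧ (∀ j, Φ.IsFol U (transSec (t j))) ∧
      ∀ a : Sec m (Coord m × R) (sumBundle 𝓕 E), ∃ f : Option (Fin r) → M → ℝ,
        (∀ j, SmoothFun m U (f j)) ∧
        ∀ y ∈ U, a.1 y = ∑ j, f j y • (Option.elim j (leafSec a) t).1 y := by
  obtain ⟨U', r, b, hx', hb⟩ := exists_folFrame Φ x
  obtain ⟨t, U, hxU, hU, ht⟩ := exists_sec_family_eq hx' (s := fun j => transMk 𝓕 E (b j))
    (R := Coord m × R) fun j => smooth_transMk (hb.smooth j)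
  have hbU := hb.mono hU
  have ht1 : ∀ j, ∀ y ∈ U, leafPart y ((t j).1 y) = 0 := fun j y hy => by
    rw [ht j y hy]; rfl
  have ht2 : ∀ j, ∀ y ∈ U, transPart y ((t j).1 y) = b j y := fun j y hy => by
    rw [ht j y hy]; rfl
  -- The index `none` carries the whole F-component with coefficient 1; the others carry the frame
  -- coefficients of the E-component.
  refine ⟨U, r, t, hxU, ht1, fun j => ?_, fun a => ⟨fun p => Option.elim p (fun _ => 1)
    fun j y => frameCoeff b j y (transSec a y), ?_, fun y hy => ?_⟩⟩
  · exact Φ.congr _ _ _ (fun y hy => (ht2 j y hy).symm) (hbU.isFol j)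
  · rintro (_ | j)
    · exact contMDiffOn_const
    · exact hbU.smoothFun_coeff le_rfl ((smooth_transSec a).mono le_top) j
  · rw [Fintype.sum_option]
    refine sumBundle_ext ?_ ?_
    · rw [map_add, map_sum, map_smul]
      simp only [map_smul, Option.elim, ht1 _ y hy, smul_zero, Finset.sum_const_zero, add_zero,
        one_smul]
      rfl
    · rw [map_add, map_sum, map_smul]
      have h0 : transPart y ((leafSec a).1 y) = 0 := rfl
      simp only [map_smul, Option.elim, ht2 _ y hy, h0, smul_zero, zero_add]
      exact hb.sum_coeff (hU hy) (transSec a y)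

end Decomposition

theorem isFol_of_eq_zero {U : Opens M} {e : Π x, E x} (he : ∀ x ∈ U, e x = 0) : Φ.IsFol U e :=
  Φ.congr _ _ _ (fun x hx => (he x hx).symm) (isFol_zero U)

variable {T : TransLieAlgebroid Φ} {ρ : Π x : M, E x →ₗ[ℝ] TangentSpace (𝓡 m) x}

set_option maxHeartbeats 1000000 in
/-- The bracket formulas determine the structure. -/
theorem IsTwistedCanonical.unique [T2Space M] [FiniteDimensional ℝ R]
    [ContMDiffVectorBundle ∞ R E (𝓡 m)] {μ : Π x, E x →ₗ[ℝ] E x →ₗ[ℝ] E x}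
    {L L' : LieAlgebroid m (Coord m × R) (sumBundle 𝓕 E)} (h : IsTwistedCanonical T ρ μ L)
    (h' : IsTwistedCanonical T ρ μ L') : L = L' := by
  have hanchor : ∀ x a, L.anchor x a = L'.anchor x a := fun x a => by
    rw [h.anchor_eq, h'.anchor_eq]
  refine lieAlgebroid_ext hanchor fun c a x => ?_
  obtain ⟨U, r, t, hx, ht, htf, hdec⟩ := exists_decomposition Φ x
  obtain ⟨f, hf, haf⟩ := hdec a
  obtain ⟨g, hg, hcg⟩ := hdec c
  -- Every generator is a section of F or a foliated section of E on U, so the four cases are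
  -- exactly the four bracket formulas.
  refine LieAlgebroid.bracket_eq_of_generators hanchor hx hg hf hcg haf fun q p => ?_
  rcases q with _ | j <;> rcases p with _ | i
  · have e1 := h.bracket_leaf_leaf U (leafSec c) (leafSec a) (fun _ _ => rfl) (fun _ _ => rfl) x hx
    have e2 := h'.bracket_leaf_leaf U (leafSec c) (leafSec a) (fun _ _ => rfl) (fun _ _ => rfl) x hx
    exact sumBundle_ext (e1.1.trans e2.1.symm) (e1.2.trans e2.2.symm)
  · have e1 := h.bracket_leaf_trans U (leafSec c) (t i) (fun _ _ => rfl) (ht i) (htf i) x hx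
    have e2 := h'.bracket_leaf_trans U (leafSec c) (t i) (fun _ _ => rfl) (ht i) (htf i) x hx
    exact sumBundle_ext (e1.1.trans e2.1.symm) (e1.2.trans e2.2.symm)
  · have e1 := h.bracket_trans_leaf U (t j) (leafSec a) (ht j) (fun _ _ => rfl) (htf j) x hx
    have e2 := h'.bracket_trans_leaf U (t j) (leafSec a) (ht j) (fun _ _ => rfl) (htf j) x hx
    exact sumBundle_ext (e1.1.trans e2.1.symm) (e1.2.trans e2.2.symm)
  · have e1 := h.bracket_trans_trans U (t j) (t i) (ht j) (ht i) (htf j) (htf i) x hx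
    have e2 := h'.bracket_trans_trans U (t j) (t i) (ht j) (ht i) (htf j) (htf i) x hx
    exact sumBundle_ext (e1.1.trans e2.1.symm) (e1.2.trans e2.2.symm)


end CanonicalExtension

/-! ### The canonical Lie algebroid of a lift -/

section CanonicalStructure

variable {m k : ℕ} {M : Type*} [TopologicalSpace M] [ChartedSpace (Coord m) M]
  [IsManifold (𝓡 m) ∞ M] {𝓕 : Foliation m k M} {R : Type*} {E : M → Type*}
  [NormedAddCommGroup R] [NormedSpace ℝ R]
  [∀ x, AddCommGroup (E x)] [∀ x, Module ℝ (E x)] [∀ x, TopologicalSpace (E x)]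
  [TopologicalSpace (TotalSpace R E)] [FiberBundle R E] [VectorBundle ℝ R E]
  {Φ : FoliatedStructure 𝓕 R E}

variable {T : TransLieAlgebroid Φ} {ρ : Π x : M, E x →ₗ[ℝ] TangentSpace (𝓡 m) x}

variable (ρ) in
/-- The anchor `Id + ρ` of `F ⊕ E`. -/
def canonicalAnchor (x : M) : sumBundle 𝓕 E x →ₗ[ℝ] TangentSpace (𝓡 m) x :=
  leafPart x + (ρ x).comp (transPart x)

theorem canonicalAnchor_apply {x : M} (a : sumBundle 𝓕 E x) :
    canonicalAnchor ρ x a = leafPart x a + ρ x (transPart x a) := rfl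

/-- The pair (anchor, E-component) embeds F ⊕ E in TM ⊕ E, with the fibre product as image. Each
algebroid law is thus checked on two components: for the first it is a law of vector fields, for the
second a law of `transBracket`. -/
theorem eq_of_canonicalAnchor_eq {x : M} {a b : sumBundle 𝓕 E x}
    (h : canonicalAnchor ρ x a = canonicalAnchor ρ x b) (h' : transPart x a = transPart x b) :
    a = b := by
  refine sumBundle_ext ?_ h'
  rw [canonicalAnchor_apply, canonicalAnchor_apply, h'] at h
  exact add_right_cancel h

variable (ρ) in
/-- The image of a section of `F ⊕ E` under the anchor. -/
abbrev anchorVF (a : Sec m (Coord m × R) (sumBundle 𝓕 E)) : Π x : M, TangentSpace (𝓡 m) x :=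
  fun x => canonicalAnchor ρ x (a.1 x)

variable (hρ : IsLift T ρ)
include hρ

theorem IsLift.smooth_canonicalAnchor {U : Opens M} {s : Π x, sumBundle 𝓕 E x}
    (hs : SmoothSubSection m (Coord m × R) U s) :
    SmoothVF U (fun x => canonicalAnchor ρ x (s x)) := by
  obtain ⟨h1, h2⟩ := smoothSubSection_iff.1 hs
  exact smoothSection_iff.2 fun x hx =>
    SmoothSecAt.add (SmoothSection.at h1 hx) (SmoothSection.at (hρ.smooth U _ h2) hx)

theorem IsLift.smooth_anchorVF (a : Sec m (Coord m × R) (sumBundle 𝓕 E)) (U : Opens M) :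
    SmoothVF U (anchorVF ρ a) := SmoothSection.mono (hρ.smooth_canonicalAnchor a.2) le_top

theorem IsLift.toNormal_canonicalAnchor {x : M} (a : sumBundle 𝓕 E x) :
    𝓕.toNormal x (canonicalAnchor ρ x a) = T.anchor x (transPart x a) := by
  rw [canonicalAnchor_apply, map_add, hρ.proj, (toNormal_eq_zero_iff 𝓕).2 (leafPart_mem a), zero_add]

variable [FiniteDimensional ℝ R] [ContMDiffVectorBundle ∞ R E (𝓡 m)]

/-- The bracket of sections of `F ⊕ E`, with anchor `[anchor, anchor]`. -/
def IsLift.bracketSec (a b : Sec m (Coord m × R) (sumBundle 𝓕 E)) :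
    Sec m (Coord m × R) (sumBundle 𝓕 E) :=
  ⟨fun x => sumMk (lieVF (anchorVF ρ a) (anchorVF ρ b) x -
      ρ x (transBracket T x (anchorVF ρ a x) (anchorVF ρ b x) (transSec a) (transSec b)))
    (by
      -- The difference is tangent to the leaves because both of its terms have the same class in
      -- νℱ.
      rw [← toNormal_eq_zero_iff, map_sub, hρ.proj, hρ.anchor_transBracket (U := ⊤)
        (hρ.smooth_anchorVF a _) (hρ.smooth_anchorVF b _) (smooth_transSec a) (smooth_transSec b)
        (fun y _ => hρ.toNormal_canonicalAnchor _) (fun y _ => hρ.toNormal_canonicalAnchor _)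
        (x := x) trivial, sub_self])
    (transBracket T x (anchorVF ρ a x) (anchorVF ρ b x) (transSec a) (transSec b)), by
    have h2 : SmoothSection m R ⊤ (fun x =>
        transBracket T x (anchorVF ρ a x) (anchorVF ρ b x) (transSec a) (transSec b)) :=
      smoothSection_transBracket T (hρ.smooth_anchorVF a _) (hρ.smooth_anchorVF b _)
        (smooth_transSec a) (smooth_transSec b) (fun y _ => hρ.toNormal_canonicalAnchor _)
        (fun y _ => hρ.toNormal_canonicalAnchor _)
    refine smoothSubSection_iff.2 ⟨smoothSection_iff.2 fun x hx => ?_, h2⟩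
    exact SmoothSecAt.sub (SmoothSection.at (SmoothVF.lieVF (hρ.smooth_anchorVF a ⊤)
      (hρ.smooth_anchorVF b ⊤)) hx) (SmoothSection.at (hρ.smooth ⊤ _ h2) hx)⟩

theorem IsLift.anchor_bracketSec (a b : Sec m (Coord m × R) (sumBundle 𝓕 E)) (x : M) :
    canonicalAnchor ρ x ((hρ.bracketSec a b).1 x) = lieVF (anchorVF ρ a) (anchorVF ρ b) x := by
  rw [canonicalAnchor_apply]
  simp [IsLift.bracketSec]

theorem IsLift.trans_bracketSec (a b : Sec m (Coord m × R) (sumBundle 𝓕 E)) (x : M) :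
    transPart x ((hρ.bracketSec a b).1 x) =
      transBracket T x (anchorVF ρ a x) (anchorVF ρ b x) (transSec a) (transSec b) := rfl

theorem IsLift.bracketSec_swap (a b : Sec m (Coord m × R) (sumBundle 𝓕 E)) (x : M) :
    (hρ.bracketSec a b).1 x = -(hρ.bracketSec b a).1 x := by
  refine eq_of_canonicalAnchor_eq (ρ := ρ) ?_ ?_
  · rw [map_neg, hρ.anchor_bracketSec, hρ.anchor_bracketSec, lieVF_swap]
  · rw [map_neg, hρ.trans_bracketSec, hρ.trans_bracketSec, transBracket_swap]

theorem IsLift.bracketSec_add (a b c : Sec m (Coord m × R) (sumBundle 𝓕 E)) (x : M) :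
    (hρ.bracketSec a (b + c)).1 x = (hρ.bracketSec a b).1 x + (hρ.bracketSec a c).1 x := by
  have h1 : anchorVF ρ (b + c) = fun x => anchorVF ρ b x + anchorVF ρ c x :=
    funext fun x => by rw [anchorVF, sec_add_apply, (canonicalAnchor ρ x).map_add]
  have h2 : transSec (b + c) = fun x => transSec b x + transSec c x :=
    funext fun x => by rw [transSec, sec_add_apply, (transPart x).map_add]
  refine eq_of_canonicalAnchor_eq (ρ := ρ) ?_ ?_
  · rw [map_add, hρ.anchor_bracketSec, hρ.anchor_bracketSec, hρ.anchor_bracketSec, h1,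
      lieVF_add_right (SmoothSection.at (hρ.smooth_anchorVF b ⊤) trivial)
      (SmoothSection.at (hρ.smooth_anchorVF c ⊤) trivial)]
  · rw [map_add, hρ.trans_bracketSec, hρ.trans_bracketSec, hρ.trans_bracketSec, h1, h2,
      transBracket_add_right T ((smooth_transSec b).at trivial) ((smooth_transSec c).at trivial)]

theorem IsLift.bracketSec_mulSec (a b : Sec m (Coord m × R) (sumBundle 𝓕 E)) (f : M → ℝ)
    (hf : SmoothFun m ⊤ f) (x : M) : (hρ.bracketSec a (mulSec f hf b)).1 x =
      f x • (hρ.bracketSec a b).1 x + dirDeriv f x (canonicalAnchor ρ x (a.1 x)) • b.1 x := by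
  have h1 : anchorVF ρ (mulSec f hf b) = fun x => f x • anchorVF ρ b x :=
    funext fun x => by rw [anchorVF, mulSec_apply, (canonicalAnchor ρ x).map_smul]
  have h2 : transSec (𝓕 := 𝓕) (E := E) (mulSec f hf b) = fun x => f x • transSec b x :=
    funext fun x => by rw [transSec, mulSec_apply, (transPart x).map_smul]
  have hfx := hf.at (x := x) trivial
  refine eq_of_canonicalAnchor_eq (ρ := ρ) ?_ ?_
  · rw [map_add, map_smul, map_smul, hρ.anchor_bracketSec, hρ.anchor_bracketSec, h1,
      lieVF_smul_right hfx (SmoothSection.at (hρ.smooth_anchorVF b ⊤) trivial), add_comm]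
  · rw [map_add, map_smul, map_smul, hρ.trans_bracketSec, hρ.trans_bracketSec, h1, h2,
      transBracket_smul_right T hfx ((smooth_transSec b).at trivial)]

theorem IsLift.anchorVF_bracketSec (a b : Sec m (Coord m × R) (sumBundle 𝓕 E)) :
    anchorVF ρ (hρ.bracketSec a b) = lieVF (anchorVF ρ a) (anchorVF ρ b) :=
  funext (hρ.anchor_bracketSec a b)

theorem IsLift.transSec_bracketSec (a b : Sec m (Coord m × R) (sumBundle 𝓕 E)) :
    transSec (hρ.bracketSec a b) = fun x =>
      transBracket T x (anchorVF ρ a x) (anchorVF ρ b x) (transSec a) (transSec b) := rfl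

theorem IsLift.bracketSec_jacobi (a b c : Sec m (Coord m × R) (sumBundle 𝓕 E)) (x : M) :
    (hρ.bracketSec a (hρ.bracketSec b c)).1 x + (hρ.bracketSec b (hρ.bracketSec c a)).1 x +
      (hρ.bracketSec c (hρ.bracketSec a b)).1 x = 0 := by
  have hs := fun a : Sec m (Coord m × R) (sumBundle 𝓕 E) => hρ.smooth_anchorVF a ⊤
  refine eq_of_canonicalAnchor_eq (ρ := ρ) ?_ ?_
  · rw [map_add, map_add, map_zero, hρ.anchor_bracketSec, hρ.anchor_bracketSec,
      hρ.anchor_bracketSec, hρ.anchorVF_bracketSec, hρ.anchorVF_bracketSec, hρ.anchorVF_bracketSec,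
      lieVF_jacobi (SmoothSection.at (hs a) trivial) (SmoothSection.at (hs b) trivial)
      (SmoothSection.at (hs c) trivial),
      lieVF_swap (X := lieVF (anchorVF ρ a) (anchorVF ρ b)),
      show lieVF (anchorVF ρ a) (anchorVF ρ c) = fun y => (-1 : ℝ) • lieVF (anchorVF ρ c)
        (anchorVF ρ a) y from funext fun y => by rw [lieVF_swap, neg_one_smul],
      lieVF_smul_right contMDiffAt_const (SmoothSection.at (SmoothVF.lieVF (hs c) (hs a)) trivial),
      dirDeriv_const, zero_smul, zero_add, neg_one_smul]
    abel
  · rw [map_add, map_add, map_zero, hρ.trans_bracketSec, hρ.trans_bracketSec, hρ.trans_bracketSec,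
      hρ.anchorVF_bracketSec, hρ.anchorVF_bracketSec, hρ.anchorVF_bracketSec,
      hρ.transSec_bracketSec, hρ.transSec_bracketSec, hρ.transSec_bracketSec]
    exact hρ.transBracket_jacobi (hs a) (hs b) (hs c) (smooth_transSec a) (smooth_transSec b)
      (smooth_transSec c) (fun y _ => hρ.toNormal_canonicalAnchor _)
      (fun y _ => hρ.toNormal_canonicalAnchor _) (fun y _ => hρ.toNormal_canonicalAnchor _) trivial

/-- The canonical Lie algebroid structure of `F ⊕ E` associated with a lift. -/
def IsLift.canonical : LieAlgebroid m (Coord m × R) (sumBundle 𝓕 E) :=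
  LieAlgebroid.ofBracket (isVectorSubbundle_sumBundle Φ) (canonicalAnchor ρ)
    (fun _ _ hs => hρ.smooth_canonicalAnchor hs) hρ.bracketSec
    (fun a x => eq_of_canonicalAnchor_eq (ρ := ρ)
      (by rw [hρ.anchor_bracketSec, map_zero, lieVF_self])
      (by rw [hρ.trans_bracketSec, map_zero, transBracket_self]))
    hρ.bracketSec_swap hρ.bracketSec_add hρ.bracketSec_jacobi hρ.anchor_bracketSec
    hρ.bracketSec_mulSec

theorem IsLift.trans_canonical_bracket (a b : Sec m (Coord m × R) (sumBundle 𝓕 E)) (x : M) :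
    transPart x ((hρ.canonical.bracket a b).1 x) =
      transBracket T x (anchorVF ρ a x) (anchorVF ρ b x) (transSec a) (transSec b) := rfl

theorem IsLift.transBracket_anchorVF_leaf_left {U : Opens M}
    {a b : Sec m (Coord m × R) (sumBundle 𝓕 E)} (ha : ∀ x ∈ U, transPart x (a.1 x) = 0)
    (hb : Φ.IsFol U (transSec b)) {x : M} (hx : x ∈ U) :
    transBracket T x (anchorVF ρ a x) (anchorVF ρ b x) (transSec a) (transSec b) = 0 := by
  refine transBracket_leaf_left T hx ha hb ?_ (hρ.toNormal_canonicalAnchor _)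
  rw [anchorVF, canonicalAnchor_apply, ha x hx, map_zero, add_zero]
  exact leafPart_mem _

/-- A Lie algebroid structure of `F ⊕ E` with the anchor `Id + ρ` is a twisted canonical one if
the `E`-components of its brackets are. -/
theorem IsLift.isTwistedCanonical_of {μ : Π x, E x →ₗ[ℝ] E x →ₗ[ℝ] E x}
    {L : LieAlgebroid m (Coord m × R) (sumBundle 𝓕 E)}
    (hanchor : ∀ x a, L.anchor x a = canonicalAnchor ρ x a) (hμ : ∀ x u v, ρ x (μ x u v) = 0)
    (hbr : ∀ (a b : Sec m (Coord m × R) (sumBundle 𝓕 E)) (x : M),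
      transPart x ((L.bracket a b).1 x) = transBracket T x (anchorVF ρ a x) (anchorVF ρ b x)
        (transSec a) (transSec b) + μ x (transSec a x) (transSec b x)) :
    IsTwistedCanonical T ρ μ L := by
  -- The anchor of a bracket is the bracket of the anchors, so the E-component of a bracket
  -- determines its F-component.
  have hlp : ∀ (a b : Sec m (Coord m × R) (sumBundle 𝓕 E)) (x : M),
      leafPart x ((L.bracket a b).1 x) = lieVF (anchorVF ρ a) (anchorVF ρ b) x -
        ρ x (transPart x ((L.bracket a b).1 x)) := fun a b x => by
    have h := L.anchor_bracket a b x
    simp only [hanchor] at h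
    rw [canonicalAnchor_apply] at h
    exact eq_sub_of_add_eq h
  have hleaf : ∀ {U : Opens M} {a : Sec m (Coord m × R) (sumBundle 𝓕 E)},
      (∀ x ∈ U, transPart x (a.1 x) = 0) → ∀ x ∈ U, ∀ᶠ y in nhds x,
        anchorVF ρ a y = leafPart y (a.1 y) := fun {U a} ha x hx => by
    filter_upwards [U.isOpen.mem_nhds hx] with y hy
    rw [anchorVF, canonicalAnchor_apply, ha y hy, map_zero, add_zero]
  have htrans : ∀ {U : Opens M} {a : Sec m (Coord m × R) (sumBundle 𝓕 E)},
      (∀ x ∈ U, leafPart x (a.1 x) = 0) → ∀ x ∈ U, ∀ᶠ y in nhds x,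
        anchorVF ρ a y = ρ y (transPart y (a.1 y)) := fun {U a} ha x hx => by
    filter_upwards [U.isOpen.mem_nhds hx] with y hy
    rw [anchorVF, canonicalAnchor_apply, ha y hy, zero_add]
  have hleft : ∀ {U : Opens M} {a b : Sec m (Coord m × R) (sumBundle 𝓕 E)},
      (∀ x ∈ U, transPart x (a.1 x) = 0) → Φ.IsFol U (transSec b) → ∀ x ∈ U,
        transPart x ((L.bracket a b).1 x) = 0 := fun {U a b} ha hb x hx => by
    rw [hbr, hρ.transBracket_anchorVF_leaf_left ha hb hx, transSec, ha x hx, map_zero,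
      LinearMap.zero_apply, add_zero]
  refine ⟨hanchor, fun U a b ha hb x hx => ?_, fun U a b ha hb hbf x hx => ?_,
    fun U a b ha hb haf x hx => ?_, fun U a b ha hb haf hbf x hx => ?_⟩
  · have h0 := hleft ha (isFol_of_eq_zero hb) x hx
    refine ⟨?_, h0⟩
    rw [hlp, h0, map_zero, sub_zero]
    exact lieVF_congr (hleaf ha x hx) (hleaf hb x hx)
  · have h0 := hleft ha hbf x hx
    refine ⟨?_, h0⟩
    rw [hlp, h0, map_zero, sub_zero]
    exact lieVF_congr (hleaf ha x hx) (htrans hb x hx)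
  · have h0 : transPart x ((L.bracket a b).1 x) = 0 := by
      rw [L.bracket_swap_apply, map_neg, hleft hb haf x hx, neg_zero]
    refine ⟨?_, h0⟩
    rw [hlp, h0, map_zero, sub_zero]
    exact lieVF_congr (htrans ha x hx) (hleaf hb x hx)
  · have h0 := hbr a b x
    rw [transBracket_of_isFol T hx haf hbf (hρ.toNormal_canonicalAnchor _)
      (hρ.toNormal_canonicalAnchor _)] at h0
    refine ⟨?_, h0⟩
    -- Without ρμ = 0 the F-component would contain the extra term −ρμ(e₁, e₂).
    rw [hlp, h0, map_add, hμ, add_zero, lieVF_congr (htrans ha x hx) (htrans hb x hx)]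

theorem IsLift.isTwistedCanonical_canonical :
    IsTwistedCanonical T ρ (fun _ => 0) hρ.canonical :=
  hρ.isTwistedCanonical_of (fun _ _ => rfl) (fun _ _ _ => map_zero _) fun a b x => by
    rw [hρ.trans_canonical_bracket, LinearMap.zero_apply, LinearMap.zero_apply, add_zero]

variable [T2Space M]

/-- The E-component of the bracket with a section of F is the derivative along it of the frame
coefficients. Every leaf vector is the value of a global section of F, so these brackets stay in F
precisely when the coefficients are foliated functions. -/
theorem IsLift.isFol_iff_isBFol (U : Opens M) (a : Sec m (Coord m × R) (sumBundle 𝓕 E)) :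
    Φ.IsFol U (transSec a) ↔ hρ.canonical.IsBFol (leafBundle 𝓕 E) U a := by
  constructor
  · intro ha V hV b hb x hx
    rw [mem_leafBundle_iff]
    exact hρ.transBracket_anchorVF_leaf_left (fun y hy => (mem_leafBundle_iff _).1 (hb y hy))
      (Φ.restrict _ _ _ hV ha) hx
  · intro ha
    refine Φ.glue U _ fun x hx => ?_
    obtain ⟨U', r, b, hx', hb⟩ := exists_folFrame Φ x
    let V := U ⊓ U'
    have hbV := hb.mono (V := V) inf_le_right
    have hf := hbV.smoothFun_coeff le_rfl ((smooth_transSec a).mono le_top)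
    refine ⟨V, ⟨hx, hx'⟩, inf_le_left, (hbV.fol_iff V le_rfl _).2
      ⟨fun i y => frameCoeff b i y (transSec a y), fun i => ⟨hf i, fun y hy v hv => ?_⟩,
      fun y hy => hbV.sum_coeff hy _⟩⟩
    obtain ⟨s, hs, hsv⟩ := exists_leaf_sec (R := R) (E := E) hv
    have h1 := (mem_leafBundle_iff _).1
      (ha V inf_le_left s (fun y _ => (mem_leafBundle_iff _).2 (hs y)) y hy)
    have hsy : anchorVF ρ s y = v := by
      rw [anchorVF, canonicalAnchor_apply, hs, map_zero, add_zero, hsv]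
    rw [hρ.trans_canonical_bracket, hsy, transBracket_eq T (ι := Empty) (κ := Fin r)
      (f := fun i => i.elim) (c := fun i => i.elim)
      (g := fun i y => frameCoeff b i y (transSec a y)) (d := b) hy (fun i => i.elim) hbV.isFol
      (fun i => i.elim) (fun i => (hf i).at hy)
      (Filter.Eventually.of_forall fun z => by simpa using hs z)
      (Filter.mem_of_superset (V.isOpen.mem_nhds hy) fun z hz => hbV.sum_coeff hz _)
      (by rw [transSec, hs y, map_zero, toNormal_eq_zero_iff]; exact hv)
      (hρ.toNormal_canonicalAnchor _)] at h1
    simp only [bracketExpr, Finset.univ_eq_empty, Finset.sum_empty, sub_zero, add_zero] at h1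
    exact Fintype.linearIndependent_iff.1 (hbV.linearIndependent y hy) _ h1 i

theorem IsLift.isMinimalExtension_canonical :
    IsMinimalExtension T hρ.canonical (leafBundle 𝓕 E) transPart where
  foliated :=
    { le := leafBundle_le
      isVectorSubbundle := isVectorSubbundle_leafBundle
      bracket_mem := fun b₁ b₂ h₁ h₂ x => by
        rw [mem_leafBundle_iff]
        exact hρ.transBracket_anchorVF_leaf_left (U := ⊤) (fun y _ => (mem_leafBundle_iff _).1 (h₁ y))
          (isFol_of_eq_zero fun y _ => (mem_leafBundle_iff _).1 (h₂ y)) trivial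
      map_anchor := fun x v => by
        constructor
        · intro hv
          refine ⟨sumMk v hv 0, (mem_leafBundle_iff _).2 rfl, ?_⟩
          change canonicalAnchor ρ x _ = v
          simp [canonicalAnchor_apply]
        · rintro ⟨b, hb, rfl⟩
          change canonicalAnchor ρ x b ∈ _
          rw [canonicalAnchor_apply, (mem_leafBundle_iff _).1 hb, map_zero, add_zero]
          exact leafPart_mem b
      generation := fun a x₀ => by
        obtain ⟨U, r, t, hx, ht, htf, hdec⟩ := exists_decomposition Φ x₀
        obtain ⟨f, hf, haf⟩ := hdec a
        have hfol : ∀ j, hρ.canonical.IsBFol (leafBundle 𝓕 E) U (Option.elim j (leafSec a) t) := by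
          rintro (_ | j)
          · exact (hρ.isFol_iff_isBFol U _).1 (isFol_zero U)
          · exact (hρ.isFol_iff_isBFol U _).1 (htf j)
        let e := finSuccEquiv r
        refine ⟨U, hx, r + 1, fun i => Option.elim (e i) (leafSec a) t, fun i => f (e i),
          fun i => hfol (e i), fun i => hf _, fun y hy => ?_⟩
        · rw [haf y hy]
          exact (Equiv.sum_comp e fun j => f j y • (Option.elim j (leafSec a) t).1 y).symm
      anchor_injective := fun x b hb h => by
        have h0 := (mem_leafBundle_iff _).1 hb
        have h : canonicalAnchor ρ x b = 0 := h
        exact eq_of_canonicalAnchor_eq (ρ := ρ) (by rw [h, map_zero]) (by rw [h0, map_zero]) }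
  smooth U s hs := (smoothSubSection_iff.1 hs).2
  surjective x e := ⟨sumMk 0 (Submodule.zero_mem _) e, rfl⟩
  ker x a := (mem_leafBundle_iff a).symm
  isFol_iff := hρ.isFol_iff_isBFol
  anchor_comm x a := hρ.toNormal_canonicalAnchor a

theorem IsLift.preservesBrackets_canonical :
    PreservesBrackets T hρ.canonical (leafBundle 𝓕 E) transPart := by
  intro U a b ha hb x hx
  rw [hρ.trans_canonical_bracket]
  exact transBracket_of_isFol T hx ((hρ.isFol_iff_isBFol U a).2 ha)
    ((hρ.isFol_iff_isBFol U b).2 hb) (hρ.toNormal_canonicalAnchor _) (hρ.toNormal_canonicalAnchor _)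

end CanonicalStructure

/-! ### Operators that are linear over functions at a point -/

section Tensorial

variable {m : ℕ} {M : Type*} [TopologicalSpace M] [T2Space M] [ChartedSpace (Coord m) M]
  {R : Type*} {W : M → Type*}
  [NormedAddCommGroup R] [NormedSpace ℝ R] [FiniteDimensional ℝ R]
  [∀ x, AddCommGroup (W x)] [∀ x, Module ℝ (W x)] [∀ x, TopologicalSpace (W x)]
  [TopologicalSpace (TotalSpace R W)] [FiberBundle R W] [VectorBundle ℝ R W]
  [IsManifold (𝓡 m) ∞ M] [ContMDiffVectorBundle ∞ R W (𝓡 m)]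
  {S : Π x, Submodule ℝ (W x)}

/-- Through every vector of a subbundle `B ⊆ S` there is a global section of `B`. -/
theorem IsVectorSubbundle.exists_sec {B : Π x, Submodule ℝ (W x)} (hB : IsVectorSubbundle m R B)
    (hle : ∀ x, B x ≤ S x) {x : M} (s : S x) (hs : (s : W x) ∈ B x) :
    ∃ a : Sec m R S, (∀ y, (a.1 y : W y) ∈ B y) ∧ a.1 x = s := by
  obtain ⟨U, r, b, hx, hb, -, hspan⟩ := hB.exists_frame x
  obtain ⟨f, hf⟩ := hspan x hx ⟨s, hs⟩
  obtain ⟨χ, hχ, hχ1, hsupp⟩ := exists_bump (m := m) x U hx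
  let t : Π y, B y := fun y => ∑ i, f i • b i y
  have ht : SmoothSection m R U (fun y => (t y : W y)) := by
    refine SmoothSection.congr (s := fun y => ∑ i, f i • (b i y : W y))
      (smoothSection_iff.2 fun y hy => SmoothSecAt.sum fun i _ =>
        SmoothSecAt.smul contMDiffAt_const (SmoothSection.at (hb i) hy)) fun y _ => ?_
    simp [t]
  refine ⟨⟨fun y => ⟨χ y • (t y : W y), hle y (Submodule.smul_mem _ _ (t y).2)⟩,
    SmoothSection.smul_bump hχ hsupp ht⟩, fun y => Submodule.smul_mem _ _ (t y).2, Subtype.ext ?_⟩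
  change χ x • (t x : W x) = s
  rw [hχ1.self_of_nhds, one_smul, show t x = ⟨s, hs⟩ from hf.symm]

variable {V : Type*} [AddCommGroup V] [Module ℝ V]

/-- A cutoff χ equal to 1 near x turns the local expansion into the global identity χb = ∑ (χf_i)
c_i, and D sees only χ(x) = 1. -/
theorem tensorial_expand {x : M} {D : Sec m R S →+ V}
    (hD : ∀ (f : M → ℝ) (hf : SmoothFun m ⊤ f) (b : Sec m R S), D (mulSec f hf b) = f x • D b)
    {U : Opens M} (hx : x ∈ U) {ι : Type*} [Fintype ι] {f : ι → M → ℝ} {c : ι → Sec m R S}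
    (hf : ∀ i, SmoothFun m U (f i)) {b : Sec m R S}
    (h : ∀ y ∈ U, b.1 y = ∑ i, f i y • (c i).1 y) : D b = ∑ i, f i x • D (c i) := by
  obtain ⟨χ, hχ, hχ1, hsupp⟩ := exists_bump (m := m) x U hx
  have hF : ∀ i, SmoothFun m ⊤ (fun y => χ y * f i y) := fun i => hχ.mul_bump hsupp (hf i)
  have hb : mulSec χ hχ b = ∑ i, mulSec _ (hF i) (c i) := by
    refine Subtype.ext (funext fun y => ?_)
    rw [sec_sum_apply]
    simp only [mulSec_apply, mul_smul]
    rw [← Finset.smul_sum]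
    by_cases hy : y ∈ tsupport χ
    · rw [h y (hsupp hy)]
    · rw [image_eq_zero_of_notMem_tsupport hy, zero_smul, zero_smul]
  have h1 := congrArg D hb
  rw [map_sum, hD, hχ1.self_of_nhds, one_smul] at h1
  rw [h1]
  refine Finset.sum_congr rfl fun i _ => ?_
  rw [hD, hχ1.self_of_nhds, one_mul]

/-- A section that vanishes at x has frame coefficients that vanish at x, so its expansion is killed
by D. -/
theorem tensorial_congr (hS : IsVectorSubbundle m R S) {x : M} {D : Sec m R S →+ V}
    (hD : ∀ (f : M → ℝ) (hf : SmoothFun m ⊤ f) (b : Sec m R S), D (mulSec f hf b) = f x • D b)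
    {b b' : Sec m R S} (h : b.1 x = b'.1 x) : D b = D b' := by
  suffices H : ∀ b : Sec m R S, b.1 x = 0 → D b = 0 by
    have := H (b - b') (sub_eq_zero.2 h)
    rwa [map_sub, sub_eq_zero] at this
  intro b hb0
  obtain ⟨U, r, t, hx, ht, hli, hspan⟩ := hS.exists_frame x
  choose! f hf using fun y (hy : y ∈ U) => hspan y hy (b.1 y)
  have hfs : ∀ i, SmoothFun m U (fun y => f y i) := fun i => smoothFun_iff.2 fun y hy => by
    refine smoothFunAt_coeff (b := fun i y => (t i y : W y)) (f := fun i y => f y i) (s := fun y => (b.1 y : W y))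
      (fun i => SmoothSection.at (ht i) hy) (hli y hy) (SmoothSection.at b.2 trivial) ?_ i
    filter_upwards [U.isOpen.mem_nhds hy] with z hz
    have := congrArg (fun t : S z => (t : W z)) (hf z hz)
    simpa using this
  obtain ⟨c, U', hx', hU', hc⟩ := exists_sec_family_eq hx ht
  rw [tensorial_expand hD hx' (f := fun i y => f y i) (c := c)
    (fun i => (hfs i).mono hU') fun y hy => by simpa only [hc _ y hy] using hf y (hU' hy)]
  have h0 : ∀ i, f x i = 0 := by
    refine Fintype.linearIndependent_iff.1 (hli x hx) (f x) ?_
    have := congrArg (fun t : S x => (t : W x)) ((hf x hx).symm.trans hb0)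
    simpa using this
  simp [h0]

end Tensorial

/-! ### Transport of a Lie algebroid along a bundle isomorphism -/

section Transport

variable {m : ℕ} {M : Type*} [TopologicalSpace M] [ChartedSpace (Coord m) M]
  [IsManifold (𝓡 m) ∞ M] {R : Type*} {W : M → Type*}
  [NormedAddCommGroup R] [NormedSpace ℝ R]
  [∀ x, AddCommGroup (W x)] [∀ x, Module ℝ (W x)] [∀ x, TopologicalSpace (W x)]
  [TopologicalSpace (TotalSpace R W)] [FiberBundle R W] [VectorBundle ℝ R W]
  {S : Π x, Submodule ℝ (W x)}
  {R' : Type*} {W' : M → Type*} [NormedAddCommGroup R'] [NormedSpace ℝ R']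
  [∀ x, AddCommGroup (W' x)] [∀ x, Module ℝ (W' x)] [∀ x, TopologicalSpace (W' x)]
  [TopologicalSpace (TotalSpace R' W')] [FiberBundle R' W'] [VectorBundle ℝ R' W']
  {S' : Π x, Submodule ℝ (W' x)}

/-- The image of a section under a smooth vector bundle morphism. -/
def mapSec (θ : Π x, S x → S' x) (hθ : ∀ (U : Opens M) (s : Π x, S x), SmoothSubSection m R U s →
    SmoothSubSection m R' U (fun x => θ x (s x))) (a : Sec m R S) : Sec m R' S' :=
  ⟨fun x => θ x (a.1 x), hθ ⊤ a.1 a.2⟩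

variable (L : LieAlgebroid m R' S') (hS : IsVectorSubbundle m R S) (θ : Π x, S x ≃ₗ[ℝ] S' x)
  (hθ : ∀ (U : Opens M) (s : Π x, S x), SmoothSubSection m R U s →
    SmoothSubSection m R' U (fun x => θ x (s x)))
  (hθ' : ∀ (U : Opens M) (s : Π x, S' x), SmoothSubSection m R' U s →
    SmoothSubSection m R U (fun x => (θ x).symm (s x)))

/-- The Lie algebroid structure transported along an isomorphism of vector bundles. -/
def LieAlgebroid.transport : LieAlgebroid m R S :=
  have hpull : ∀ c : Sec m R' S', mapSec (fun x => θ x) hθ (mapSec (fun x => (θ x).symm) hθ' c) = c :=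
    fun c => Subtype.ext (funext fun x => (θ x).apply_symm_apply _)
  LieAlgebroid.ofBracket hS (fun x => (L.anchor x).comp (θ x).toLinearMap)
    (fun U s hs => L.anchor_smooth U _ (hθ U s hs))
    (fun a b => mapSec (fun x => (θ x).symm) hθ'
      (L.bracket (mapSec (fun x => θ x) hθ a) (mapSec (fun x => θ x) hθ b)))
    (fun a x => by
      change (θ x).symm _ = 0
      rw [L.bracket_self]
      exact map_zero _)
    (fun a b x => by
      change (θ x).symm _ = -(θ x).symm _
      rw [L.bracket_swap_apply, map_neg])
    (fun a b c x => by
      change (θ x).symm _ = (θ x).symm _ + (θ x).symm _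
      have h : mapSec (fun x => θ x) hθ (b + c) =
          mapSec (fun x => θ x) hθ b + mapSec (fun x => θ x) hθ c :=
        Subtype.ext (funext fun y => map_add (θ y) _ _)
      rw [← map_add, ← sec_add_apply, ← map_add, h])
    (fun a b c x => by
      simp only [hpull]
      change (θ x).symm _ + (θ x).symm _ + (θ x).symm _ = 0
      rw [← map_add, ← map_add, ← sec_add_apply, ← sec_add_apply, L.jacobi]
      exact map_zero _)
    (fun a b x => by
      change L.anchor x (θ x ((θ x).symm _)) = _
      rw [(θ x).apply_symm_apply, L.anchor_bracket]
      rfl)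
    (fun a b f hf x => by
      have h : mapSec (fun x => θ x) hθ (mulSec f hf b) =
          mulSec f hf (mapSec (fun x => θ x) hθ b) :=
        Subtype.ext (funext fun y => map_smul (θ y) _ _)
      change (θ x).symm _ = f x • (θ x).symm _ + dirDeriv f x (L.anchor x (θ x (a.1 x))) • b.1 x
      rw [h, L.leibniz, map_add, map_smul, map_smul]
      congr 2
      exact (θ x).symm_apply_apply _)

theorem LieAlgebroid.transport_bracket (a b : Sec m R S) (x : M) :
    ((L.transport hS θ hθ hθ').bracket a b).1 x =
      (θ x).symm ((L.bracket (mapSec (fun x => θ x) hθ a) (mapSec (fun x => θ x) hθ b)).1 x) := rfl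

theorem LieAlgebroid.isLieAlgebroidIso_transport :
    IsLieAlgebroidIso (L.transport hS θ hθ hθ') L θ where
  smooth := hθ
  smooth_symm := hθ'
  anchor _ _ := rfl
  bracket a b a' b' ha hb x := by
    rw [L.transport_bracket, (θ x).apply_symm_apply,
      show a' = mapSec (fun x => θ x) hθ a from Subtype.ext (funext ha),
      show b' = mapSec (fun x => θ x) hθ b from Subtype.ext (funext hb)]

end Transport

/-! ### Minimal extensions: the bracket defect, the splitting and the twist -/

section MinimalExtension

variable {m k : ℕ} {M : Type*} [TopologicalSpace M] [T2Space M] [ChartedSpace (Coord m) M]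
  [IsManifold (𝓡 m) ∞ M] {𝓕 : Foliation m k M} {RE : Type*} {E : M → Type*}
  [NormedAddCommGroup RE] [NormedSpace ℝ RE] [FiniteDimensional ℝ RE]
  [∀ x, AddCommGroup (E x)] [∀ x, Module ℝ (E x)] [∀ x, TopologicalSpace (E x)]
  [TopologicalSpace (TotalSpace RE E)] [FiberBundle RE E] [VectorBundle ℝ RE E]
  [ContMDiffVectorBundle ∞ RE E (𝓡 m)]
  {Φ : FoliatedStructure 𝓕 RE E} {T : TransLieAlgebroid Φ}

/-- A complement of `F` in `TM` gives a lift of `♯` that vanishes on its kernel. -/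
theorem exists_lift_of_complement [SigmaCompactSpace M] (T : TransLieAlgebroid Φ) :
    ∃ ρ : Π x : M, E x →ₗ[ℝ] TangentSpace (𝓡 m) x, IsLift T ρ ∧
      ∀ x e, T.anchor x e = 0 → ρ x e = 0 := by
  obtain ⟨p, hpF, hp, hps⟩ := exists_leaf_projection 𝓕
  have hker : ∀ x, 𝓕.tangent x ≤ LinearMap.ker (LinearMap.id - p x) := fun x v hv => by
    rw [LinearMap.mem_ker, LinearMap.sub_apply, hp x v hv]
    exact sub_self v
  -- With p the projection onto F, id − p descends to νℱ and splits ψ. Factoring through ♯ makes ρ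
  -- vanish on ker ♯.
  let ρ : Π x : M, E x →ₗ[ℝ] TangentSpace (𝓡 m) x := fun x =>
    ((𝓕.tangent x).liftQ (LinearMap.id - p x) (hker x)).comp (T.anchor x)
  have hρ : ∀ x e v, 𝓕.toNormal x v = T.anchor x e → ρ x e = v - p x v := fun x e v h => by
    change (𝓕.tangent x).liftQ (LinearMap.id - p x) (hker x) (T.anchor x e) = _
    rw [← h]
    exact Submodule.liftQ_apply _ _ _
  refine ⟨ρ, ⟨fun U e he => smoothSection_iff.2 fun x hx => ?_, fun x e => ?_⟩, fun x e h => ?_⟩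
  · obtain ⟨U', r, b, hx', hb⟩ := exists_folFrame Φ x
    -- The anchors of the frame are classes of smooth fields X_i, so ρb_i = X_i − pX_i is smooth.
    choose V hxV hVU X hX hXb using fun i => T.anchor_fol U' (b i) (hb.isFol i) x hx'
    refine SmoothSecAt.congr (s := fun y => ∑ i, frameCoeff b i y (e y) • (X i y - p y (X i y)))
      (SmoothSecAt.sum fun i _ => SmoothSecAt.smul (hb.smoothFunAt_coeff hx' (he.at hx) i)
        (SmoothSecAt.sub (SmoothSection.at (hX i).1 (hxV i))
          (SmoothSection.at (hps _ _ (hX i).1) (hxV i)))) ?_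
    have hV : ∀ᶠ y in nhds x, ∀ i, y ∈ V i :=
      Filter.eventually_all.2 fun i => (V i).isOpen.mem_nhds (hxV i)
    filter_upwards [hV, U'.isOpen.mem_nhds hx'] with y hy hyU
    conv_lhs => rw [hb.sum_coeff hyU (e y), map_sum]
    refine Finset.sum_congr rfl fun i _ => ?_
    rw [map_smul, hρ y _ _ (hXb i y (hy i))]
  · obtain ⟨v, hv⟩ := toNormal_surjective (𝓕 := 𝓕) x (T.anchor x e)
    rw [hρ x e v hv, map_sub, hv, (toNormal_eq_zero_iff 𝓕).2 (hpF x v), sub_zero]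
  · rw [hρ x e 0 (by rw [h, map_zero]), map_zero, sub_zero]

variable {R : Type*} {W : M → Type*} [NormedAddCommGroup R] [NormedSpace ℝ R]
  [FiniteDimensional ℝ R]
  [∀ x, AddCommGroup (W x)] [∀ x, Module ℝ (W x)] [∀ x, TopologicalSpace (W x)]
  [TopologicalSpace (TotalSpace R W)] [FiberBundle R W] [VectorBundle ℝ R W]
  [ContMDiffVectorBundle ∞ R W (𝓡 m)]
  {S : Π x, Submodule ℝ (W x)} {L : LieAlgebroid m R S} {B : Π x, Submodule ℝ (W x)}
  {σ : Π x, S x →ₗ[ℝ] E x}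

theorem LieAlgebroid.IsBFol.mono {U V : Opens M} {a : Sec m R S} (ha : L.IsBFol B U a)
    (hV : V ≤ U) : L.IsBFol B V a := fun V' hV' => ha V' (hV'.trans hV)

variable (T L σ) in
/-- The failure of `σ` to preserve the bracket of two sections. -/
def bracketDefect (a b : Sec m R S) (x : M) : E x :=
  σ x ((L.bracket a b).1 x) - transBracket T x (L.anchor x (a.1 x)) (L.anchor x (b.1 x))
    (fun y => σ y (a.1 y)) (fun y => σ y (b.1 y))

theorem bracketDefect_swap (a b : Sec m R S) (x : M) :
    bracketDefect T L σ a b x = -bracketDefect T L σ b a x := by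
  rw [bracketDefect, bracketDefect, L.bracket_swap_apply, map_neg, transBracket_swap]
  abel

variable (hA : IsMinimalExtension T L B σ)
include hA

theorem IsMinimalExtension.smooth_map (a : Sec m R S) (x : M) :
    SmoothSecAt m RE (fun y => σ y (a.1 y)) x := (hA.smooth ⊤ a.1 a.2).at trivial

theorem IsMinimalExtension.bracketDefect_add (a b c : Sec m R S) (x : M) :
    bracketDefect T L σ a (b + c) x = bracketDefect T L σ a b x + bracketDefect T L σ a c x := by
  have h := transBracket_add_right T (v := L.anchor x (a.1 x)) (v' := L.anchor x (b.1 x))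
    (w' := L.anchor x (c.1 x)) (e := fun y => σ y (a.1 y)) (hA.smooth_map b x) (hA.smooth_map c x)
  simp only [bracketDefect, map_add, sec_add_apply, h]
  abel

/-- Both brackets differentiate f along the same vector, the anchor of a, and multiply by σb; these
terms cancel. -/
theorem IsMinimalExtension.bracketDefect_mulSec (a : Sec m R S) (x : M) (f : M → ℝ)
    (hf : SmoothFun m ⊤ f) (b : Sec m R S) :
    bracketDefect T L σ a (mulSec f hf b) x = f x • bracketDefect T L σ a b x := by
  have h := transBracket_smul_right T (v := L.anchor x (a.1 x)) (v' := L.anchor x (b.1 x))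
    (e := fun y => σ y (a.1 y)) (hf.at trivial) (hA.smooth_map b x)
  simp only [bracketDefect, map_add, map_smul, mulSec_apply, L.leibniz, h, smul_sub]
  abel

/-- The bracket defect as a function of its second argument. -/
def IsMinimalExtension.defectHom (a : Sec m R S) (x : M) : Sec m R S →+ E x :=
  AddMonoidHom.mk' (fun b => bracketDefect T L σ a b x) fun b c => hA.bracketDefect_add a b c x

theorem IsMinimalExtension.bracketDefect_congr_right (a : Sec m R S) {b b' : Sec m R S} {x : M}
    (h : b.1 x = b'.1 x) : bracketDefect T L σ a b x = bracketDefect T L σ a b' x :=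
  tensorial_congr (D := hA.defectHom a x) L.isVectorSubbundle (hA.bracketDefect_mulSec a x) h

/-- B-foliated sections generate locally and the defect is tensorial, so it can be tested on them.
-/
theorem IsMinimalExtension.bracketDefect_eq_zero_of_isBFol {a : Sec m R S} {x : M}
    (h : ∀ (U : Opens M) (c : Sec m R S), x ∈ U → L.IsBFol B U c → bracketDefect T L σ a c x = 0)
    (b : Sec m R S) : bracketDefect T L σ a b x = 0 := by
  obtain ⟨U, hx, r, c, f, hc, hf, hbf⟩ := hA.foliated.generation b x
  have := tensorial_expand (D := hA.defectHom a x) (hA.bracketDefect_mulSec a x) hx hf hbf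
  refine this.trans (Finset.sum_eq_zero fun i _ => ?_)
  change f i x • bracketDefect T L σ a (c i) x = 0
  rw [h U (c i) hx (hc i), smul_zero]

theorem IsMinimalExtension.anchor_mem_tangent {x : M} {a : S x} (ha : (a : W x) ∈ B x) :
    L.anchor x a ∈ 𝓕.tangent x := (hA.foliated.map_anchor x _).2 ⟨a, ha, rfl⟩

/-- By tensoriality a may be replaced by a section of B with the same value. Its bracket with a
B-foliated section lies in B = ker σ, and the model bracket vanishes by `transBracket_leaf_left`.
Hence the defect depends only on the images in E. -/
theorem IsMinimalExtension.bracketDefect_eq_zero_of_left {a : Sec m R S} {x : M}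
    (ha : σ x (a.1 x) = 0) (b : Sec m R S) : bracketDefect T L σ a b x = 0 := by
  obtain ⟨a', ha', hax⟩ := hA.foliated.isVectorSubbundle.exists_sec hA.foliated.le (a.1 x)
    ((hA.ker x _).1 ha)
  rw [bracketDefect_swap, ← hA.bracketDefect_congr_right b hax, ← bracketDefect_swap]
  refine hA.bracketDefect_eq_zero_of_isBFol (fun U c hx hc => ?_) b
  rw [bracketDefect, (hA.ker x _).2 (hc U le_rfl a' (fun y _ => ha' y) x hx),
    transBracket_leaf_left T hx (fun y _ => (hA.ker y _).2 (ha' y)) ((hA.isFol_iff U c).2 hc)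
    (hA.anchor_mem_tangent (ha' x)) (hA.anchor_comm x _), sub_zero]

theorem IsMinimalExtension.bracketDefect_congr {a a' b b' : Sec m R S} {x : M}
    (ha : σ x (a.1 x) = σ x (a'.1 x)) (hb : σ x (b.1 x) = σ x (b'.1 x)) :
    bracketDefect T L σ a b x = bracketDefect T L σ a' b' x := by
  have key : ∀ a a' b : Sec m R S, σ x (a.1 x) = σ x (a'.1 x) →
      bracketDefect T L σ b a x = bracketDefect T L σ b a' x := fun a a' b h => by
    have h0 : σ x ((a - a').1 x) = 0 := by
      change σ x (a.1 x - a'.1 x) = 0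
      rw [map_sub, h, sub_self]
    have h1 : bracketDefect T L σ b (a - a') x = 0 := by
      rw [bracketDefect_swap, hA.bracketDefect_eq_zero_of_left h0, neg_zero]
    exact sub_eq_zero.1 ((map_sub (hA.defectHom b x) a a').symm.trans h1)
  rw [key b b' a hb, bracketDefect_swap, key a a' b' ha, ← bracketDefect_swap]

theorem IsMinimalExtension.exists_sec_map_eq (x : M) (e : E x) :
    ∃ a : Sec m R S, σ x (a.1 x) = e := by
  obtain ⟨s, hs⟩ := hA.surjective x e
  obtain ⟨a, -, ha⟩ := L.isVectorSubbundle.exists_sec (fun _ => le_rfl) s s.2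
  exact ⟨a, by rw [ha, hs]⟩

/-- The bracket defect, as a `2`-form on `E`. -/
def IsMinimalExtension.twist (x : M) : E x →ₗ[ℝ] E x →ₗ[ℝ] E x :=
  -- An arbitrary section over each vector; `bracketDefect_congr` makes the choice immaterial, which
  -- also yields bilinearity.
  let s := fun e : E x => (hA.exists_sec_map_eq x e).choose
  have hs : ∀ e, σ x ((s e).1 x) = e := fun e => (hA.exists_sec_map_eq x e).choose_spec
  have hadd : ∀ u v w : E x, bracketDefect T L σ (s u) (s (v + w)) x =
      bracketDefect T L σ (s u) (s v) x + bracketDefect T L σ (s u) (s w) x := fun u v w => by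
    rw [← hA.bracketDefect_add]
    exact hA.bracketDefect_congr rfl (by rw [sec_add_apply, map_add, hs, hs, hs])
  have hsmul : ∀ (c : ℝ) (u v : E x), bracketDefect T L σ (s u) (s (c • v)) x =
      c • bracketDefect T L σ (s u) (s v) x := fun c u v => by
    have hc : SmoothFun m ⊤ (fun _ : M => c) := contMDiffOn_const
    rw [← hA.bracketDefect_mulSec _ _ (fun _ => c) hc]
    exact hA.bracketDefect_congr rfl (by rw [mulSec_apply, map_smul, hs, hs])
  LinearMap.mk₂ ℝ (fun u v => bracketDefect T L σ (s u) (s v) x)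
    (fun u v w => by
      rw [bracketDefect_swap, hadd, neg_add, ← bracketDefect_swap, ← bracketDefect_swap])
    (fun c u v => by rw [bracketDefect_swap, hsmul, ← smul_neg, ← bracketDefect_swap])
    hadd hsmul

theorem IsMinimalExtension.twist_map (a b : Sec m R S) (x : M) :
    hA.twist x (σ x (a.1 x)) (σ x (b.1 x)) = bracketDefect T L σ a b x :=
  hA.bracketDefect_congr (hA.exists_sec_map_eq x _).choose_spec
    (hA.exists_sec_map_eq x _).choose_spec

theorem IsMinimalExtension.map_bracket (a b : Sec m R S) (x : M) :
    σ x ((L.bracket a b).1 x) = transBracket T x (L.anchor x (a.1 x)) (L.anchor x (b.1 x))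
      (fun y => σ y (a.1 y)) (fun y => σ y (b.1 y)) + hA.twist x (σ x (a.1 x)) (σ x (b.1 x)) := by
  rw [hA.twist_map, bracketDefect]
  abel

theorem IsMinimalExtension.bracketDefect_of_isBFol {U : Opens M} {a b : Sec m R S}
    (ha : L.IsBFol B U a) (hb : L.IsBFol B U b) {x : M} (hx : x ∈ U) :
    bracketDefect T L σ a b x = σ x ((L.bracket a b).1 x) -
      T.bracket (fun y => σ y (a.1 y)) (fun y => σ y (b.1 y)) x := by
  rw [bracketDefect, transBracket_of_isFol T hx ((hA.isFol_iff U a).2 ha) ((hA.isFol_iff U b).2 hb)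
    (hA.anchor_comm x _) (hA.anchor_comm x _)]

/-- The hypothesis kills the defect on pairs of B-foliated sections; generation is then applied in
each argument in turn. -/
theorem IsMinimalExtension.twist_eq_zero (h : PreservesBrackets T L B σ) (x : M) :
    hA.twist x = 0 := by
  refine LinearMap.ext fun u => LinearMap.ext fun v => ?_
  obtain ⟨a, rfl⟩ := hA.exists_sec_map_eq x u
  obtain ⟨b, rfl⟩ := hA.exists_sec_map_eq x v
  rw [hA.twist_map]
  refine hA.bracketDefect_eq_zero_of_isBFol (fun U d hxU hd => ?_) b
  rw [bracketDefect_swap, neg_eq_zero]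
  refine hA.bracketDefect_eq_zero_of_isBFol (fun V c hxV hc => ?_) a
  rw [hA.bracketDefect_of_isBFol (U := U ⊓ V) (hd.mono inf_le_left) (hc.mono inf_le_right)
    ⟨hxU, hxV⟩, h (U ⊓ V) d c (hd.mono inf_le_left) (hc.mono inf_le_right) x ⟨hxU, hxV⟩, sub_self]

omit hA in
-- Jacobi: [c, [a, b]] = −[a, [b, c]] − [b, [c, a]], and bracketing with a or b keeps sections of B
-- in B. Needed for the twist to be foliated.
theorem LieAlgebroid.IsBFol.bracket {U : Opens M} {a b : Sec m R S} (ha : L.IsBFol B U a)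
    (hb : L.IsBFol B U b) : L.IsBFol B U (L.bracket a b) := by
  intro V hV c hc x hx
  have h1 : ∀ y ∈ V, ((L.bracket b c).1 y : W y) ∈ B y := fun y hy => by
    rw [L.bracket_swap_apply]
    exact Submodule.neg_mem _ (hb V hV c hc y hy)
  have h2 : ∀ y ∈ V, ((L.bracket c a).1 y : W y) ∈ B y := ha V hV c hc
  have h3 : ((L.bracket a (L.bracket b c)).1 x : W x) ∈ B x := by
    rw [L.bracket_swap_apply]
    exact Submodule.neg_mem _ (ha V hV _ h1 x hx)
  have h4 : ((L.bracket b (L.bracket c a)).1 x : W x) ∈ B x := by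
    rw [L.bracket_swap_apply]
    exact Submodule.neg_mem _ (hb V hV _ h2 x hx)
  have h5 := congrArg (fun s : Sec m R S => (s.1 x : W x)) (L.jacobi c a b)
  have h6 : ((L.bracket c (L.bracket a b)).1 x : W x) = -((L.bracket a (L.bracket b c)).1 x : W x) -
      ((L.bracket b (L.bracket c a)).1 x : W x) := by
    have h5 : ((L.bracket c (L.bracket a b)).1 x : W x) + (L.bracket a (L.bracket b c)).1 x +
      (L.bracket b (L.bracket c a)).1 x = 0 := h5
    rw [eq_sub_iff_add_eq, eq_neg_iff_add_eq_zero, ← h5]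
    abel
  rw [h6]
  exact Submodule.sub_mem _ (Submodule.neg_mem _ h3) h4

variable {ρ : Π x : M, E x →ₗ[ℝ] TangentSpace (𝓡 m) x} (hρ : IsLift T ρ)
include hρ

/-- Under ♯ both σ[a, b] and the model bracket become the class of [♯a, ♯b]. -/
theorem IsMinimalExtension.anchor_twist (x : M) (u v : E x) :
    T.anchor x (hA.twist x u v) = 0 := by
  obtain ⟨a, rfl⟩ := hA.exists_sec_map_eq x u
  obtain ⟨b, rfl⟩ := hA.exists_sec_map_eq x v
  have h1 : ∀ a : Sec m R S, SmoothVF ⊤ (fun y => L.anchor y (a.1 y)) := fun a =>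
    L.anchor_smooth ⊤ a.1 a.2
  have h2 := hρ.anchor_transBracket (h1 a) (h1 b) (hA.smooth ⊤ a.1 a.2) (hA.smooth ⊤ b.1 b.2)
    (fun y _ => hA.anchor_comm y _) (fun y _ => hA.anchor_comm y _) (x := x) trivial
  rw [hA.twist_map, bracketDefect, map_sub, h2, ← hA.anchor_comm, L.anchor_bracket, sub_self]

/-- The isomorphism `A → F ⊕ E` given by a lift. -/
def IsMinimalExtension.splitting (x : M) : S x ≃ₗ[ℝ] sumBundle 𝓕 E x :=
  have hmem : ∀ a : S x, L.anchor x a - ρ x (σ x a) ∈ 𝓕.tangent x := fun a => by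
    rw [← toNormal_eq_zero_iff, map_sub, hρ.proj, hA.anchor_comm, sub_self]
  LinearEquiv.ofBijective
    { toFun := fun a => sumMk (L.anchor x a - ρ x (σ x a)) (hmem a) (σ x a)
      map_add' := fun a b => sumBundle_ext
        (by rw [(leafPart x).map_add]; simp only [leafPart_sumMk, map_add]; abel)
        (by rw [(transPart x).map_add]; simp only [transPart_sumMk, map_add])
      map_smul' := fun c a => sumBundle_ext
        (by rw [(leafPart x).map_smul]; simp [smul_sub])
        (by rw [(transPart x).map_smul]; simp) }
    (by
      constructor
      · refine (injective_iff_map_eq_zero _).2 fun a ha => ?_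
        -- An element of the kernel lies in ker σ = B, where the anchor is injective.
        have h1 : σ x a = 0 := congrArg (transPart x) ha
        have h2 : L.anchor x a - ρ x (σ x a) = 0 := congrArg (leafPart x) ha
        rw [h1, map_zero, sub_zero] at h2
        exact hA.foliated.anchor_injective x a ((hA.ker x a).1 h1) h2
      · intro w
        obtain ⟨a, ha⟩ := hA.surjective x (transPart x w)
        -- After matching the E-component, the remaining error is a leaf vector, which is the anchor
        -- of an element of B.
        obtain ⟨b, hb, hbv⟩ := (hA.foliated.map_anchor x
          (leafPart x w - (L.anchor x a - ρ x (σ x a)))).1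
          (Submodule.sub_mem _ (leafPart_mem w) (hmem a))
        have hb0 := (hA.ker x b).2 hb
        refine ⟨a + b, sumBundle_ext ?_ ?_⟩
        · change L.anchor x (a + b) - ρ x (σ x (a + b)) = _
          rw [map_add, map_add, hb0, add_zero, hbv]
          abel
        · change σ x (a + b) = _
          rw [map_add, hb0, add_zero, ha])

theorem IsMinimalExtension.leafPart_splitting {x : M} (a : S x) :
    leafPart x (hA.splitting hρ x a) = L.anchor x a - ρ x (σ x a) := rfl

theorem IsMinimalExtension.transPart_splitting {x : M} (a : S x) :
    transPart x (hA.splitting hρ x a) = σ x a := rfl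

theorem IsMinimalExtension.smooth_splitting (U : Opens M) (s : Π x, S x)
    (hs : SmoothSubSection m R U s) :
    SmoothSubSection m (Coord m × RE) U (fun x => hA.splitting hρ x (s x)) :=
  smoothSubSection_iff.2 ⟨smoothSection_iff.2 fun _ hx =>
    SmoothSecAt.sub (SmoothSection.at (L.anchor_smooth U s hs) hx)
      (SmoothSection.at (hρ.smooth U _ (hA.smooth U s hs)) hx), hA.smooth U s hs⟩

theorem IsMinimalExtension.smooth_splitting_symm (U : Opens M) (s : Π x, sumBundle 𝓕 E x)
    (hs : SmoothSubSection m (Coord m × RE) U s) :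
    SmoothSubSection m R U (fun x => (hA.splitting hρ x).symm (s x)) :=
  smooth_symm_of_smooth L.isVectorSubbundle (hA.splitting hρ) (hA.smooth_splitting hρ) U s hs

theorem IsMinimalExtension.map_splitting_symm {x : M} (w : sumBundle 𝓕 E x) :
    σ x ((hA.splitting hρ x).symm w) = transPart x w := by
  rw [← hA.transPart_splitting hρ, LinearEquiv.apply_symm_apply]

theorem IsMinimalExtension.anchor_splitting_symm {x : M} (w : sumBundle 𝓕 E x) :
    L.anchor x ((hA.splitting hρ x).symm w) = canonicalAnchor ρ x w := by
  have h := hA.leafPart_splitting hρ ((hA.splitting hρ x).symm w)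
  rw [LinearEquiv.apply_symm_apply, hA.map_splitting_symm] at h
  rw [canonicalAnchor_apply, h, sub_add_cancel]

theorem IsMinimalExtension.isTwist_twist : IsTwist T hA.twist where
  alternating x e := by
    obtain ⟨a, rfl⟩ := hA.exists_sec_map_eq x e
    rw [hA.twist_map, bracketDefect, L.bracket_self, transBracket_self, sub_zero]
    exact map_zero _
  anchor_zero := hA.anchor_twist hρ
  foliated U e₁ e₂ h₁ h₂ := by
    refine Φ.glue _ _ fun x hx => ?_
    have hs : ∀ {e : Π x, E x}, Φ.IsFol U e → SmoothSubSection m R U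
        (fun y => (hA.splitting hρ y).symm (transMk 𝓕 E e y)) := fun he =>
      hA.smooth_splitting_symm hρ U _ (smooth_transMk (isFol_smooth he))
    -- Sections of A over e₁ (index `true`) and e₂ (index `false`) are B-foliated near x. The twist
    -- is then σ[a₁, a₂] − [e₁, e₂]_E, a combination of foliated sections with coefficients 1 and
    -- −1.
    obtain ⟨a, V, hxV, hV, hav⟩ := exists_sec_family_eq hx
      (s := fun (i : Bool) y => (hA.splitting hρ y).symm (transMk 𝓕 E (cond i e₁ e₂) y))
      (fun i => by cases i; exacts [hs h₂, hs h₁])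
    have hσ : ∀ i, ∀ y ∈ V, σ y ((a i).1 y) = cond i e₁ e₂ y := fun i y hy => by
      rw [hav i y hy, hA.map_splitting_symm]; rfl
    have hfol : ∀ i, Φ.IsFol V (fun y => σ y ((a i).1 y)) := fun i =>
      Φ.congr _ _ _ (fun y hy => (hσ i y hy).symm) (Φ.restrict _ _ _ hV (by cases i; exacts [h₂, h₁]))
    have hB : ∀ i, L.IsBFol B V (a i) := fun i => (hA.isFol_iff V (a i)).1 (hfol i)
    refine ⟨V, hxV, hV, Φ.congr _ _ _ (fun y hy => ?_) (isFol_sum_smul (ι := Bool)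
      (c := fun i => cond i (fun y => σ y ((L.bracket (a true) (a false)).1 y))
        (T.bracket (fun y => σ y ((a true).1 y)) (fun y => σ y ((a false).1 y))))
      (f := fun i _ => cond i 1 (-1)) (fun i => ?_) fun i => isFolFun_const V _)⟩
    · have h := hA.twist_map (a true) (a false) y
      rw [hσ _ y hy, hσ _ y hy, hA.bracketDefect_of_isBFol (hB true) (hB false) hy] at h
      refine Eq.trans ?_ h.symm
      rw [Fintype.sum_bool]
      simp only [cond_true, cond_false, one_smul, neg_one_smul, sub_eq_add_neg]
    · cases i
      · exact T.bracket_fol V _ _ (hfol true) (hfol false)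
      · exact (hA.isFol_iff V _).2 ((hB true).bracket (hB false))

/-- The Lie algebroid structure of `F ⊕ E` that corresponds to a minimal extension. -/
def IsMinimalExtension.splitAlgebroid : LieAlgebroid m (Coord m × RE) (sumBundle 𝓕 E) :=
  L.transport (isVectorSubbundle_sumBundle Φ) (fun x => (hA.splitting hρ x).symm)
    (hA.smooth_splitting_symm hρ) (hA.smooth_splitting hρ)

/-- The twist has values in ker ♯, where this lift vanishes, so it enters only the E-component of
the bracket. -/
theorem IsMinimalExtension.isTwistedCanonical_splitAlgebroid
    (hρ0 : ∀ x e, T.anchor x e = 0 → ρ x e = 0) :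
    IsTwistedCanonical T ρ hA.twist (hA.splitAlgebroid hρ) := by
  refine hρ.isTwistedCanonical_of (fun x a => hA.anchor_splitting_symm hρ a)
    (fun x u v => hρ0 x _ (hA.anchor_twist hρ x u v)) fun a b x => ?_
  rw [IsMinimalExtension.splitAlgebroid, LieAlgebroid.transport_bracket]
  refine (hA.transPart_splitting hρ _).trans ?_
  rw [hA.map_bracket]
  simp only [mapSec, hA.map_splitting_symm, hA.anchor_splitting_symm]

end MinimalExtension

end FolAlg

end

open FolAlg in
theorem proposition1p3 {m k : ℕ} {M : Type*} [TopologicalSpace M] [T2Space M]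
    [SigmaCompactSpace M] [ChartedSpace (Coord m) M] [IsManifold (𝓡 m) ∞ M]
    (𝓕 : Foliation m k M)
    {RE : Type*} {E : M → Type*} [NormedAddCommGroup RE] [NormedSpace ℝ RE]
    [FiniteDimensional ℝ RE]
    [∀ x, AddCommGroup (E x)] [∀ x, Module ℝ (E x)] [∀ x, TopologicalSpace (E x)]
    [TopologicalSpace (TotalSpace RE E)] [FiberBundle RE E] [VectorBundle ℝ RE E]
    [ContMDiffVectorBundle ∞ RE E (𝓡 m)]
    (Φ : FoliatedStructure 𝓕 RE E) (T : TransLieAlgebroid Φ) :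
    (∀ ρ : Π x : M, E x →ₗ[ℝ] TangentSpace (𝓡 m) x, IsLift T ρ →
      ∃ L : LieAlgebroid m (Coord m × RE) (sumBundle 𝓕 E),
        IsTwistedCanonical T ρ (fun _ => 0) L ∧
        IsMinimalExtension T L (leafBundle 𝓕 E) transPart ∧
        PreservesBrackets T L (leafBundle 𝓕 E) transPart ∧
        ∀ L' : LieAlgebroid m (Coord m × RE) (sumBundle 𝓕 E),
          IsTwistedCanonical T ρ (fun _ => 0) L' → L' = L) ∧
    (∀ {R : Type*} {W : M → Type*} [NormedAddCommGroup R] [NormedSpace ℝ R]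
      [FiniteDimensional ℝ R]
      [∀ x, AddCommGroup (W x)] [∀ x, Module ℝ (W x)] [∀ x, TopologicalSpace (W x)]
      [TopologicalSpace (TotalSpace R W)] [FiberBundle R W] [VectorBundle ℝ R W]
      [ContMDiffVectorBundle ∞ R W (𝓡 m)]
      (S : Π x, Submodule ℝ (W x)) (L : LieAlgebroid m R S) (B : Π x, Submodule ℝ (W x))
      (σ : Π x, S x →ₗ[ℝ] E x), IsMinimalExtension T L B σ →
      ∃ (ρ : Π x : M, E x →ₗ[ℝ] TangentSpace (𝓡 m) x) (μ : Π x, E x →ₗ[ℝ] E x →ₗ[ℝ] E x)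
        (L₀ : LieAlgebroid m (Coord m × RE) (sumBundle 𝓕 E)) (θ : Π x, sumBundle 𝓕 E x ≃ₗ[ℝ] S x),
        IsLift T ρ ∧ IsTwist T μ ∧ IsTwistedCanonical T ρ μ L₀ ∧
        IsLieAlgebroidIso L₀ L θ ∧ (∀ x a, σ x (θ x a) = transPart x a) ∧
        (PreservesBrackets T L B σ → ∀ x, μ x = 0)) := by
  refine ⟨fun ρ hρ => ⟨hρ.canonical, hρ.isTwistedCanonical_canonical,
    hρ.isMinimalExtension_canonical, hρ.preservesBrackets_canonical,
    fun L' hL' => hL'.unique hρ.isTwistedCanonical_canonical⟩, ?_⟩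
  intro R W _ _ _ _ _ _ _ _ _ _ S L B σ hA
  obtain ⟨ρ, hρ, hρ0⟩ := exists_lift_of_complement T
  exact ⟨ρ, hA.twist, hA.splitAlgebroid hρ, fun x => (hA.splitting hρ x).symm, hρ,
    hA.isTwist_twist hρ, hA.isTwistedCanonical_splitAlgebroid hρ hρ0,
    L.isLieAlgebroidIso_transport _ _ _ _, fun x a => hA.map_splitting_symm hρ a,
    hA.twist_eq_zero⟩
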